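/- Let $M$ be a compact smooth manifold with boundary, $\dim M=4k$, with fibred boundary: $W=\partial M$ is oriented and is the total space of a smooth fibre bundle $F\to W\overset{\phi}{\to}N$ with $F$, $N$ closed manifolds. Fix a boundary defining function $x$, a collar $[0,1)_x\times W\hookrightarrow M$ compatible with $x$, and a smooth splitting $TW=T^VW\oplus T^HW$ with $T^VW=\ker d\phi$. The $\phi$-tangent bundle ${}^\phi TM$ is locally spanned over the collar, up to $x=0$, by $x^2\partial_x$, by $xY$ with $Y$ a horizontal lift of a vector field of $N$, and by vertical vector fields. Let $h$ be a Riemannian metric on $N$, let $\tau$ be a smooth field of symmetric bilinear forms on $TW$ which vanishes on $T^HW$ and restricts to a Riemannian metric on each fibre, and let $\tilde g_\phi=\frac{dx^2}{x^4}+\frac{\phi^*h}{x^2}+\tau$. Let $g_\phi$ be an exact $\phi$-metric, i.e. a smooth Riemannian metric on the interior of $M$ which on the collar has the form $$g_\phi=\tilde g_\phi+xA+x^2B,$$ where $A,B$ are smooth (up to $x=0$) sections of $S^2[{}^\phi T^*M]$ over the collar, and $A$ satisfies, for all horizontal lifts $Y,Y_1,Y_2$ of vector fields of $N$ and all vertical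 vector fields $V_1,V_2$ on $W$: (i) $A(x^2\partial_x,\cdot)\equiv0$ and $A(xY_1,xY_2)=O(x)$; (ii) $\big(V_1\cdot A(V_2,xY)-V_2\cdot A(V_1,xY)-A([V_1,V_2],xY)\big)|_{x=0}=0$. Let $\hat g_\varepsilon=\frac{dx^2}{\varepsilon^4}+\frac{\phi^*h}{\varepsilon^2}+\kappa_\varepsilon(x)$, $0<\varepsilon<1$, be asymptotic auxiliary metrics near $\partial M$, where the symmetric bilinear forms $\kappa_\varepsilon(x)$ on $TW$ are smooth in $(\varepsilon,x)\in[0,1)^2$ and in the point of $W$, such that $\hat g_\varepsilon$ and $\tilde g_\phi+xA$ have the same restriction to the hypersurface $\partial M_\varepsilon=\{x=\varepsilon\}$ (for instance $\kappa_\varepsilon(x)=\tau+xA$, or $\kappa_\varepsilon(x)=\tau+\varepsilon A|_{x=\varepsilon}$). Let ${}^\varepsilon\hat\nabla$ and ${}^\phi\nabla$ be the Levi-Civita connections of $\hat g_\varepsilon$ and $g_\phi$. For an invariant polynomial $P$ of degree $2k$, with polarization also denoted by $P$, and a path of connections $(\nabla_t)_{0\le t\le1}$ from ${}^\varepsilon\hat\nabla$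 to ${}^\phi\nabla$ with connection forms $\omega_t$ and curvature $\Omega_t$, the transgression form is $TP=\int_0^1 2k\,P(\dot\omega_t,\Omega_t,\dots,\Omega_t)\,dt$. For the Hirzebruch polynomial $L=L_k(p_1,\dots,p_k)$ in the Pontryagin forms given by $\det(1+\Omega/2\pi)=1+p_1+p_2+\cdots$, take $\nabla_t={}^\varepsilon\hat\nabla+t({}^\phi\nabla-{}^\varepsilon\hat\nabla)$. For the Euler form $e=\mathrm{Pf}(\Omega/2\pi)$, take for $\nabla_t$ the Levi-Civita connection of $g_t=(1-t)\hat g_\varepsilon+tg_\phi$, in $g_t$-orthonormal oriented frames, with $\dot\omega_t$ replaced by its $g_t$-skew part (this is the same affine path along $\partial M_\varepsilon$ whenever $\hat g_\varepsilon=g_\phi$ there). If $\dim F$ is odd, the Chern–Simons correction associated to the Euler form vanishes: $$e_{CS}(\partial M,{}^\phi\nabla)=-\lim_{\varepsilon\to0^+}\int_{\partial M_\varepsilon}Te(M,{}^\varepsilon\hat\nabla,{}^\phi\nabla)=0.$$ If $\dim F=1$, the Chern–Simons correction associated to the Hirzebruch $L$-polynomial also vanishes: $$L_{CS}(\partial M,{}^\phi\nabla)=-\lim_{\varepsilon\to0^+}\int_{\partial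 M_\varepsilon}TL(M,{}^\varepsilon\hat\nabla,{}^\phi\nabla)=0.$$ In both cases the existence of the limit is part of the statement. -/

import Mathlib

open scoped Manifold ContDiff Topology Bundle
open Set Filter MeasureTheory

noncomputable section

namespace PhiCS

/-! ### Invariant polynomials -/

/-- The polarization of a homogeneous polynomial function `p` of degree `m` on matrices: the
symmetric `m`-linear function `P` with `P (X, …, X) = p X`. -/
def polarize {κ : Type*} {m : ℕ} (p : Matrix κ κ ℝ → ℝ) (X : Fin m → Matrix κ κ ℝ) : ℝ :=
  (m.factorial : ℝ)⁻¹ * ∑ S : Finset (Fin m), (-1 : ℝ) ^ (m - S.card) * p (∑ j ∈ S, X j)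

/-- The Pfaffian of a `2m × 2m` matrix with respect to an ordering `e` of the index type,
`1 / (2 ^ m m!) ∑ σ, sign σ ∏ j, X (σ (2j)) (σ (2j+1))`. -/
def pfaffian {κ : Type*} {m : ℕ} (e : Fin (2 * m) ≃ κ) (X : Matrix κ κ ℝ) : ℝ :=
  ((2 : ℝ) ^ m * (m.factorial : ℝ))⁻¹ *
    ∑ σ : Equiv.Perm (Fin (2 * m)), ((Equiv.Perm.sign σ : ℤ) : ℝ) *
      ∏ j : Fin m, X (e (σ ⟨2 * (j : ℕ), by omega⟩)) (e (σ ⟨2 * (j : ℕ) + 1, by omega⟩))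

/-- The `j`-th Pontryagin polynomial: the part of degree `2j` of `det (1 + X)`. -/
def pontryagin {κ : Type*} [Fintype κ] [DecidableEq κ] (j : ℕ) (X : Matrix κ κ ℝ) : ℝ :=
  (Matrix.det (1 + (Polynomial.X : Polynomial ℝ) • X.map Polynomial.C)).coeff (2 * j)

/-- The part of degree `k` of `∏ j, √z_j / tanh √z_j` in the variables `z_1, …, z_k`, where
`√z / tanh √z = ∑ r, 2 ^ (2r) B_(2r) / (2r)! z ^ r`. -/
def hirzebruchRoots (k : ℕ) : MvPolynomial (Fin k) ℚ :=
  MvPolynomial.homogeneousComponent k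
    (∏ j : Fin k, ∑ r ∈ Finset.range (k + 1),
      MvPolynomial.C ((2 : ℚ) ^ (2 * r) * bernoulli (2 * r) / ((2 * r).factorial : ℚ)) *
        MvPolynomial.X j ^ r)

theorem hirzebruchRoots_isSymmetric (k : ℕ) : (hirzebruchRoots k).IsSymmetric := by
  intro e
  unfold hirzebruchRoots
  rw [MvPolynomial.rename_homogeneousComponent]
  congr 1
  simp only [map_prod, map_sum, map_mul, map_pow, MvPolynomial.rename_C, MvPolynomial.rename_X]
  exact Equiv.prod_comp e (fun j => ∑ r ∈ Finset.range (k + 1),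
      MvPolynomial.C ((2 : ℚ) ^ (2 * r) * bernoulli (2 * r) / ((2 * r).factorial : ℚ)) *
        MvPolynomial.X j ^ r)

/-- The Hirzebruch polynomial `L_k (p_1, …, p_k)`: the unique polynomial which becomes
`hirzebruchRoots k` when `p_j` is the `j`-th elementary symmetric polynomial. The variable of
index `j : Fin k` is `p_(j+1)`. -/
def hirzebruchPoly (k : ℕ) : MvPolynomial (Fin k) ℚ :=
  (MvPolynomial.esymmAlgEquiv (Fin k) ℚ (Fintype.card_fin k)).symm
    ⟨hirzebruchRoots k, hirzebruchRoots_isSymmetric k⟩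

/-- `X ↦ L_k (p_1 (X / 2π), …, p_k (X / 2π))`, homogeneous of degree `2k`. -/
def hirzebruchL {κ : Type*} [Fintype κ] [DecidableEq κ] (k : ℕ) (X : Matrix κ κ ℝ) : ℝ :=
  MvPolynomial.aeval (fun j : Fin k => pontryagin ((j : ℕ) + 1) ((2 * Real.pi)⁻¹ • X))
    (hirzebruchPoly k)

/-! ### Riemannian geometry in coordinates `(x, u)` of a cylinder

The coordinates are indexed by `Option ι`, where `none` is the coordinate `x`. -/

section Coordinates

variable {ι : Type*} [Fintype ι] [DecidableEq ι]

/-- The coordinate vector `∂_α`. -/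
def coordVec : Option ι → ℝ × EuclideanSpace ℝ ι
  | none => (1, 0)
  | some i => (0, EuclideanSpace.single i 1)

/-- The partial derivative `∂_α F`. -/
def pd (α : Option ι) (F : ℝ × EuclideanSpace ℝ ι → ℝ) (p : ℝ × EuclideanSpace ℝ ι) : ℝ :=
  fderiv ℝ F p (coordVec α)

/-- A matrix of 1-forms: `Γ p μ` is the value at `p` on `∂_μ`. -/
abbrev ConnForm (ι : Type*) : Type _ :=
  ℝ × EuclideanSpace ℝ ι → Option ι → Matrix (Option ι) (Option ι) ℝ

/-- The Levi-Civita connection form, in the frame `∂_α`, of the metric with components `G`: the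
entry `(α, β)` of the value on `∂_μ` is the Christoffel symbol `Γ^α_(βμ)`. -/
def leviCivita (G : ℝ × EuclideanSpace ℝ ι → Matrix (Option ι) (Option ι) ℝ) : ConnForm ι :=
  fun p μ => Matrix.of fun α β => ∑ ν, ((G p)⁻¹ α ν / 2) *
    (-pd ν (fun q => G q β μ) p + pd β (fun q => G q μ ν) p + pd μ (fun q => G q ν β) p)

/-- The curvature form `dΓ + Γ ∧ Γ`, evaluated on `∂_μ, ∂_ν`. -/
def curvature (Γ : ConnForm ι) (p : ℝ × EuclideanSpace ℝ ι) (μ ν : Option ι) :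
    Matrix (Option ι) (Option ι) ℝ :=
  (Matrix.of fun α β => pd μ (fun q => Γ q ν α β) p - pd ν (fun q => Γ q μ α β) p) +
    (Γ p μ * Γ p ν - Γ p ν * Γ p μ)

/-- For a symmetric multilinear function `P`, a matrix `θ` of 1-forms and a matrix `Ω` of 2-forms
on the hypersurface with coordinates `u`, the value of the top degree form `P (θ, Ω, …, Ω)` on the
coordinate vectors in the order `o`. -/
def topForm {κ : Type*} {q : ℕ} (o : Fin (2 * q + 1) ≃ ι)
    (P : (Fin (q + 1) → Matrix κ κ ℝ) → ℝ)
    (θ : ι → Matrix κ κ ℝ) (Ω : ι → ι → Matrix κ κ ℝ) : ℝ :=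
  ((2 : ℝ) ^ q)⁻¹ * ∑ σ : Equiv.Perm (Fin (2 * q + 1)), ((Equiv.Perm.sign σ : ℤ) : ℝ) *
    P (Fin.cons (θ (o (σ 0))) fun j : Fin q =>
      Ω (o (σ ⟨2 * (j : ℕ) + 1, by omega⟩)) (o (σ ⟨2 * (j : ℕ) + 2, by omega⟩)))

/-- The restriction to a hypersurface `x = const`, at `p`, of the transgression form
`T L_k (∇⁰, ∇¹) = 2k ∫₀¹ L_k (ω¹ - ω⁰, Ω_t, …, Ω_t) dt`, where `Ω_t` is the curvature of
`∇⁰ + t (∇¹ - ∇⁰)`; here `2k = q + 1`, and `∇⁰`, `∇¹` are the Levi-Civita connections of the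
metrics with components `G₀`, `G₁`. -/
def transgressionL (k : ℕ) {q : ℕ} (o : Fin (2 * q + 1) ≃ ι)
    (G₀ G₁ : ℝ × EuclideanSpace ℝ ι → Matrix (Option ι) (Option ι) ℝ)
    (p : ℝ × EuclideanSpace ℝ ι) : ℝ :=
  ((q : ℝ) + 1) * ∫ t in (0 : ℝ)..1, topForm o (polarize (hirzebruchL k))
    (fun μ => leviCivita G₁ p (some μ) - leviCivita G₀ p (some μ))
    (fun μ ν => curvature
      (fun r η => leviCivita G₀ r η + t • (leviCivita G₁ r η - leviCivita G₀ r η))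
      p (some μ) (some ν))

/-- The linear path of metrics from `G₀` to `G₁`. -/
def metricPath (G₀ G₁ : ℝ × EuclideanSpace ℝ ι → Matrix (Option ι) (Option ι) ℝ) (t : ℝ) :
    ℝ × EuclideanSpace ℝ ι → Matrix (Option ι) (Option ι) ℝ :=
  fun p => (1 - t) • G₀ p + t • G₁ p

/-- The restriction to a hypersurface `x = const`, at `p`, of the transgression form
`T e (∇⁰, ∇¹) = (q + 1) ∫₀¹ Pf (ω̇_t / 2π, Ω_t / 2π, …, Ω_t / 2π) dt` of the Euler form
`e = Pf (Ω / 2π)` in dimension `2 (q + 1)`.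

The Pfaffian is only invariant on skew matrices, so the interpolation has to go through metric
connections: `∇_t` is determined by `g_t (∇_t X, Y) = (1 - t) g₀ (∇⁰ X, Y) + t g₁ (∇¹ X, Y)` with
`g_t = (1 - t) g₀ + t g₁`, that is, it is the Levi-Civita connection of `g_t`. Where `g₀ = g₁` holds
along the hypersurface, it is `∇⁰ + t (∇¹ - ∇⁰)` there. In an arbitrary frame with Gram matrix `G`,
the Pfaffian of an endomorphism `X` in an oriented orthonormal frame is `± Pf (G X) / √(det G)`,
and the sign is that of the orientation of the frame. The hypersurface is oriented as the boundary
of `{x ≥ const}`, so the outward vector `-∂_x` followed by the oriented coordinates `u` is positive,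
and `(∂_x, ∂_u)` is negative; `e` is an ordering that starts with `∂_x`. -/
def transgressionEuler {q : ℕ} (o : Fin (2 * q + 1) ≃ ι) (e : Fin (2 * (q + 1)) ≃ Option ι)
    (G₀ G₁ : ℝ × EuclideanSpace ℝ ι → Matrix (Option ι) (Option ι) ℝ)
    (p : ℝ × EuclideanSpace ℝ ι) : ℝ :=
  -(((q : ℝ) + 1) * ∫ t in (0 : ℝ)..1,
    (√(metricPath G₀ G₁ t p).det)⁻¹ *
      topForm o (polarize (pfaffian e))
        (fun μ => (2 * Real.pi)⁻¹ • (metricPath G₀ G₁ t p * Matrix.of fun α β =>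
          deriv (fun s => leviCivita (metricPath G₀ G₁ s) p (some μ) α β) t))
        (fun μ ν => (2 * Real.pi)⁻¹ • (metricPath G₀ G₁ t p *
          curvature (leviCivita (metricPath G₀ G₁ t)) p (some μ) (some ν))))

end Coordinates

/-! ### Manifolds with fibred boundary -/

/-- The model space of the boundary: `n` base coordinates and `f` fibre coordinates. -/
abbrev BdModel (n f : ℕ) : Type := EuclideanSpace ℝ (Fin n ⊕ Fin f)

section Fibred

variable (n f : ℕ)
  (M : Type*) [TopologicalSpace M] [ChartedSpace (EuclideanHalfSpace (n + f + 1)) M]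
  (W : Type*) [TopologicalSpace W] [ChartedSpace (BdModel n f) W]
  (N : Type*) [TopologicalSpace N] [ChartedSpace (EuclideanSpace ℝ (Fin n)) N]
  (F : Type*) [TopologicalSpace F] [ChartedSpace (EuclideanSpace ℝ (Fin f)) F]

/-- A fibred boundary on the manifold with boundary `M`, of dimension `n + f + 1`: a boundary
defining function `x`, a smooth fibre bundle `F → W → N`, and a collar `[0, 1) × W → M` which
identifies `W` with `∂M` and under which `x` is the projection to `[0, 1)`. -/
structure FibredBoundary where
  bdf : M → ℝ
  contMDiff_bdf : ContMDiff (𝓡∂ (n + f + 1)) 𝓘(ℝ, ℝ) ∞ bdf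
  bdf_nonneg : ∀ p, 0 ≤ bdf p
  bdf_eq_zero_iff : ∀ p, bdf p = 0 ↔ p ∈ (𝓡∂ (n + f + 1)).boundary M
  proj : W → N
  contMDiff_proj : ContMDiff 𝓘(ℝ, BdModel n f) (𝓡 n) ∞ proj
  locallyTrivial : ∀ y : N, ∃ t : Bundle.Trivialization F proj, y ∈ t.baseSet ∧
    ContMDiffOn 𝓘(ℝ, BdModel n f) ((𝓡 n).prod (𝓡 f)) ∞ t t.source ∧
    ContMDiffOn ((𝓡 n).prod (𝓡 f)) 𝓘(ℝ, BdModel n f) ∞ t.toOpenPartialHomeomorph.symm t.target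
  collar : ℝ × W → M
  contMDiffOn_collar : ContMDiffOn (𝓘(ℝ, ℝ).prod 𝓘(ℝ, BdModel n f)) (𝓡∂ (n + f + 1)) ∞ collar
    (Ico 0 1 ×ˢ univ)
  isOpen_image_collar : IsOpen (collar '' (Ico 0 1 ×ˢ univ))
  collarInv : M → ℝ × W
  collarInv_collar : ∀ p ∈ (Ico 0 1 ×ˢ univ : Set (ℝ × W)), collarInv (collar p) = p
  contMDiffOn_collarInv : ContMDiffOn (𝓡∂ (n + f + 1)) (𝓘(ℝ, ℝ).prod 𝓘(ℝ, BdModel n f)) ∞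
    collarInv (collar '' (Ico 0 1 ×ˢ univ))
  bdf_collar : ∀ x ∈ Ico (0 : ℝ) 1, ∀ w, bdf (collar (x, w)) = x
  boundary_subset : ∀ p ∈ (𝓡∂ (n + f + 1)).boundary M, ∃ w, collar (0, w) = p

variable {n f M W N F}

/-- A splitting `TW = T^V W ⊕ T^H W` with `T^V W = ker dφ`, given by its smooth field of
projections onto `T^V W`; the horizontal bundle `T^H W` is the kernel of the projections. -/
structure Splitting [IsManifold 𝓘(ℝ, BdModel n f) ∞ W] (D : FibredBoundary n f M W N F) where
  vert : ∀ w : W, TangentSpace 𝓘(ℝ, BdModel n f) w →L[ℝ] TangentSpace 𝓘(ℝ, BdModel n f) w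
  contMDiff_vert : ContMDiff 𝓘(ℝ, BdModel n f)
    (𝓘(ℝ, BdModel n f).prod 𝓘(ℝ, BdModel n f →L[ℝ] BdModel n f)) ∞
    (fun w => Bundle.TotalSpace.mk' (BdModel n f →L[ℝ] BdModel n f)
      (E := fun w : W =>
        TangentSpace 𝓘(ℝ, BdModel n f) w →L[ℝ] TangentSpace 𝓘(ℝ, BdModel n f) w) w (vert w))
  proj_vert : ∀ w X, mfderiv 𝓘(ℝ, BdModel n f) (𝓡 n) D.proj w (vert w X) = 0
  vert_eq_self : ∀ w X, mfderiv 𝓘(ℝ, BdModel n f) (𝓡 n) D.proj w X = 0 → vert w X = X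

/-- Smoothness on `s × W` of a family of bilinear forms on `TW` with parameters in `s`. -/
def SmoothBilinFamily {P : Type*} [NormedAddCommGroup P] [NormedSpace ℝ P]
    [IsManifold 𝓘(ℝ, BdModel n f) ∞ W] (s : Set P)
    (K : P → ∀ w : W, TangentSpace 𝓘(ℝ, BdModel n f) w →L[ℝ]
      TangentSpace 𝓘(ℝ, BdModel n f) w →L[ℝ] ℝ) : Prop :=
  ContMDiffOn (𝓘(ℝ, P).prod 𝓘(ℝ, BdModel n f))
    (𝓘(ℝ, BdModel n f).prod 𝓘(ℝ, BdModel n f →L[ℝ] BdModel n f →L[ℝ] ℝ)) ∞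
    (fun p : P × W => Bundle.TotalSpace.mk' (BdModel n f →L[ℝ] BdModel n f →L[ℝ] ℝ)
      (E := fun w : W => TangentSpace 𝓘(ℝ, BdModel n f) w →L[ℝ]
        TangentSpace 𝓘(ℝ, BdModel n f) w →L[ℝ] ℝ) p.2 (K p.1 p.2))
    (s ×ˢ univ)

variable (n f W) in
/-- A smooth section, over the collar `[0, 1) × W`, of the symmetric square of the dual of the
`φ`-tangent bundle. A splitting identifies the `φ`-tangent bundle over the collar with `ℝ ⊕ TW`,
the pair `(s, X)` standing for `s x²∂_x + x X^H + X^V`; in these terms the section is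
`(s, X), (s', X') ↦ s s' c₀₀ + s c₀ (X') + s' c₀ (X) + c₁ (X, X')`, with components smooth up to
`x = 0`. -/
structure PhiTensor [IsManifold 𝓘(ℝ, BdModel n f) ∞ W] where
  c₀₀ : ℝ → W → ℝ
  c₀ : ℝ → ∀ w : W, TangentSpace 𝓘(ℝ, BdModel n f) w →L[ℝ] ℝ
  c₁ : ℝ → ∀ w : W, TangentSpace 𝓘(ℝ, BdModel n f) w →L[ℝ]
    TangentSpace 𝓘(ℝ, BdModel n f) w →L[ℝ] ℝ
  smooth₀₀ : ContMDiffOn (𝓘(ℝ, ℝ).prod 𝓘(ℝ, BdModel n f)) 𝓘(ℝ, ℝ) ∞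
    (fun p : ℝ × W => c₀₀ p.1 p.2) (Ico 0 1 ×ˢ univ)
  smooth₀ : ContMDiffOn (𝓘(ℝ, ℝ).prod 𝓘(ℝ, BdModel n f))
    (𝓘(ℝ, BdModel n f).prod 𝓘(ℝ, BdModel n f →L[ℝ] ℝ)) ∞
    (fun p : ℝ × W => Bundle.TotalSpace.mk' (BdModel n f →L[ℝ] ℝ)
      (E := fun w : W => TangentSpace 𝓘(ℝ, BdModel n f) w →L[ℝ] ℝ) p.2 (c₀ p.1 p.2))
    (Ico 0 1 ×ˢ univ)
  smooth₁ : SmoothBilinFamily (Ico 0 1) c₁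
  symm : ∀ x ∈ Ico (0 : ℝ) 1, ∀ w X Y, c₁ x w X Y = c₁ x w Y X

section Tensors

variable [IsManifold 𝓘(ℝ, BdModel n f) ∞ W] {D : FibredBoundary n f M W N F}

/-- The value of the section at `(x, w)`, `x > 0`, on the tangent vectors `s ∂_x + X`
and `s' ∂_x + X'`; note that `s ∂_x + X = (s / x²) x²∂_x + x (X^H / x) + X^V`. -/
def PhiTensor.eval (A : PhiTensor n f W) (S : Splitting D) (x : ℝ) (w : W)
    (ξ ξ' : ℝ × TangentSpace 𝓘(ℝ, BdModel n f) w) : ℝ :=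
  let r : TangentSpace 𝓘(ℝ, BdModel n f) w → TangentSpace 𝓘(ℝ, BdModel n f) w :=
    fun X => x⁻¹ • (X - S.vert w X) + S.vert w X
  (ξ.1 / x ^ 2) * (ξ'.1 / x ^ 2) * A.c₀₀ x w + (ξ.1 / x ^ 2) * A.c₀ x w (r ξ'.2) +
    (ξ'.1 / x ^ 2) * A.c₀ x w (r ξ.2) + A.c₁ x w (r ξ.2) (r ξ'.2)

/-- `Y` is the horizontal lift of a smooth vector field of `N`. -/
def Splitting.IsLift [IsManifold (𝓡 n) ∞ N] (S : Splitting D)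
    (Y : ∀ w : W, TangentSpace 𝓘(ℝ, BdModel n f) w) : Prop :=
  (∀ w, S.vert w (Y w) = 0) ∧
  ∃ Z : ∀ y : N, TangentSpace (𝓡 n) y,
    ContMDiff (𝓡 n) (𝓡 n).tangent ∞ (fun y => (⟨y, Z y⟩ : TangentBundle (𝓡 n) N)) ∧
    ∀ w, mfderiv 𝓘(ℝ, BdModel n f) (𝓡 n) D.proj w (Y w) = Z (D.proj w)

/-- Condition (i): `A (x²∂_x, ·) ≡ 0`, and `A (x Y₁, x Y₂) = O(x)` for horizontal `Y₁, Y₂` (which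
is a condition on the values of `Y₁, Y₂` at each point). -/
def PhiTensor.CondI (A : PhiTensor n f W) (S : Splitting D) : Prop :=
  (∀ x ∈ Ico (0 : ℝ) 1, ∀ w, A.c₀₀ x w = 0 ∧ A.c₀ x w = 0) ∧
  ∀ w, ∀ Y₁ Y₂ : TangentSpace 𝓘(ℝ, BdModel n f) w, S.vert w Y₁ = 0 → S.vert w Y₂ = 0 →
    (fun x => A.c₁ x w Y₁ Y₂) =O[𝓝[>] 0] (fun x : ℝ => x)

/-- The derivative of a function on `W` in the direction of a tangent vector. -/
def dirDeriv (u : W → ℝ) (w : W) (X : TangentSpace 𝓘(ℝ, BdModel n f) w) : ℝ :=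
  mfderiv 𝓘(ℝ, BdModel n f) 𝓘(ℝ, ℝ) u w X

/-- Condition (ii): at `x = 0`,
`V₁ · A (V₂, x Y) - V₂ · A (V₁, x Y) - A ([V₁, V₂], x Y) = 0` for all vertical vector fields
`V₁, V₂` and all lifts `Y` of vector fields of the base. -/
def PhiTensor.CondII [IsManifold (𝓡 n) ∞ N] (A : PhiTensor n f W) (S : Splitting D) : Prop :=
  ∀ V₁ V₂ Y : ∀ w : W, TangentSpace 𝓘(ℝ, BdModel n f) w,
    ContMDiff 𝓘(ℝ, BdModel n f) 𝓘(ℝ, BdModel n f).tangent ∞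
      (fun w => (⟨w, V₁ w⟩ : TangentBundle 𝓘(ℝ, BdModel n f) W)) →
    ContMDiff 𝓘(ℝ, BdModel n f) 𝓘(ℝ, BdModel n f).tangent ∞
      (fun w => (⟨w, V₂ w⟩ : TangentBundle 𝓘(ℝ, BdModel n f) W)) →
    (∀ w, mfderiv 𝓘(ℝ, BdModel n f) (𝓡 n) D.proj w (V₁ w) = 0) →
    (∀ w, mfderiv 𝓘(ℝ, BdModel n f) (𝓡 n) D.proj w (V₂ w) = 0) →
    S.IsLift Y →
    ∀ w, dirDeriv (fun w' => A.c₁ 0 w' (V₂ w') (Y w')) w (V₁ w)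
      - dirDeriv (fun w' => A.c₁ 0 w' (V₁ w') (Y w')) w (V₂ w)
      - A.c₁ 0 w (VectorField.mlieBracket 𝓘(ℝ, BdModel n f) V₁ V₂ w) (Y w) = 0

/-- The data of a product-type metric: a Riemannian metric `h` on the base and a smooth field `τ` of
symmetric bilinear forms on the vertical bundle (extended by zero to the horizontal bundle) which
restricts to a Riemannian metric on each fibre. -/
structure ProductData [IsManifold (𝓡 n) ∞ N] (S : Splitting D) where
  h : Bundle.ContMDiffRiemannianMetric (IB := 𝓡 n) (n := ∞) (F := EuclideanSpace ℝ (Fin n))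
    (E := fun y : N => TangentSpace (𝓡 n) y)
  τ : ∀ w : W, TangentSpace 𝓘(ℝ, BdModel n f) w →L[ℝ] TangentSpace 𝓘(ℝ, BdModel n f) w →L[ℝ] ℝ
  smooth_τ : SmoothBilinFamily (univ : Set ℝ) (fun _ => τ)
  τ_symm : ∀ w X Y, τ w X Y = τ w Y X
  τ_vert : ∀ w X Y, τ w X Y = τ w (S.vert w X) (S.vert w Y)
  τ_pos : ∀ w X, mfderiv 𝓘(ℝ, BdModel n f) (𝓡 n) D.proj w X = 0 → X ≠ 0 → 0 < τ w X X

variable [IsManifold (𝓡 n) ∞ N] {S : Splitting D}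

/-- The pullback `φ^* h`. -/
def ProductData.baseForm (Q : ProductData S) (w : W)
    (X Y : TangentSpace 𝓘(ℝ, BdModel n f) w) : ℝ :=
  Q.h.inner (D.proj w) (mfderiv 𝓘(ℝ, BdModel n f) (𝓡 n) D.proj w X)
    (mfderiv 𝓘(ℝ, BdModel n f) (𝓡 n) D.proj w Y)

/-- The product-type metric `dx² / x⁴ + φ^* h / x² + τ` on `(0, 1) × W`. -/
def ProductData.metric (Q : ProductData S) (x : ℝ) (w : W)
    (ξ ξ' : ℝ × TangentSpace 𝓘(ℝ, BdModel n f) w) : ℝ :=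
  ξ.1 * ξ'.1 / x ^ 4 + Q.baseForm w ξ.2 ξ'.2 / x ^ 2 + Q.τ w ξ.2 ξ'.2

end Tensors

/-- The pullback to `(0, 1) × W` under the collar of a field of bilinear forms on `M`. -/
def FibredBoundary.pullback (D : FibredBoundary n f M W N F)
    (g : ∀ p : M, TangentSpace (𝓡∂ (n + f + 1)) p →L[ℝ]
      TangentSpace (𝓡∂ (n + f + 1)) p →L[ℝ] ℝ)
    (x : ℝ) (w : W) (ξ ξ' : ℝ × TangentSpace 𝓘(ℝ, BdModel n f) w) : ℝ :=
  g (D.collar (x, w))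
    (mfderiv (𝓘(ℝ, ℝ).prod 𝓘(ℝ, BdModel n f)) (𝓡∂ (n + f + 1)) D.collar (x, w) ξ)
    (mfderiv (𝓘(ℝ, ℝ).prod 𝓘(ℝ, BdModel n f)) (𝓡∂ (n + f + 1)) D.collar (x, w) ξ')

section Metrics

variable [IsManifold (𝓡∂ (n + f + 1)) ∞ M] [IsManifold 𝓘(ℝ, BdModel n f) ∞ W]
  [IsManifold (𝓡 n) ∞ N] {D : FibredBoundary n f M W N F} {S : Splitting D}

/-- An exact `φ`-metric: a smooth Riemannian metric `g` on the interior of `M` which is of the form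
`g̃ + x A + x² B` on the collar, where `g̃` is the product-type metric given by `Q`, and `A`, `B`
are smooth sections of the symmetric square of the dual of the `φ`-tangent bundle. -/
structure ExactPhiMetric (Q : ProductData S) (A B : PhiTensor n f W) where
  g : ∀ p : M, TangentSpace (𝓡∂ (n + f + 1)) p →L[ℝ] TangentSpace (𝓡∂ (n + f + 1)) p →L[ℝ] ℝ
  smooth : ContMDiffOn (𝓡∂ (n + f + 1))
    ((𝓡∂ (n + f + 1)).prod 𝓘(ℝ, EuclideanSpace ℝ (Fin (n + f + 1)) →L[ℝ]
      EuclideanSpace ℝ (Fin (n + f + 1)) →L[ℝ] ℝ)) ∞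
    (fun p => Bundle.TotalSpace.mk' (EuclideanSpace ℝ (Fin (n + f + 1)) →L[ℝ]
        EuclideanSpace ℝ (Fin (n + f + 1)) →L[ℝ] ℝ)
      (E := fun p : M => TangentSpace (𝓡∂ (n + f + 1)) p →L[ℝ]
        TangentSpace (𝓡∂ (n + f + 1)) p →L[ℝ] ℝ) p (g p))
    ((𝓡∂ (n + f + 1)).interior M)
  symm : ∀ p ∈ (𝓡∂ (n + f + 1)).interior M, ∀ v v', g p v v' = g p v' v
  pos : ∀ p ∈ (𝓡∂ (n + f + 1)).interior M, ∀ v, v ≠ 0 → 0 < g p v v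
  collar_eq : ∀ x ∈ Ioo (0 : ℝ) 1, ∀ w ξ ξ', D.pullback g x w ξ ξ' =
    Q.metric x w ξ ξ' + x * A.eval S x w ξ ξ' + x ^ 2 * B.eval S x w ξ ξ'

/-- A smooth family, for `0 < ε < 1`, of asymptotic auxiliary metrics
`ĝ_ε = dx² / ε⁴ + φ^* h / ε² + κ_ε (x)` near `∂M`, where the symmetric bilinear forms `κ_ε (x)` on
`TW` are smooth in `(ε, x, w)` up to `ε = 0` and `x = 0`, and where the restrictions of `ĝ_ε` and of
the asymptotic metric `g̃ + x A` to the hypersurface `x = ε` are the same. -/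
structure AuxiliaryFamily (Q : ProductData S) (A : PhiTensor n f W) where
  κ : ℝ × ℝ → ∀ w : W, TangentSpace 𝓘(ℝ, BdModel n f) w →L[ℝ]
    TangentSpace 𝓘(ℝ, BdModel n f) w →L[ℝ] ℝ
  smooth : SmoothBilinFamily (Ico 0 1 ×ˢ Ico 0 1) κ
  symm : ∀ ε ∈ Ico (0 : ℝ) 1, ∀ x ∈ Ico (0 : ℝ) 1, ∀ w X Y, κ (ε, x) w X Y = κ (ε, x) w Y X
  agree : ∀ ε ∈ Ioo (0 : ℝ) 1, ∀ w, ∀ X Y : TangentSpace 𝓘(ℝ, BdModel n f) w,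
    Q.baseForm w X Y / ε ^ 2 + κ (ε, ε) w X Y =
      Q.metric ε w (0, X) (0, Y) + ε * A.eval S ε w (0, X) (0, Y)

/-- The metric `ĝ_ε` on the collar. -/
def AuxiliaryFamily.metric {Q : ProductData S} {A : PhiTensor n f W} (K : AuxiliaryFamily Q A)
    (ε x : ℝ) (w : W) (ξ ξ' : ℝ × TangentSpace 𝓘(ℝ, BdModel n f) w) : ℝ :=
  ξ.1 * ξ'.1 / ε ^ 4 + Q.baseForm w ξ.2 ξ'.2 / ε ^ 2 + K.κ (ε, x) w ξ.2 ξ'.2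

end Metrics

/-! ### Integration over the hypersurfaces `x = ε` -/

/-- `χ` is a chart of `W` whose first `n` coordinates are pulled back from a chart of the base. -/
def IsFibredChart (D : FibredBoundary n f M W N F)
    (χ : OpenPartialHomeomorph W (BdModel n f)) : Prop :=
  χ ∈ IsManifold.maximalAtlas 𝓘(ℝ, BdModel n f) ∞ W ∧
  ∃ η ∈ IsManifold.maximalAtlas (𝓡 n) ∞ N, χ.source ⊆ D.proj ⁻¹' η.source ∧
    ∀ w ∈ χ.source, ∀ i : Fin n, χ w (Sum.inl i) = η (D.proj w) i

/-- A finite oriented atlas of fibred charts of `W` (which orients `W`) together with a subordinate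
partition of unity. -/
structure OrientedFibredAtlas (D : FibredBoundary n f M W N F) where
  card : ℕ
  chart : Fin card → OpenPartialHomeomorph W (BdModel n f)
  isFibred : ∀ a, IsFibredChart D (chart a)
  oriented : ∀ a b, ∀ u ∈ ((chart a).symm.trans (chart b)).source,
    0 < (fderiv ℝ (fun v => chart b ((chart a).symm v)) u).det
  ρ : Fin card → W → ℝ
  contMDiff_ρ : ∀ a, ContMDiff 𝓘(ℝ, BdModel n f) 𝓘(ℝ, ℝ) ∞ (ρ a)
  ρ_nonneg : ∀ a w, 0 ≤ ρ a w
  sum_ρ : ∀ w, ∑ a, ρ a w = 1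
  tsupport_ρ : ∀ a, tsupport (ρ a) ⊆ (chart a).source

/-- The integral over `W` of the top degree form whose component in the chart `χ`, with respect to
`du`, is `dens χ`. -/
def OrientedFibredAtlas.integral {D : FibredBoundary n f M W N F} (U : OrientedFibredAtlas D)
    (dens : OpenPartialHomeomorph W (BdModel n f) → BdModel n f → ℝ) : ℝ :=
  ∑ a, ∫ u in (U.chart a).target, U.ρ a ((U.chart a).symm u) * dens (U.chart a) u

/-- The coordinate vector `∂_α` of the coordinates `(x, χ)` on `(0, 1) × W`. -/
def cylVec (χ : OpenPartialHomeomorph W (BdModel n f)) (u : BdModel n f) :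
    Option (Fin n ⊕ Fin f) → ℝ × TangentSpace 𝓘(ℝ, BdModel n f) (χ.symm u)
  | none => (1, 0)
  | some i => (0, mfderiv 𝓘(ℝ, BdModel n f) 𝓘(ℝ, BdModel n f) χ.symm u
      (EuclideanSpace.single i (1 : ℝ) : BdModel n f))

/-- The components, in the coordinates `(x, χ)`, of a field of bilinear forms on `(0, 1) × W`. -/
def gram (q : ℝ → ∀ w : W, ℝ × TangentSpace 𝓘(ℝ, BdModel n f) w →
      ℝ × TangentSpace 𝓘(ℝ, BdModel n f) w → ℝ)
    (χ : OpenPartialHomeomorph W (BdModel n f)) (p : ℝ × BdModel n f) :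
    Matrix (Option (Fin n ⊕ Fin f)) (Option (Fin n ⊕ Fin f)) ℝ :=
  Matrix.of fun α β => q p.1 (χ.symm p.2) (cylVec χ p.2 α) (cylVec χ p.2 β)

/-- The order of the coordinates on `W`: first those of the base, then those of the fibre. -/
def bdOrder (q : ℕ) (hq : n + f = 2 * q + 1) : Fin (2 * q + 1) ≃ Fin n ⊕ Fin f :=
  (finCongr hq.symm).trans finSumFinEquiv.symm

/-- The order of the coordinates `(x, u)`: first `x`. -/
def cylOrder (q : ℕ) (hq : n + f = 2 * q + 1) : Fin (2 * (q + 1)) ≃ Option (Fin n ⊕ Fin f) :=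
  ((finCongr (by omega : 2 * (q + 1) = 2 * q + 1 + 1)).trans (finSuccEquiv (2 * q + 1))).trans
    (Equiv.optionCongr (bdOrder q hq))

section Integrals

variable [IsManifold (𝓡∂ (n + f + 1)) ∞ M] [IsManifold 𝓘(ℝ, BdModel n f) ∞ W]
  [IsManifold (𝓡 n) ∞ N] {D : FibredBoundary n f M W N F} {S : Splitting D}
  {Q : ProductData S} {A B : PhiTensor n f W}

/-- `∫_{x = ε} T e (M, ∇(ĝ_ε), ∇(g))`, with the Levi-Civita connections of `ĝ_ε` and `g`. -/
def integralTe (k : ℕ) (hdim : n + f + 1 = 4 * k) (U : OrientedFibredAtlas D)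
    (K : AuxiliaryFamily Q A) (G : ExactPhiMetric Q A B) (ε : ℝ) : ℝ :=
  U.integral fun χ u =>
    transgressionEuler (bdOrder (2 * k - 1) (by omega)) (cylOrder (2 * k - 1) (by omega))
      (gram (K.metric ε) χ) (gram (D.pullback G.g) χ) (ε, u)

/-- `∫_{x = ε} T L (M, ∇(ĝ_ε), ∇(g))`, with the Levi-Civita connections of `ĝ_ε` and `g`. -/
def integralTL (k : ℕ) (hdim : n + f + 1 = 4 * k) (U : OrientedFibredAtlas D)
    (K : AuxiliaryFamily Q A) (G : ExactPhiMetric Q A B) (ε : ℝ) : ℝ :=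
  U.integral fun χ u =>
    transgressionL k (bdOrder (2 * k - 1) (by omega))
      (gram (K.metric ε) χ) (gram (D.pullback G.g) χ) (ε, u)

end Integrals

end Fibred

end PhiCS

end

noncomputable section

namespace PhiCS

/-! ### Polarized invariant polynomials -/

section Invariants

variable {κ : Type*}

/-! The proof is an adiabatic limit computed in a rescaled frame. In a fibred chart, with base
coordinates indexed by a and fibre coordinates by i, use the frame x²∂_x, x∂_a, ∂_i. There the Gram
matrices of both metrics along x = ε extend smoothly to ε = 0 and have the same limit H₀, the block
sum of 1, φ^*h and the fibre part of τ (`limitMetric_isBlockMetric`). H₀ is block diagonal for the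
splitting of indices into horizontal (x and base) and vertical (fibre), and its horizontal block is
constant along the fibres.

Only the values of the forms on vectors tangent to x = ε are integrated, and the change of frame is
constant on that hypersurface. The Levi-Civita forms and curvatures are therefore merely conjugated
by a diagonal matrix (`Jet.Represents.leviCivita_eq`, `curvature_eq_slabCurvature`), and the
transgression integrands do not see this: the L-polynomial is conjugation invariant, and in the
Euler case the powers of ε leave the Pfaffian as the same factor that leaves √det G. The rescaled
connection forms are smooth up to ε = 0. The only term that threatens to blow up is the fibre
derivative of the entries (β, a), which would carry 1/ε; fibre constancy and block structure of H₀
remove its leading part. Hence each integrand extends continuously to ε = 0, for every parameter t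
of the path, and it is enough that the extension vanishes there.

At ε = 0 the connection forms preserve the splitting (`Jet.IsRegular.christoffel_zero_block`).
Condition (i) enters here: it kills the first order term of the horizontal block, whose fibre
derivative would otherwise give a mixed entry. The curvatures and the t-derivatives preserve the
splitting too.

Euler form: a Pfaffian of a block diagonal matrix with a block of odd size is zero
(`pfaffian_eq_zero_of_blockDiag`), so for odd f the limiting integrand vanishes
(`tendsto_eulerIntegrand`).

L-form, f = 1: a top degree form on the hypersurface must be evaluated on the fibre vector ∂_i in
one of its slots. In the limit the two connections agree on ∂_i (`gamma_zero_vert_eq`), and the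
curvature contracted with ∂_i is zero (`slabCurvature_zero_vert`): the horizontal block of the
limiting connection has no ∂_i component and is constant along the fibre, while the vertical 1 × 1
block is the exact form ½ d log τ. So every summand has a zero argument
(`tendsto_hirzebruchIntegrand`).

Compactness of the support of each partition function and of the interval of t turns these limits
into uniform ones (`eventually_abs_le_of_tendsto`), and the integrals tend to zero. -/

theorem polarize_eq_zero_of_apply_eq_zero {m : ℕ} (p : Matrix κ κ ℝ → ℝ)
    (X : Fin m → Matrix κ κ ℝ) (j : Fin m) (hj : X j = 0) : polarize p X = 0 := by
  classical
  unfold polarize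
  refine mul_eq_zero_of_right _ ?_
  -- In the inclusion-exclusion sum, the subsets with and without j have the same partial sum and
  -- opposite signs, so they cancel in pairs.
  refine Finset.sum_involution (fun S _ => symmDiff S {j}) ?_ ?_ (fun _ _ => Finset.mem_univ _) ?_
  · intro S _
    by_cases h : j ∈ S
    · have hS : symmDiff S {j} = S.erase j := by
        ext a; by_cases ha : a = j <;> simp [Finset.mem_symmDiff, ha, h]
      have hc : S.card = (S.erase j).card + 1 := (Finset.card_erase_add_one h).symm
      have hle : S.card ≤ m := by simpa using Finset.card_le_univ S
      have h1 : m - (S.erase j).card = (m - S.card) + 1 := by omega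
      have h2 : ∑ i ∈ S, X i = ∑ i ∈ S.erase j, X i := by
        rw [← Finset.add_sum_erase S X h, hj, zero_add]
      rw [hS, h1, h2, pow_succ]; ring
    · have hS : symmDiff S {j} = insert j S := by
        ext a; by_cases ha : a = j <;> simp [Finset.mem_symmDiff, ha, h]
      have hc : (insert j S).card = S.card + 1 := Finset.card_insert_of_notMem h
      have hle : (insert j S).card ≤ m := by simpa using Finset.card_le_univ (insert j S)
      have h1 : m - S.card = (m - (insert j S).card) + 1 := by omega
      have h2 : ∑ i ∈ insert j S, X i = ∑ i ∈ S, X i := by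
        rw [Finset.sum_insert h, hj, zero_add]
      rw [hS, h1, h2, pow_succ]; ring
  · intro S _ _ h
    have h' : S.card = (symmDiff S {j}).card := by rw [h]
    have : j ∈ symmDiff S {j} ↔ j ∈ S := by rw [h]
    simp [Finset.mem_symmDiff] at this
  · intro S _
    simp

/-- The polarization formula evaluates `p` only at partial sums of the arguments, so a class closed
under addition is enough. Neither multilinearity nor homogeneity of `p` is needed, here or in
`polarize_map`. -/
theorem polarize_eq_zero_of_forall {m : ℕ} (p : Matrix κ κ ℝ → ℝ) (V : AddSubmonoid (Matrix κ κ ℝ))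
    (hp : ∀ X ∈ V, p X = 0) (X : Fin m → Matrix κ κ ℝ) (hX : ∀ j, X j ∈ V) :
    polarize p X = 0 := by
  unfold polarize
  refine mul_eq_zero_of_right _ (Finset.sum_eq_zero fun S _ => ?_)
  rw [hp _ (V.sum_mem fun j _ => hX j), mul_zero]

theorem polarize_map {m : ℕ} (p : Matrix κ κ ℝ → ℝ) (φ : Matrix κ κ ℝ →+ Matrix κ κ ℝ) (c : ℝ)
    (hp : ∀ X, p (φ X) = c * p X) (X : Fin m → Matrix κ κ ℝ) :
    polarize p (fun j => φ (X j)) = c * polarize p X := by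
  unfold polarize
  simp only [← map_sum, hp]
  rw [Finset.mul_sum, Finset.mul_sum, Finset.mul_sum]
  exact Finset.sum_congr rfl fun S _ => by ring

theorem continuous_polarize {m : ℕ} {p : Matrix κ κ ℝ → ℝ} (hp : Continuous p) :
    Continuous (polarize p : (Fin m → Matrix κ κ ℝ) → ℝ) := by
  unfold polarize
  exact continuous_const.mul (continuous_finsetSum _ fun S _ => continuous_const.mul
    (hp.comp (continuous_finsetSum _ fun j _ => continuous_apply j)))

theorem topForm_map {ι : Type*} [Fintype ι] [DecidableEq ι] {q : ℕ} (o : Fin (2 * q + 1) ≃ ι)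
    (P : (Fin (q + 1) → Matrix κ κ ℝ) → ℝ) (φ : Matrix κ κ ℝ → Matrix κ κ ℝ) (c : ℝ)
    (hP : ∀ X, P (fun j => φ (X j)) = c * P X) (θ : ι → Matrix κ κ ℝ) (Ω : ι → ι → Matrix κ κ ℝ) :
    topForm o P (fun μ => φ (θ μ)) (fun μ ν => φ (Ω μ ν)) = c * topForm o P θ Ω := by
  have h : ∀ (a : Matrix κ κ ℝ) (b : Fin q → Matrix κ κ ℝ),
      (Fin.cons (φ a) fun j => φ (b j) : Fin (q + 1) → Matrix κ κ ℝ) =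
        fun j => φ ((Fin.cons a b : Fin (q + 1) → Matrix κ κ ℝ) j) := by
    intro a b
    funext j
    refine Fin.cases ?_ (fun i => ?_) j <;> simp
  unfold topForm
  simp only [h, hP]
  rw [mul_left_comm, Finset.mul_sum _ _ c]
  congr 1
  exact Finset.sum_congr rfl fun σ _ => by ring

theorem continuous_topForm {ι : Type*} [Fintype ι] [DecidableEq ι] {q : ℕ}
    (o : Fin (2 * q + 1) ≃ ι) {P : (Fin (q + 1) → Matrix κ κ ℝ) → ℝ} (hP : Continuous P) :
    Continuous fun x : (ι → Matrix κ κ ℝ) × (ι → ι → Matrix κ κ ℝ) => topForm o P x.1 x.2 := by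
  unfold topForm
  refine continuous_const.mul (continuous_finsetSum _ fun σ _ => continuous_const.mul
    (hP.comp (Continuous.finCons ?_ ?_)))
  · exact (continuous_apply _).comp continuous_fst
  · exact continuous_pi fun j => (continuous_apply _).comp ((continuous_apply _).comp continuous_snd)

/-- Each permutation places the index i in exactly one slot, of θ or of one Ω, and the argument
occupying that slot is zero. -/
theorem topForm_eq_zero_of_index {ι : Type*} [Fintype ι] [DecidableEq ι] {q : ℕ}
    (o : Fin (2 * q + 1) ≃ ι) (p : Matrix κ κ ℝ → ℝ)
    (θ : ι → Matrix κ κ ℝ) (Ω : ι → ι → Matrix κ κ ℝ) (i : ι) (hθ : θ i = 0)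
    (hl : ∀ j, Ω i j = 0) (hr : ∀ j, Ω j i = 0) : topForm o (polarize p) θ Ω = 0 := by
  unfold topForm
  refine mul_eq_zero_of_right _ (Finset.sum_eq_zero fun σ _ => mul_eq_zero_of_right _ ?_)
  obtain ⟨a, ha⟩ : ∃ a, o (σ a) = i := ⟨σ.symm (o.symm i), by simp⟩
  have hlt := a.2
  by_cases h0 : (a : ℕ) = 0
  · refine polarize_eq_zero_of_apply_eq_zero _ _ 0 ?_
    have : (0 : Fin (2 * q + 1)) = a := Fin.ext h0.symm
    rw [Fin.cons_zero, this, ha, hθ]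
  -- Position 0 belongs to θ; an odd position 2b + 1 is the left slot of the b-th curvature, and a
  -- positive even position 2(b - 1) + 2 the right slot of the (b - 1)-st.
  · rcases Nat.even_or_odd (a : ℕ) with he | hodd
    · obtain ⟨b, hb⟩ := he
      have hbq : b - 1 < q := by omega
      refine polarize_eq_zero_of_apply_eq_zero _ _ (Fin.succ ⟨b - 1, hbq⟩) ?_
      have : (⟨2 * (b - 1) + 2, by omega⟩ : Fin (2 * q + 1)) = a := Fin.ext (by simp; omega)
      rw [Fin.cons_succ]
      simp only [this, ha, hr]
    · obtain ⟨b, hb⟩ := hodd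
      have hbq : b < q := by omega
      refine polarize_eq_zero_of_apply_eq_zero _ _ (Fin.succ ⟨b, hbq⟩) ?_
      have : (⟨2 * b + 1, by omega⟩ : Fin (2 * q + 1)) = a := Fin.ext (by simp; omega)
      rw [Fin.cons_succ]
      simp only [this, ha, hl]

theorem topForm_eq_zero_of_forall {ι : Type*} [Fintype ι] [DecidableEq ι] {q : ℕ}
    (o : Fin (2 * q + 1) ≃ ι) (p : Matrix κ κ ℝ → ℝ) (V : AddSubmonoid (Matrix κ κ ℝ))
    (hp : ∀ X ∈ V, p X = 0) (θ : ι → Matrix κ κ ℝ) (Ω : ι → ι → Matrix κ κ ℝ)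
    (hθ : ∀ i, θ i ∈ V) (hΩ : ∀ i j, Ω i j ∈ V) : topForm o (polarize p) θ Ω = 0 := by
  unfold topForm
  refine mul_eq_zero_of_right _ (Finset.sum_eq_zero fun σ _ => mul_eq_zero_of_right _ ?_)
  refine polarize_eq_zero_of_forall p V hp _ fun j => ?_
  refine Fin.cases ?_ (fun i => ?_) j
  · simpa using hθ _
  · simpa using hΩ _ _

theorem continuous_pfaffian {m : ℕ} (e : Fin (2 * m) ≃ κ) : Continuous (pfaffian e) := by
  unfold pfaffian
  exact continuous_const.mul (continuous_finsetSum _ fun σ _ => continuous_const.mul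
    (continuous_finsetProd _ fun j _ => (continuous_id.matrix_elem _ _)))

theorem prod_pairs {m : ℕ} (g : Fin (2 * m) → ℝ) :
    ∏ j : Fin m, (g ⟨2 * (j : ℕ), by omega⟩ * g ⟨2 * (j : ℕ) + 1, by omega⟩) = ∏ i, g i := by
  have h : ∏ i : Fin (m * 2), g (Fin.cast (mul_comm m 2) i) = ∏ i, g i :=
    Equiv.prod_comp (finCongr (mul_comm m 2)) g
  rw [← h, ← finProdFinEquiv.prod_comp, Fintype.prod_prod_type]
  refine Finset.prod_congr rfl fun j _ => ?_
  rw [Fin.prod_univ_two]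
  congr 2 <;> · ext; simp [finProdFinEquiv]; try omega

theorem sum_pairs {m : ℕ} (g : Fin (2 * m) → ℕ) :
    ∑ j : Fin m, (g ⟨2 * (j : ℕ), by omega⟩ + g ⟨2 * (j : ℕ) + 1, by omega⟩) = ∑ i, g i := by
  have h : ∑ i : Fin (m * 2), g (Fin.cast (mul_comm m 2) i) = ∑ i, g i :=
    Equiv.sum_comp (finCongr (mul_comm m 2)) g
  rw [← h, ← finProdFinEquiv.sum_comp, Fintype.sum_prod_type]
  refine Finset.sum_congr rfl fun j _ => ?_
  rw [Fin.sum_univ_two]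
  congr 2 <;> · ext; simp [finProdFinEquiv]; try omega

/-- Every summand of the Pfaffian uses each index exactly once, so the diagonal entries factor out
as det D. This carries the Euler integrand to the rescaled frame. -/
theorem pfaffian_diagonal_mul_mul [Fintype κ] [DecidableEq κ] {m : ℕ} (e : Fin (2 * m) ≃ κ)
    (d : κ → ℝ) (X : Matrix κ κ ℝ) :
    pfaffian e (Matrix.diagonal d * X * Matrix.diagonal d) = (∏ a, d a) * pfaffian e X := by
  unfold pfaffian
  rw [mul_left_comm, Finset.mul_sum _ _ (∏ a, d a)]
  congr 1
  refine Finset.sum_congr rfl fun σ _ => ?_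
  rw [mul_left_comm]
  congr 1
  have h : ∏ a, d a = ∏ i, d (e (σ i)) := ((σ.trans e).prod_comp d).symm
  rw [h, ← prod_pairs (fun i => d (e (σ i))), ← Finset.prod_mul_distrib]
  refine Finset.prod_congr rfl fun j _ => ?_
  rw [Matrix.mul_diagonal, Matrix.diagonal_mul]
  ring

/-- The matrices which preserve the splitting of the index set given by `v`. -/
def blockDiag (v : κ → Bool) : AddSubmonoid (Matrix κ κ ℝ) where
  carrier := {X | ∀ a b, v a ≠ v b → X a b = 0}
  add_mem' hX hY a b h := by simp [hX a b h, hY a b h]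
  zero_mem' _ _ _ := rfl

theorem mem_blockDiag {v : κ → Bool} {X : Matrix κ κ ℝ} :
    X ∈ blockDiag v ↔ ∀ a b, v a ≠ v b → X a b = 0 := Iff.rfl

theorem smul_mem_blockDiag {v : κ → Bool} {X : Matrix κ κ ℝ} (c : ℝ) (hX : X ∈ blockDiag v) :
    c • X ∈ blockDiag v := fun a b h => by simp [hX a b h]

theorem sub_mem_blockDiag {v : κ → Bool} {X Y : Matrix κ κ ℝ} (hX : X ∈ blockDiag v)
    (hY : Y ∈ blockDiag v) : X - Y ∈ blockDiag v := fun a b h => by simp [hX a b h, hY a b h]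

theorem mul_mem_blockDiag [Fintype κ] {v : κ → Bool} {X Y : Matrix κ κ ℝ} (hX : X ∈ blockDiag v)
    (hY : Y ∈ blockDiag v) : X * Y ∈ blockDiag v := fun a b h => by
  rw [Matrix.mul_apply]
  refine Finset.sum_eq_zero fun c _ => ?_
  by_cases hc : v a = v c
  · rw [hY c b (hc ▸ h), mul_zero]
  · rw [hX a c hc, zero_mul]

/-- Being block diagonal means commuting with the reflection J of the splitting. In this form
stability under inversion is formal, and it also covers singular matrices. -/
theorem mem_blockDiag_iff_sign [Fintype κ] [DecidableEq κ] {v : κ → Bool} {X : Matrix κ κ ℝ} :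
    X ∈ blockDiag v ↔ Matrix.diagonal (fun a => if v a then (1 : ℝ) else -1) * X *
      Matrix.diagonal (fun a => if v a then (1 : ℝ) else -1) = X := by
  rw [mem_blockDiag, ← Matrix.ext_iff]
  simp only [Matrix.mul_diagonal, Matrix.diagonal_mul]
  refine forall_congr' fun a => forall_congr' fun b => ?_
  cases v a <;> cases v b <;> simp <;> constructor <;> intro h <;> linarith

theorem inv_mem_blockDiag [Fintype κ] [DecidableEq κ] {v : κ → Bool} {X : Matrix κ κ ℝ}
    (hX : X ∈ blockDiag v) : X⁻¹ ∈ blockDiag v := by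
  rw [mem_blockDiag_iff_sign] at hX ⊢
  set J : Matrix κ κ ℝ := Matrix.diagonal (fun a => if v a then (1 : ℝ) else -1)
  have hJ : J * J = 1 := by
    rw [Matrix.diagonal_mul_diagonal, ← Matrix.diagonal_one]
    congr 1; funext a; split_ifs <;> simp
  have hJi : J⁻¹ = J := Matrix.inv_eq_left_inv hJ
  conv_rhs => rw [← hX]
  rw [Matrix.mul_inv_rev, Matrix.mul_inv_rev, hJi, Matrix.mul_assoc]

/-- A nonzero summand pairs vertical indices only with vertical ones, which would make their number
even. This is the parity argument behind the Euler case. -/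
theorem pfaffian_eq_zero_of_blockDiag [Fintype κ] {m : ℕ} (e : Fin (2 * m) ≃ κ)
    (v : κ → Bool) (hv : Odd (Finset.univ.filter fun a => v a = true).card) {X : Matrix κ κ ℝ}
    (hX : X ∈ blockDiag v) : pfaffian e X = 0 := by
  unfold pfaffian
  refine mul_eq_zero_of_right _ (Finset.sum_eq_zero fun σ _ => mul_eq_zero_of_right _ ?_)
  by_contra hne
  have h : ∀ j : Fin m, v (e (σ ⟨2 * (j : ℕ), by omega⟩)) = v (e (σ ⟨2 * (j : ℕ) + 1, by omega⟩)) := by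
    intro j
    by_contra hj
    exact hne (Finset.prod_eq_zero (Finset.mem_univ j) (hX _ _ hj))
  refine Nat.not_even_iff_odd.2 hv ?_
  have hs : ∑ i, (if v (e (σ i)) = true then 1 else 0) = ∑ a, if v a = true then 1 else 0 :=
    (σ.trans e).sum_comp fun a => if v a = true then 1 else 0
  rw [Finset.card_filter, ← hs, ← sum_pairs]
  refine Finset.even_sum _ fun j _ => ?_
  simp only [h j]
  exact ⟨_, rfl⟩

variable [Fintype κ] [DecidableEq κ]

theorem continuous_pontryagin (j : ℕ) : Continuous (pontryagin j : Matrix κ κ ℝ → ℝ) := by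
  -- Continuity is followed coefficient by coefficient: a coefficient of a product is a finite sum
  -- of products of coefficients.
  have key : ∀ s : Finset κ, ∀ g : κ → Matrix κ κ ℝ → Polynomial ℝ,
      (∀ a d, Continuous fun X => (g a X).coeff d) → ∀ d, Continuous fun X => (∏ a ∈ s, g a X).coeff d := by
    intro s g hg
    induction s using Finset.induction_on with
    | empty => intro d; simpa using continuous_const
    | insert a s ha ih =>
      intro d
      simp only [Finset.prod_insert ha, Polynomial.coeff_mul]
      exact continuous_finsetSum _ fun x _ => (hg a x.1).mul (ih x.2)
  unfold pontryagin
  simp only [Matrix.det_apply', Polynomial.finsetSum_coeff]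
  refine continuous_finsetSum _ fun σ _ => ?_
  simp only [← Polynomial.C_eq_intCast, Polynomial.coeff_C_mul]
  refine continuous_const.mul (key _ _ (fun a d => ?_) _)
  simp only [Matrix.add_apply, Matrix.smul_apply, Matrix.map_apply, smul_eq_mul,
    Polynomial.coeff_add]
  refine Continuous.add ?_ ?_
  · exact continuous_const
  · cases d with
    | zero => simpa using continuous_const
    | succ d =>
      simp only [Polynomial.coeff_X_mul]
      cases d with
      | zero => simpa using continuous_id.matrix_elem _ _
      | succ d => simpa [Polynomial.coeff_C] using continuous_const

theorem continuous_hirzebruchL (k : ℕ) : Continuous (hirzebruchL k : Matrix κ κ ℝ → ℝ) := by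
  unfold hirzebruchL
  simp only [MvPolynomial.aeval_def, MvPolynomial.eval₂_eq']
  exact continuous_finsetSum _ fun d _ => continuous_const.mul (continuous_finsetProd _ fun i _ =>
    ((continuous_pontryagin _).comp (continuous_const_smul _)).pow _)

theorem pontryagin_conj (j : ℕ) (D D' X : Matrix κ κ ℝ) (h : D * D' = 1) :
    pontryagin j (D * X * D') = pontryagin j X := by
  unfold pontryagin
  have h1 : D.map Polynomial.C * D'.map Polynomial.C = 1 := by
    rw [← Matrix.map_mul, h]; simp
  have h2 : (1 + (Polynomial.X : Polynomial ℝ) • (D * X * D').map Polynomial.C) =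
      D.map Polynomial.C * (1 + (Polynomial.X : Polynomial ℝ) • X.map Polynomial.C) *
        D'.map Polynomial.C := by
    rw [Matrix.map_mul, Matrix.map_mul, mul_add, add_mul, mul_one, h1, Matrix.mul_smul,
      Matrix.smul_mul]
  rw [h2, Matrix.det_mul_right_comm, h1, one_mul]

theorem hirzebruchL_conj (k : ℕ) (D D' X : Matrix κ κ ℝ) (h : D * D' = 1) :
    hirzebruchL k (D * X * D') = hirzebruchL k X := by
  unfold hirzebruchL
  congr 2
  funext j
  rw [← Matrix.smul_mul, ← Matrix.mul_smul, pontryagin_conj _ _ _ _ h]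

end Invariants

/-! ### Calculus on a slab `[0, 1) × U` -/

section Slab

/-- A derivative within a set becomes a genuine derivative along a map that stays in the set. This
handles slices of the slab up to its boundary x = 0. -/
theorem hasFDerivAt_comp_of_mapsTo {X Y : Type*} [NormedAddCommGroup X] [NormedSpace ℝ X]
    [NormedAddCommGroup Y] [NormedSpace ℝ Y] {F : X → ℝ} {T : Set X} {φ : Y → X} {L : Y →L[ℝ] X}
    {y : Y} (hF : DifferentiableWithinAt ℝ F T (φ y)) (hφ : HasFDerivAt φ L y) {s : Set Y}
    (hs : s ∈ 𝓝 y) (hT : MapsTo φ s T) :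
    HasFDerivAt (fun w => F (φ w)) ((fderivWithin ℝ F T (φ y)).comp L) y :=
  (hF.hasFDerivWithinAt.comp y hφ.hasFDerivWithinAt hT).hasFDerivAt hs

variable {E : Type*} [NormedAddCommGroup E]

/-- The set `[0, 1) × U`. -/
def slab (U : Set E) : Set (ℝ × E) := Ico 0 1 ×ˢ U

theorem slab_mem_nhds {U : Set E} (hU : IsOpen U) {ε : ℝ} (hε : ε ∈ Ioo (0 : ℝ) 1) {u : E}
    (hu : u ∈ U) : slab U ∈ 𝓝 (ε, u) :=
  prod_mem_nhds (Ico_mem_nhds hε.1 hε.2) (hU.mem_nhds hu)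

variable [NormedSpace ℝ E]

theorem uniqueDiffOn_slab {U : Set E} (hU : IsOpen U) : UniqueDiffOn ℝ (slab U) :=
  (uniqueDiffOn_Ico 0 1).prod hU.uniqueDiffOn

theorem hasFDerivAt_slice (ε : ℝ) (u : E) :
    HasFDerivAt (fun w : E => (ε, w)) (ContinuousLinearMap.inr ℝ ℝ E) u :=
  hasFDerivAt_prodMk_right ε u

/-- The derivative of `F` along the slices `x = const`, in the direction `v`. -/
def tanDeriv (U : Set E) (v : E) (F : ℝ × E → ℝ) (q : ℝ × E) : ℝ :=
  fderivWithin ℝ F (slab U) q (0, v)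

theorem contDiffOn_tanDeriv {U : Set E} (hU : IsOpen U) (v : E) {F : ℝ × E → ℝ}
    (hF : ContDiffOn ℝ ∞ F (slab U)) : ContDiffOn ℝ ∞ (tanDeriv U v F) (slab U) :=
  (hF.fderivWithin (uniqueDiffOn_slab hU) (by simp)).clm_apply contDiffOn_const

/-- Slices x = const are open in the remaining directions, even at x = 0. Tangential derivatives at
the boundary are thus ordinary derivatives of the restriction, and can be read off from H₀. -/
theorem tanDeriv_eq {U : Set E} (hU : IsOpen U) (v : E) {F : ℝ × E → ℝ} {ε : ℝ}
    (hε : ε ∈ Ico (0 : ℝ) 1) {u : E} (hu : u ∈ U)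
    (hF : DifferentiableWithinAt ℝ F (slab U) (ε, u)) :
    tanDeriv U v F (ε, u) = fderiv ℝ (fun w => F (ε, w)) u v := by
  rw [(hasFDerivAt_comp_of_mapsTo hF (hasFDerivAt_slice ε u) (hU.mem_nhds hu)
    fun w hw => ⟨hε, hw⟩).fderiv]
  simp [tanDeriv]

theorem fderiv_slice {F : ℝ × E → ℝ} {ε : ℝ} {u : E} (hF : DifferentiableAt ℝ F (ε, u)) (v : E) :
    fderiv ℝ F (ε, u) (0, v) = fderiv ℝ (fun w => F (ε, w)) u v := by
  have h := hF.hasFDerivAt.comp u (hasFDerivAt_slice ε u)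
  have h' : HasFDerivAt (fun w => F (ε, w)) _ u := h
  rw [h'.fderiv]
  simp

end Slab

/-! ### Rescaled jets of metrics and their Christoffel symbols at ε = 0. -/

section Adiabatic

variable {n f : ℕ}

/-- The vertical indices. -/
def isVert : Option (Fin n ⊕ Fin f) → Bool
  | some (Sum.inr _) => true
  | _ => false

/-- The weights of the coordinate vectors: `x²∂_x`, `x ∂_a`, `∂_i`. -/
def wt : Option (Fin n ⊕ Fin f) → ℕ
  | none => 2
  | some (Sum.inl _) => 1
  | some (Sum.inr _) => 0

/-- The unit coordinate vectors of `BdModel n f`. -/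
abbrev unitVec (i : Fin n ⊕ Fin f) : BdModel n f := EuclideanSpace.single i (1 : ℝ)

/-- Matrices with rows and columns indexed by the coordinates `(x, u)`. -/
abbrev CylMatrix (n f : ℕ) : Type := Matrix (Option (Fin n ⊕ Fin f)) (Option (Fin n ⊕ Fin f)) ℝ

/-- The conditions on the limit of the rescaled metrics: a field of positive matrices which
preserves the splitting into horizontal and vertical indices, and whose horizontal block is constant
along the fibres. -/
structure IsBlockMetric (U : Set (BdModel n f)) (H₀ : BdModel n f → CylMatrix n f) : Prop where
  smooth : ∀ α β, ContDiffOn ℝ ∞ (fun u => H₀ u α β) U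
  block : ∀ u ∈ U, H₀ u ∈ blockDiag isVert
  indep : ∀ u ∈ U, ∀ α β, isVert α = false → isVert β = false → ∀ j,
    fderiv ℝ (fun w => H₀ w α β) u (unitVec (Sum.inr j)) = 0
  det_pos : ∀ u ∈ U, 0 < (H₀ u).det

/-- The rescaled first order jet of a family of metrics along the hypersurfaces `x = ε`: the values
`H` of the components, their derivatives `X` in the direction `ε ∂_x`, and the first order term `m`
of `H` in `ε`. -/
structure Jet (n f : ℕ) where
  H : ℝ × BdModel n f → CylMatrix n f
  X : ℝ × BdModel n f → CylMatrix n f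
  m : ℝ × BdModel n f → CylMatrix n f

/-- The conditions satisfied by the rescaled jets of exact `φ`-metrics and auxiliary metrics. -/
structure Jet.IsRegular (U : Set (BdModel n f)) (H₀ : BdModel n f → CylMatrix n f)
    (c : CylMatrix n f) (J : Jet n f) : Prop where
  smoothH : ∀ α β, ContDiffOn ℝ ∞ (fun q => J.H q α β) (slab U)
  smoothX : ∀ α β, ContDiffOn ℝ ∞ (fun q => J.X q α β) (slab U)
  smoothm : ∀ α β, ContDiffOn ℝ ∞ (fun q => J.m q α β) (slab U)
  H_zero : ∀ u ∈ U, J.H (0, u) = H₀ u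
  H_eq : ∀ q ∈ slab U, ∀ α β, (isVert α && isVert β) = false →
    J.H q α β = H₀ q.2 α β + q.1 * J.m q α β
  m_zero : ∀ u ∈ U, ∀ α β, isVert α = false → isVert β = false → J.m (0, u) α β = 0
  X_zero : ∀ u ∈ U, ∀ α β, J.X (0, u) α β = c α β * H₀ u α β

/-- `J` is the rescaled jet of the family of metrics with components `G ε`. -/
structure Jet.Represents (U : Set (BdModel n f)) (G : ℝ → ℝ × BdModel n f → CylMatrix n f)
    (J : Jet n f) : Prop where
  contDiffAt : ∀ ε ∈ Ioo (0 : ℝ) 1, ∀ u ∈ U, ∀ α β, ContDiffAt ℝ ∞ (fun q => G ε q α β) (ε, u)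
  symm : ∀ ε ∈ Ioo (0 : ℝ) 1, ∀ x ∈ Ioo (0 : ℝ) 1, ∀ u ∈ U, ∀ α β,
    G ε (x, u) α β = G ε (x, u) β α
  value : ∀ ε ∈ Ioo (0 : ℝ) 1, ∀ u ∈ U, ∀ α β,
    ε ^ (wt α + wt β) * G ε (ε, u) α β = J.H (ε, u) α β
  deriv_x : ∀ ε ∈ Ioo (0 : ℝ) 1, ∀ u ∈ U, ∀ α β,
    ε ^ (wt α + wt β + 1) * pd none (fun q => G ε q α β) (ε, u) = J.X (ε, u) α β

/-- Affine combinations of jets. -/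
def Jet.mix (J₀ J₁ : Jet n f) (t : ℝ) : Jet n f where
  H q := (1 - t) • J₀.H q + t • J₁.H q
  X q := (1 - t) • J₀.X q + t • J₁.X q
  m q := (1 - t) • J₀.m q + t • J₁.m q

variable {U : Set (BdModel n f)} {H₀ : BdModel n f → CylMatrix n f} {J J₀ J₁ : Jet n f}
  {G G₀ G₁ : ℝ → ℝ × BdModel n f → CylMatrix n f} {c c₀ c₁ : CylMatrix n f}

/-- All the conditions are affine in the jet once H₀ is shared; only the constants `c` get
interpolated. Hence what is proved for one jet holds along the whole path of metrics. -/
theorem Jet.IsRegular.mix (h₀ : J₀.IsRegular U H₀ c₀) (h₁ : J₁.IsRegular U H₀ c₁) (t : ℝ) :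
    (J₀.mix J₁ t).IsRegular U H₀ ((1 - t) • c₀ + t • c₁) where
  smoothH α β := (contDiffOn_const.mul (h₀.smoothH α β)).add
    (contDiffOn_const.mul (h₁.smoothH α β))
  smoothX α β := (contDiffOn_const.mul (h₀.smoothX α β)).add
    (contDiffOn_const.mul (h₁.smoothX α β))
  smoothm α β := (contDiffOn_const.mul (h₀.smoothm α β)).add
    (contDiffOn_const.mul (h₁.smoothm α β))
  H_zero u hu := by
    simp only [Jet.mix, h₀.H_zero u hu, h₁.H_zero u hu, ← add_smul]
    simp
  H_eq q hq α β h := by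
    simp only [Jet.mix, Matrix.add_apply, Matrix.smul_apply, smul_eq_mul, h₀.H_eq q hq α β h,
      h₁.H_eq q hq α β h]
    ring
  m_zero u hu α β hα hβ := by
    simp [Jet.mix, h₀.m_zero u hu α β hα hβ, h₁.m_zero u hu α β hα hβ]
  X_zero u hu α β := by
    simp only [Jet.mix, Matrix.add_apply, Matrix.smul_apply, smul_eq_mul, h₀.X_zero u hu α β,
      h₁.X_zero u hu α β]
    ring

theorem Jet.Represents.mix (h₀ : J₀.Represents U G₀) (h₁ : J₁.Represents U G₁) (t : ℝ) :
    (J₀.mix J₁ t).Represents U (fun ε => metricPath (G₀ ε) (G₁ ε) t) where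
  contDiffAt ε hε u hu α β := (contDiffAt_const.mul (h₀.contDiffAt ε hε u hu α β)).add
    (contDiffAt_const.mul (h₁.contDiffAt ε hε u hu α β))
  symm ε hε x hx u hu α β := by
    simp [metricPath, h₀.symm ε hε x hx u hu α β, h₁.symm ε hε x hx u hu α β]
  value ε hε u hu α β := by
    simp only [Jet.mix, metricPath, Matrix.add_apply, Matrix.smul_apply, smul_eq_mul,
      ← h₀.value ε hε u hu α β, ← h₁.value ε hε u hu α β]
    ring
  deriv_x ε hε u hu α β := by
    have d₀ := (h₀.contDiffAt ε hε u hu α β).differentiableAt (by simp)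
    have d₁ := (h₁.contDiffAt ε hε u hu α β).differentiableAt (by simp)
    simp only [Jet.mix, metricPath, Matrix.add_apply, Matrix.smul_apply, smul_eq_mul,
      ← h₀.deriv_x ε hε u hu α β, ← h₁.deriv_x ε hε u hu α β, pd]
    rw [fderiv_fun_add (d₀.const_mul _) (d₁.const_mul _), fderiv_const_mul d₀,
      fderiv_const_mul d₁]
    simp only [add_apply, smul_apply, smul_eq_mul]
    ring

/-- The rescaled derivatives `∂_α g_(βμ)` on the hypersurface `x = ε`, where `μ` is tangential. -/
def Jet.lower (U : Set (BdModel n f)) (J : Jet n f) (α β : Option (Fin n ⊕ Fin f))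
    (μ : Fin n ⊕ Fin f) (q : ℝ × BdModel n f) : ℝ :=
  match α, μ with
  | none, Sum.inl a => J.X q β (some (Sum.inl a))
  | none, Sum.inr i => q.1 * J.X q β (some (Sum.inr i))
  | some (Sum.inl b), Sum.inl a =>
    tanDeriv U (unitVec (Sum.inl b)) (fun r => J.H r β (some (Sum.inl a))) q
  | some (Sum.inl b), Sum.inr i =>
    q.1 * tanDeriv U (unitVec (Sum.inl b)) (fun r => J.H r β (some (Sum.inr i))) q
  | some (Sum.inr j), Sum.inl a =>
    tanDeriv U (unitVec (Sum.inr j)) (fun r => J.m r β (some (Sum.inl a))) q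
  | some (Sum.inr j), Sum.inr i =>
    tanDeriv U (unitVec (Sum.inr j)) (fun r => J.H r β (some (Sum.inr i))) q

/-- The rescaled Christoffel symbols of the first kind. -/
def Jet.christoffel (U : Set (BdModel n f)) (J : Jet n f) (μ : Fin n ⊕ Fin f)
    (q : ℝ × BdModel n f) : CylMatrix n f :=
  Matrix.of fun α β => (-J.lower U α β μ q + J.lower U β α μ q +
    tanDeriv U (unitVec μ) (fun r => J.H r α β) q) / 2

theorem Jet.IsRegular.contDiffOn_lower (h : J.IsRegular U H₀ c) (hU : IsOpen U)
    (α β : Option (Fin n ⊕ Fin f)) (μ : Fin n ⊕ Fin f) :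
    ContDiffOn ℝ ∞ (J.lower U α β μ) (slab U) := by
  unfold Jet.lower
  rcases α with _ | b | j <;> rcases μ with a | i <;> dsimp only
  · exact h.smoothX _ _
  · exact contDiffOn_fst.mul (h.smoothX _ _)
  · exact contDiffOn_tanDeriv hU _ (h.smoothH _ _)
  · exact contDiffOn_fst.mul (contDiffOn_tanDeriv hU _ (h.smoothH _ _))
  · exact contDiffOn_tanDeriv hU _ (h.smoothm _ _)
  · exact contDiffOn_tanDeriv hU _ (h.smoothH _ _)

theorem Jet.IsRegular.contDiffOn_christoffel (h : J.IsRegular U H₀ c) (hU : IsOpen U)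
    (μ : Fin n ⊕ Fin f) (α β : Option (Fin n ⊕ Fin f)) :
    ContDiffOn ℝ ∞ (fun q => J.christoffel U μ q α β) (slab U) :=
  (((h.contDiffOn_lower hU α β μ).neg.add (h.contDiffOn_lower hU β α μ)).add
    (contDiffOn_tanDeriv hU _ (h.smoothH _ _))).div_const 2

theorem differentiableWithinAt_slab {F : ℝ × BdModel n f → ℝ} (hF : ContDiffOn ℝ ∞ F (slab U))
    {q : ℝ × BdModel n f} (hq : q ∈ slab U) : DifferentiableWithinAt ℝ F (slab U) q :=
  (hF q hq).differentiableWithinAt (by simp)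

theorem Jet.IsRegular.tanDeriv_zero (h : J.IsRegular U H₀ c) (hU : IsOpen U) (v : BdModel n f)
    {u : BdModel n f} (hu : u ∈ U) (α β : Option (Fin n ⊕ Fin f)) :
    tanDeriv U v (fun r => J.H r α β) (0, u) = fderiv ℝ (fun w => H₀ w α β) u v := by
  have h0 : (0 : ℝ) ∈ Ico (0 : ℝ) 1 := by simp
  rw [tanDeriv_eq hU v h0 hu (differentiableWithinAt_slab (h.smoothH α β) ⟨h0, hu⟩)]
  congr 1
  refine Filter.EventuallyEq.fderiv_eq ?_
  filter_upwards [hU.mem_nhds hu] with w hw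
  rw [h.H_zero w hw]

theorem IsBlockMetric.fderiv_mixed (hB : IsBlockMetric U H₀) (hU : IsOpen U) {u : BdModel n f}
    (hu : u ∈ U) {α β : Option (Fin n ⊕ Fin f)} (hαβ : isVert α ≠ isVert β) (v : BdModel n f) :
    fderiv ℝ (fun w => H₀ w α β) u v = 0 := by
  have : (fun w => H₀ w α β) =ᶠ[𝓝 u] fun _ => 0 := by
    filter_upwards [hU.mem_nhds hu] with w hw
    exact hB.block w hw α β hαβ
  rw [this.fderiv_eq]
  simp

theorem Jet.IsRegular.tanDeriv_m_zero (h : J.IsRegular U H₀ c) (hU : IsOpen U) (v : BdModel n f)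
    {u : BdModel n f} (hu : u ∈ U) {α β : Option (Fin n ⊕ Fin f)} (hα : isVert α = false)
    (hβ : isVert β = false) : tanDeriv U v (fun r => J.m r α β) (0, u) = 0 := by
  have h0 : (0 : ℝ) ∈ Ico (0 : ℝ) 1 := by simp
  rw [tanDeriv_eq hU v h0 hu (differentiableWithinAt_slab (h.smoothm α β) ⟨h0, hu⟩)]
  have : (fun w => J.m (0, w) α β) =ᶠ[𝓝 u] fun _ => 0 := by
    filter_upwards [hU.mem_nhds hu] with w hw
    exact h.m_zero w hw α β hα hβ
  rw [this.fderiv_eq]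
  simp

theorem Jet.IsRegular.lower_zero_mixed (h : J.IsRegular U H₀ c) (hB : IsBlockMetric U H₀)
    (hU : IsOpen U) {u : BdModel n f} (hu : u ∈ U) {α β : Option (Fin n ⊕ Fin f)}
    (hαβ : isVert α ≠ isVert β) (μ : Fin n ⊕ Fin f) : J.lower U α β μ (0, u) = 0 := by
  rcases α with _ | b | j <;> rcases μ with a | i <;> simp only [Jet.lower]
  · rw [h.X_zero u hu, hB.block u hu _ _ (fun h' => hαβ (by rw [h']; rfl)), mul_zero]
  · exact zero_mul _
  · rw [h.tanDeriv_zero hU _ hu, hB.fderiv_mixed hU hu (fun h' => hαβ (by rw [h']; rfl))]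
  · exact zero_mul _
  -- Here β is horizontal, and the entry is a fibre derivative of the horizontal block of `m` at ε =
  -- 0. For a φ-metric, `m_zero` comes from condition (i) on A.
  · refine h.tanDeriv_m_zero hU _ hu ?_ rfl
    cases hβ : isVert β
    · rfl
    · exact absurd (by rw [hβ]; rfl) hαβ
  · rw [h.tanDeriv_zero hU _ hu, hB.fderiv_mixed hU hu (fun h' => hαβ (by rw [h']; rfl))]

/-- Each term in a mixed entry is at ε = 0 one of four things: it carries a factor ε, or is a
multiple of a mixed entry of H₀, or a derivative of such an entry, or the fibre derivative of the
horizontal block of `m`. All of them vanish. -/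
theorem Jet.IsRegular.christoffel_zero_block (h : J.IsRegular U H₀ c) (hB : IsBlockMetric U H₀)
    (hU : IsOpen U) {u : BdModel n f} (hu : u ∈ U) (μ : Fin n ⊕ Fin f) :
    J.christoffel U μ (0, u) ∈ blockDiag isVert := by
  intro α β hαβ
  simp [Jet.christoffel, h.lower_zero_mixed hB hU hu hαβ, h.lower_zero_mixed hB hU hu hαβ.symm,
    h.tanDeriv_zero hU _ hu, hB.fderiv_mixed hU hu hαβ]

/-- In a fibre direction the antisymmetric terms carry a factor ε, and the remaining one is the
fibre derivative of the fibre-constant horizontal block of H₀. -/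
theorem Jet.IsRegular.christoffel_zero_vert (h : J.IsRegular U H₀ c) (hB : IsBlockMetric U H₀)
    (hU : IsOpen U) {u : BdModel n f} (hu : u ∈ U) (i : Fin f) {α β : Option (Fin n ⊕ Fin f)}
    (hα : isVert α = false) (hβ : isVert β = false) :
    J.christoffel U (Sum.inr i) (0, u) α β = 0 := by
  have key : ∀ α β : Option (Fin n ⊕ Fin f), isVert α = false →
      J.lower U α β (Sum.inr i) (0, u) = 0 := by
    intro α β hα
    rcases α with _ | b | j
    · exact zero_mul _
    · exact zero_mul _
    · cases hα
  simp [Jet.christoffel, key α β hα, key β α hβ, h.tanDeriv_zero hU _ hu, hB.indep u hu α β hα hβ]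

/-- On the diagonal the two `lower` terms cancel. The result depends on H₀ alone, which for
one-dimensional fibres settles the whole vertical block. -/
theorem Jet.IsRegular.christoffel_zero_diag (h : J.IsRegular U H₀ c) (hU : IsOpen U)
    {u : BdModel n f} (hu : u ∈ U) (μ : Fin n ⊕ Fin f) (α : Option (Fin n ⊕ Fin f)) :
    J.christoffel U μ (0, u) α α = fderiv ℝ (fun w => H₀ w α α) u (unitVec μ) / 2 := by
  simp [Jet.christoffel, h.tanDeriv_zero hU _ hu]

theorem fderiv_fderiv_comm {E : Type*} [NormedAddCommGroup E] [NormedSpace ℝ E] {F : E → ℝ} {u : E}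
    (hF : ContDiffAt ℝ ∞ F u) (v w : E) :
    fderiv ℝ (fun p => fderiv ℝ F p v) u w = fderiv ℝ (fun p => fderiv ℝ F p w) u v := by
  have hd : DifferentiableAt ℝ (fderiv ℝ F) u :=
    (hF.fderiv_right (m := ∞) (by simp)).differentiableAt (by simp)
  have hs : IsSymmSndFDerivAt ℝ F u := hF.isSymmSndFDerivAt (by simpa using WithTop.coe_le_coe.2 (le_top : (2 : ℕ∞) ≤ ⊤))
  have key : ∀ v w, fderiv ℝ (fun p => fderiv ℝ F p v) u w = fderiv ℝ (fderiv ℝ F) u w v := by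
    intro v w
    rw [fderiv_clm_apply hd (by fun_prop)]
    simp
  rw [key, key, hs.eq]

theorem IsBlockMetric.contDiffAt (hB : IsBlockMetric U H₀) (hU : IsOpen U) {u : BdModel n f}
    (hu : u ∈ U) (α β : Option (Fin n ⊕ Fin f)) : ContDiffAt ℝ ∞ (fun w => H₀ w α β) u :=
  (hB.smooth α β).contDiffAt (hU.mem_nhds hu)

theorem IsBlockMetric.fderiv_fderiv_eq_zero (hB : IsBlockMetric U H₀) (hU : IsOpen U)
    {u : BdModel n f} (hu : u ∈ U) {α β : Option (Fin n ⊕ Fin f)} (hα : isVert α = false)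
    (hβ : isVert β = false) (j : Fin f) (v : BdModel n f) :
    fderiv ℝ (fun p => fderiv ℝ (fun w => H₀ w α β) p v) u (unitVec (Sum.inr j)) = 0 := by
  rw [fderiv_fderiv_comm (hB.contDiffAt hU hu α β)]
  have : (fun p => fderiv ℝ (fun w => H₀ w α β) p (unitVec (Sum.inr j))) =ᶠ[𝓝 u] fun _ => 0 := by
    filter_upwards [hU.mem_nhds hu] with w hw
    exact hB.indep w hw α β hα hβ j
  rw [this.fderiv_eq]
  simp

theorem differentiableAt_slice_zero (hU : IsOpen U) {F : ℝ × BdModel n f → ℝ}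
    (hF : ContDiffOn ℝ ∞ F (slab U)) {u : BdModel n f} (hu : u ∈ U) :
    DifferentiableAt ℝ (fun w => F (0, w)) u :=
  (hasFDerivAt_comp_of_mapsTo (differentiableWithinAt_slab hF (q := (0, u)) ⟨by simp, hu⟩)
    (hasFDerivAt_slice 0 u) (hU.mem_nhds hu) fun w hw => ⟨by simp, hw⟩).differentiableAt

/-- On the horizontal block only entries of H₀, times the constants `c`, and their base derivatives
occur. These are fibre-constant, the latter because second derivatives commute. That `c` does not
depend on the point is essential. -/
theorem Jet.IsRegular.fderiv_lower_zero (h : J.IsRegular U H₀ c) (hB : IsBlockMetric U H₀)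
    (hU : IsOpen U) {u : BdModel n f} (hu : u ∈ U) (a : Fin n) (j : Fin f)
    {α β : Option (Fin n ⊕ Fin f)} (hα : isVert α = false) (hβ : isVert β = false) :
    fderiv ℝ (fun w => J.lower U α β (Sum.inl a) (0, w)) u (unitVec (Sum.inr j)) = 0 := by
  rcases α with _ | b | i
  · have : (fun w => J.lower U none β (Sum.inl a) (0, w)) =ᶠ[𝓝 u]
        fun w => c β (some (Sum.inl a)) * H₀ w β (some (Sum.inl a)) := by
      filter_upwards [hU.mem_nhds hu] with w hw
      exact h.X_zero w hw _ _
    rw [this.fderiv_eq, fderiv_const_mul ((hB.contDiffAt hU hu _ _).differentiableAt (by simp))]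
    simp [hB.indep u hu β (some (Sum.inl a)) hβ rfl]
  · have : (fun w => J.lower U (some (Sum.inl b)) β (Sum.inl a) (0, w)) =ᶠ[𝓝 u]
        fun w => fderiv ℝ (fun w => H₀ w β (some (Sum.inl a))) w (unitVec (Sum.inl b)) := by
      filter_upwards [hU.mem_nhds hu] with w hw
      exact h.tanDeriv_zero hU _ hw _ _
    rw [this.fderiv_eq, hB.fderiv_fderiv_eq_zero hU hu hβ rfl]
  · cases hα

theorem Jet.IsRegular.fderiv_christoffel_zero (h : J.IsRegular U H₀ c) (hB : IsBlockMetric U H₀)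
    (hU : IsOpen U) {u : BdModel n f} (hu : u ∈ U) (a : Fin n) (j : Fin f)
    {α β : Option (Fin n ⊕ Fin f)} (hα : isVert α = false) (hβ : isVert β = false) :
    fderiv ℝ (fun w => J.christoffel U (Sum.inl a) (0, w) α β) u (unitVec (Sum.inr j)) = 0 := by
  have d1 := differentiableAt_slice_zero hU (h.contDiffOn_lower hU α β (Sum.inl a)) hu
  have d2 := differentiableAt_slice_zero hU (h.contDiffOn_lower hU β α (Sum.inl a)) hu
  have d3 := differentiableAt_slice_zero hU
    (contDiffOn_tanDeriv hU (unitVec (Sum.inl a)) (h.smoothH α β)) hu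
  have e3 : fderiv ℝ (fun w => tanDeriv U (unitVec (Sum.inl a)) (fun r => J.H r α β) (0, w)) u
      (unitVec (Sum.inr j)) = 0 := by
    have : (fun w => tanDeriv U (unitVec (Sum.inl a)) (fun r => J.H r α β) (0, w)) =ᶠ[𝓝 u]
        fun w => fderiv ℝ (fun w => H₀ w α β) w (unitVec (Sum.inl a)) := by
      filter_upwards [hU.mem_nhds hu] with w hw
      exact h.tanDeriv_zero hU _ hw _ _
    rw [this.fderiv_eq, hB.fderiv_fderiv_eq_zero hU hu hα hβ]
  have hd := ((d1.hasFDerivAt.neg.add d2.hasFDerivAt).add d3.hasFDerivAt).mul_const (2 : ℝ)⁻¹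
  have hd' : HasFDerivAt (fun w => J.christoffel U (Sum.inl a) (0, w) α β) _ u := hd
  rw [hd'.fderiv]
  simp [e3, h.fderiv_lower_zero hB hU hu a j hα hβ, h.fderiv_lower_zero hB hU hu a j hβ hα]

end Adiabatic

/-! ### Smoothness of determinants and inverses -/

section MatrixSmooth

variable {X : Type*} [NormedAddCommGroup X] [NormedSpace ℝ X] {κ : Type*} [Fintype κ]
  {A B : X → Matrix κ κ ℝ} {s : Set X} {x : X}

theorem contDiffWithinAt_mul (hA : ∀ a b, ContDiffWithinAt ℝ ∞ (fun y => A y a b) s x)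
    (hB : ∀ a b, ContDiffWithinAt ℝ ∞ (fun y => B y a b) s x) (a b : κ) :
    ContDiffWithinAt ℝ ∞ (fun y => (A y * B y) a b) s x := by
  simp only [Matrix.mul_apply]
  exact ContDiffWithinAt.sum fun c _ => (hA a c).mul (hB c b)

variable [DecidableEq κ]

theorem contDiffWithinAt_det (hA : ∀ a b, ContDiffWithinAt ℝ ∞ (fun y => A y a b) s x) :
    ContDiffWithinAt ℝ ∞ (fun y => (A y).det) s x := by
  simp only [Matrix.det_apply']
  exact ContDiffWithinAt.sum fun σ _ => contDiffWithinAt_const.mul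
    (contDiffWithinAt_prod fun a _ => hA _ _)

theorem contDiffWithinAt_inv (hA : ∀ a b, ContDiffWithinAt ℝ ∞ (fun y => A y a b) s x)
    (hx : (A x).det ≠ 0) (a b : κ) : ContDiffWithinAt ℝ ∞ (fun y => (A y)⁻¹ a b) s x := by
  simp only [Matrix.inv_def, Ring.inverse_eq_inv', Matrix.smul_apply, smul_eq_mul,
    Matrix.adjugate_apply]
  refine ((contDiffWithinAt_det hA).inv hx).mul (contDiffWithinAt_det fun i j => ?_)
  simp only [Matrix.updateRow_apply]
  split_ifs
  · exact contDiffWithinAt_const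
  · exact hA i j

end MatrixSmooth

theorem contDiffAt_pd {ι : Type*} [Fintype ι] [DecidableEq ι] {F : ℝ × EuclideanSpace ℝ ι → ℝ}
    {p : ℝ × EuclideanSpace ℝ ι} (hF : ContDiffAt ℝ ∞ F p) (α : Option ι) :
    ContDiffAt ℝ ∞ (pd α F) p :=
  (hF.fderiv_right (m := ∞) (by simp)).clm_apply contDiffAt_const

theorem differentiableAt_leviCivita {ι : Type*} [Fintype ι] [DecidableEq ι]
    {G : ℝ × EuclideanSpace ℝ ι → Matrix (Option ι) (Option ι) ℝ} {p : ℝ × EuclideanSpace ℝ ι}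
    (hG : ∀ α β, ContDiffAt ℝ ∞ (fun q => G q α β) p) (hp : (G p).det ≠ 0) (μ α β : Option ι) :
    DifferentiableAt ℝ (fun q => leviCivita G q μ α β) p := by
  have hinv : ∀ a b, ContDiffAt ℝ ∞ (fun q => (G q)⁻¹ a b) p := fun a b =>
    contDiffWithinAt_univ.1 (contDiffWithinAt_inv (fun a b => (hG a b).contDiffWithinAt) hp a b)
  have h : ContDiffAt ℝ ∞ (fun q => leviCivita G q μ α β) p := by
    simp only [leviCivita, Matrix.of_apply]
    exact ContDiffAt.sum fun ν _ => ((hinv α ν).div_const 2).mul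
      (((contDiffAt_pd (hG _ _) _).neg.add (contDiffAt_pd (hG _ _) _)).add
        (contDiffAt_pd (hG _ _) _))
  exact h.differentiableAt (by simp)

/-! ### From coordinate frames to rescaled frames. -/

section Bridge

variable {n f : ℕ} {U : Set (BdModel n f)} {H₀ : BdModel n f → CylMatrix n f} {J J₀ J₁ : Jet n f}
  {G G₀ G₁ : ℝ → ℝ × BdModel n f → CylMatrix n f} {c c₀ c₁ : CylMatrix n f}

/-- The diagonal matrix of the rescaling `x²∂_x, x ∂_a, ∂_i` at `x = ε`. -/
def scale (ε : ℝ) : CylMatrix n f := Matrix.diagonal fun α => ε ^ wt α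

/-- The inverse of `scale ε`. -/
def unscale (ε : ℝ) : CylMatrix n f := Matrix.diagonal fun α => (ε ^ wt α)⁻¹

theorem scale_mul_unscale {ε : ℝ} (hε : ε ≠ 0) : (scale ε : CylMatrix n f) * unscale ε = 1 := by
  rw [scale, unscale, Matrix.diagonal_mul_diagonal, ← Matrix.diagonal_one]
  congr 1
  funext α
  exact mul_inv_cancel₀ (pow_ne_zero _ hε)

theorem unscale_mul_scale {ε : ℝ} (hε : ε ≠ 0) : (unscale ε : CylMatrix n f) * scale ε = 1 := by
  rw [mul_eq_one_comm, scale_mul_unscale hε]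

theorem Jet.Represents.H_eq (h : J.Represents U G) {ε : ℝ} (hε : ε ∈ Ioo (0 : ℝ) 1)
    {u : BdModel n f} (hu : u ∈ U) : J.H (ε, u) = scale ε * G ε (ε, u) * scale ε := by
  ext α β
  rw [scale, Matrix.mul_diagonal, Matrix.diagonal_mul, ← h.value ε hε u hu, pow_add]
  ring

theorem Jet.Represents.G_eq (h : J.Represents U G) {ε : ℝ} (hε : ε ∈ Ioo (0 : ℝ) 1)
    {u : BdModel n f} (hu : u ∈ U) : G ε (ε, u) = unscale ε * J.H (ε, u) * unscale ε := by
  rw [h.H_eq hε hu]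
  simp only [Matrix.mul_assoc, scale_mul_unscale hε.1.ne', mul_one]
  rw [← Matrix.mul_assoc, unscale_mul_scale hε.1.ne', one_mul]

theorem Jet.Represents.inv_eq (h : J.Represents U G) {ε : ℝ} (hε : ε ∈ Ioo (0 : ℝ) 1)
    {u : BdModel n f} (hu : u ∈ U) : (G ε (ε, u))⁻¹ = scale ε * (J.H (ε, u))⁻¹ * scale ε := by
  have hi : (unscale ε : CylMatrix n f)⁻¹ = scale ε :=
    Matrix.inv_eq_left_inv (scale_mul_unscale hε.1.ne')
  rw [h.G_eq hε hu, Matrix.mul_inv_rev, Matrix.mul_inv_rev, hi, Matrix.mul_assoc]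

theorem Jet.Represents.pd_some (h : J.Represents U G) (hJ : J.IsRegular U H₀ c) (hU : IsOpen U)
    {ε : ℝ} (hε : ε ∈ Ioo (0 : ℝ) 1) {u : BdModel n f} (hu : u ∈ U) (j : Fin n ⊕ Fin f)
    (α β : Option (Fin n ⊕ Fin f)) :
    ε ^ (wt α + wt β) * pd (some j) (fun q => G ε q α β) (ε, u) =
      tanDeriv U (unitVec j) (fun r => J.H r α β) (ε, u) := by
  have hd := (h.contDiffAt ε hε u hu α β).differentiableAt (by simp)
  have hε' : ε ∈ Ico (0 : ℝ) 1 := ⟨hε.1.le, hε.2⟩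
  have hs : DifferentiableAt ℝ (fun w => G ε (ε, w) α β) u :=
    (hd.hasFDerivAt.comp u (hasFDerivAt_slice ε u)).differentiableAt
  rw [tanDeriv_eq hU _ hε' hu (differentiableWithinAt_slab (hJ.smoothH α β) ⟨hε', hu⟩)]
  have : (fun w => J.H (ε, w) α β) =ᶠ[𝓝 u] fun w => ε ^ (wt α + wt β) * G ε (ε, w) α β := by
    filter_upwards [hU.mem_nhds hu] with w hw
    exact (h.value ε hε w hw α β).symm
  rw [this.fderiv_eq, fderiv_const_mul hs, smul_apply, smul_eq_mul, pd, coordVec,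
    fderiv_slice hd]

/-- The left side has weights for α and β but none for μ, since the connection form is evaluated on
the unscaled ∂_μ. Comparing with the weight of the entry (β, μ) leaves a power ε, 1 or 1/ε; the last
occurs only for a fibre derivative and a base index μ. -/
theorem Jet.Represents.pd_lower (h : J.Represents U G) (hJ : J.IsRegular U H₀ c)
    (hB : IsBlockMetric U H₀) (hU : IsOpen U) {ε : ℝ} (hε : ε ∈ Ioo (0 : ℝ) 1)
    {u : BdModel n f} (hu : u ∈ U) (α β : Option (Fin n ⊕ Fin f)) (μ : Fin n ⊕ Fin f) :
    ε ^ (wt α + wt β) * pd α (fun q => G ε q β (some μ)) (ε, u) = J.lower U α β μ (ε, u) := by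
  have hε' : ε ∈ Ico (0 : ℝ) 1 := ⟨hε.1.le, hε.2⟩
  rcases α with _ | b | j <;> rcases μ with a | i <;> simp only [Jet.lower]
  · rw [← h.deriv_x ε hε u hu]; simp only [wt]; ring
  · rw [← h.deriv_x ε hε u hu]; simp only [wt]; ring
  · rw [← h.pd_some hJ hU hε hu]; simp only [wt]; ring
  · rw [← h.pd_some hJ hU hε hu]; simp only [wt]; ring
  -- The 1/ε case. The fibre derivative of H₀ + ε m at (β, a) has no leading part: H₀ is
  -- fibre-constant there if β is horizontal and zero if β is vertical. Dividing by ε leaves the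
  -- derivative of `m`.
  · have h1 := h.pd_some hJ hU hε hu (Sum.inr j) β (some (Sum.inl a))
    have hm := differentiableWithinAt_slab (hJ.smoothm β (some (Sum.inl a)))
      (q := (ε, u)) ⟨hε', hu⟩
    rw [tanDeriv_eq hU _ hε' hu (differentiableWithinAt_slab (hJ.smoothH _ _) ⟨hε', hu⟩)] at h1
    rw [tanDeriv_eq hU _ hε' hu hm]
    have hms : DifferentiableAt ℝ (fun w => J.m (ε, w) β (some (Sum.inl a))) u :=
      (hasFDerivAt_comp_of_mapsTo hm (hasFDerivAt_slice ε u) (hU.mem_nhds hu)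
        fun w hw => ⟨hε', hw⟩).differentiableAt
    have h0 : DifferentiableAt ℝ (fun w => H₀ w β (some (Sum.inl a))) u :=
      (hB.contDiffAt hU hu _ _).differentiableAt (by simp)
    have he : (fun w => J.H (ε, w) β (some (Sum.inl a))) =ᶠ[𝓝 u]
        fun w => H₀ w β (some (Sum.inl a)) + ε * J.m (ε, w) β (some (Sum.inl a)) := by
      filter_upwards [hU.mem_nhds hu] with w hw
      exact hJ.H_eq (ε, w) ⟨hε', hw⟩ _ _ (by simp [isVert])
    have hz : fderiv ℝ (fun w => H₀ w β (some (Sum.inl a))) u (unitVec (Sum.inr j)) = 0 := by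
      by_cases hβ : isVert β = false
      · exact hB.indep u hu _ _ hβ rfl j
      · exact hB.fderiv_mixed hU hu hβ _
    rw [he.fderiv_eq, fderiv_fun_add h0 (hms.const_mul ε), fderiv_const_mul hms, add_apply, hz,
      zero_add, smul_apply, smul_eq_mul] at h1
    refine mul_left_cancel₀ hε.1.ne' ?_
    rw [← h1]
    simp only [wt]
    ring
  · rw [← h.pd_some hJ hU hε hu]; simp only [wt]; ring

/-- The inverse metric supplies ε^(wt α + wt ν) and the lowered symbol absorbs ε^(wt ν + wt β), so
ε^(wt α - wt β) remains, which is a conjugation. There is no inhomogeneous term because the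
rescaling is constant on x = ε. -/
theorem Jet.Represents.leviCivita_eq (h : J.Represents U G) (hJ : J.IsRegular U H₀ c)
    (hB : IsBlockMetric U H₀) (hU : IsOpen U) {ε : ℝ} (hε : ε ∈ Ioo (0 : ℝ) 1)
    {u : BdModel n f} (hu : u ∈ U) (μ : Fin n ⊕ Fin f) :
    leviCivita (G ε) (ε, u) (some μ) =
      scale ε * ((J.H (ε, u))⁻¹ * J.christoffel U μ (ε, u)) * unscale ε := by
  ext α β
  have hsymm : ∀ γ ν δ, pd γ (fun q => G ε q ν δ) (ε, u) = pd γ (fun q => G ε q δ ν) (ε, u) := by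
    intro γ ν δ
    have : (fun q => G ε q ν δ) =ᶠ[𝓝 (ε, u)] fun q => G ε q δ ν := by
      filter_upwards [prod_mem_nhds (Ioo_mem_nhds hε.1 hε.2) (hU.mem_nhds hu)] with q hq
      exact h.symm ε hε q.1 hq.1 q.2 hq.2 ν δ
    rw [pd, pd, this.fderiv_eq]
  rw [scale, unscale, Matrix.mul_diagonal, Matrix.diagonal_mul, Matrix.mul_apply, Finset.mul_sum,
    Finset.sum_mul, leviCivita, Matrix.of_apply]
  refine Finset.sum_congr rfl fun ν _ => ?_
  rw [h.inv_eq hε hu, scale, Matrix.mul_diagonal, Matrix.diagonal_mul, Jet.christoffel,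
    Matrix.of_apply, ← h.pd_lower hJ hB hU hε hu, ← h.pd_lower hJ hB hU hε hu,
    ← h.pd_some hJ hU hε hu, hsymm β (some μ) ν]
  have hβ : ε ^ wt β ≠ 0 := pow_ne_zero _ hε.1.ne'
  rw [pow_add, pow_add]
  field_simp

/-- The parameter space `[0, 1) × U × ℝ` of the paths of connections. -/
def pathSlab (U : Set (BdModel n f)) : Set ((ℝ × BdModel n f) × ℝ) := slab U ×ˢ univ

theorem uniqueDiffOn_pathSlab (hU : IsOpen U) : UniqueDiffOn ℝ (pathSlab U) :=
  (uniqueDiffOn_slab hU).prod uniqueDiffOn_univ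

/-- The curvature of the rescaled connection forms `Γ` on the hypersurfaces `x = ε`. -/
def slabCurvature (U : Set (BdModel n f))
    (Γ : Fin n ⊕ Fin f → (ℝ × BdModel n f) × ℝ → CylMatrix n f) (z : (ℝ × BdModel n f) × ℝ)
    (μ ν : Fin n ⊕ Fin f) : CylMatrix n f :=
  (Matrix.of fun α β =>
    fderivWithin ℝ (fun y => Γ ν y α β) (pathSlab U) z ((0, unitVec μ), 0) -
      fderivWithin ℝ (fun y => Γ μ y α β) (pathSlab U) z ((0, unitVec ν), 0)) +
    (Γ μ z * Γ ν z - Γ ν z * Γ μ z)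

theorem fderivWithin_pathSlab_tan (hU : IsOpen U) {F : (ℝ × BdModel n f) × ℝ → ℝ} {ε : ℝ}
    (hε : ε ∈ Ico (0 : ℝ) 1) {u : BdModel n f} (hu : u ∈ U) {t : ℝ}
    (hF : DifferentiableWithinAt ℝ F (pathSlab U) ((ε, u), t)) (v : BdModel n f) :
    HasFDerivAt (fun w => F ((ε, w), t)) (fderiv ℝ (fun w => F ((ε, w), t)) u) u ∧
    fderivWithin ℝ F (pathSlab U) ((ε, u), t) ((0, v), 0) =
      fderiv ℝ (fun w => F ((ε, w), t)) u v := by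
  have hφ : HasFDerivAt (fun w : BdModel n f => ((ε, w), t))
      ((ContinuousLinearMap.inl ℝ (ℝ × BdModel n f) ℝ).comp
        (ContinuousLinearMap.inr ℝ ℝ (BdModel n f))) u :=
    HasFDerivAt.comp (g := fun p : ℝ × BdModel n f => (p, t)) u
      (hasFDerivAt_prodMk_left (ε, u) t) (hasFDerivAt_prodMk_right ε u)
  have h := hasFDerivAt_comp_of_mapsTo (φ := fun w : BdModel n f => ((ε, w), t)) hF hφ
    (hU.mem_nhds hu) fun w hw => ⟨⟨hε, hw⟩, mem_univ _⟩
  refine ⟨h.differentiableAt.hasFDerivAt, ?_⟩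
  rw [h.fderiv]
  simp

theorem fderivWithin_pathSlab_path {F : (ℝ × BdModel n f) × ℝ → ℝ} {ε : ℝ}
    (hε : ε ∈ Ico (0 : ℝ) 1) {u : BdModel n f} (hu : u ∈ U) {t : ℝ}
    (hF : DifferentiableWithinAt ℝ F (pathSlab U) ((ε, u), t)) :
    fderivWithin ℝ F (pathSlab U) ((ε, u), t) (0, 1) = deriv (fun s => F ((ε, u), s)) t := by
  have h := hasFDerivAt_comp_of_mapsTo hF (hasFDerivAt_prodMk_right (𝕜 := ℝ) (ε, u) t) univ_mem
    fun w _ => (⟨⟨hε, hu⟩, mem_univ _⟩ : _ ∈ pathSlab U)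
  rw [← fderiv_apply_one_eq_deriv, h.fderiv]
  simp

/-- On two tangential vectors the curvature involves only tangential derivatives, and a conjugation
constant on the slice passes through it. Differentiability of Γ on the cylinder is what identifies
its partial derivatives with those of the restriction to the slice. -/
theorem curvature_eq_slabCurvature (hU : IsOpen U) {ε : ℝ} (hε : ε ∈ Ioo (0 : ℝ) 1)
    {u : BdModel n f} (hu : u ∈ U) {t : ℝ} {Γ : ConnForm (Fin n ⊕ Fin f)}
    {Γs : Fin n ⊕ Fin f → (ℝ × BdModel n f) × ℝ → CylMatrix n f}
    (hΓ : ∀ μ α β, DifferentiableAt ℝ (fun q => Γ q (some μ) α β) (ε, u))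
    (hs : ∀ μ α β, DifferentiableWithinAt ℝ (fun z => Γs μ z α β) (pathSlab U) ((ε, u), t))
    (heq : ∀ w ∈ U, ∀ μ, Γ (ε, w) (some μ) = scale ε * Γs μ ((ε, w), t) * unscale ε)
    (μ ν : Fin n ⊕ Fin f) :
    curvature Γ (ε, u) (some μ) (some ν) =
      scale ε * slabCurvature U Γs ((ε, u), t) μ ν * unscale ε := by
  have hε' : ε ∈ Ico (0 : ℝ) 1 := ⟨hε.1.le, hε.2⟩
  have key : ∀ j μ α β, pd (some j) (fun q => Γ q (some μ) α β) (ε, u) =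
      ε ^ wt α * fderivWithin ℝ (fun y => Γs μ y α β) (pathSlab U) ((ε, u), t)
        ((0, unitVec j), 0) * (ε ^ wt β)⁻¹ := by
    intro j μ α β
    obtain ⟨h1, h2⟩ := fderivWithin_pathSlab_tan hU hε' hu (hs μ α β) (unitVec j)
    rw [h2, pd, coordVec, fderiv_slice (hΓ μ α β)]
    have : (fun w => Γ (ε, w) (some μ) α β) =ᶠ[𝓝 u]
        fun w => ε ^ wt α * Γs μ ((ε, w), t) α β * (ε ^ wt β)⁻¹ := by
      filter_upwards [hU.mem_nhds hu] with w hw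
      rw [heq w hw, scale, unscale, Matrix.mul_diagonal, Matrix.diagonal_mul]
    rw [this.fderiv_eq, ((h1.const_mul _).mul_const _).fderiv]
    simp only [smul_apply, smul_eq_mul]
    ring
  have hc : ∀ X Y : CylMatrix n f, scale ε * X * unscale ε * (scale ε * Y * unscale ε) =
      scale ε * (X * Y) * unscale ε := by
    intro X Y
    rw [show scale ε * X * unscale ε * (scale ε * Y * unscale ε) =
      scale ε * X * (unscale ε * scale ε) * Y * unscale ε by simp only [Matrix.mul_assoc],
      unscale_mul_scale hε.1.ne', mul_one, Matrix.mul_assoc (scale ε) X Y]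
  rw [curvature, slabCurvature, heq u hu, heq u hu, hc, hc, mul_add, add_mul, mul_sub, sub_mul]
  congr 1
  ext α β
  rw [Matrix.of_apply, key, key, scale, unscale, Matrix.mul_diagonal, Matrix.diagonal_mul,
    Matrix.of_apply]
  ring

end Bridge

/-! ### Rescaled paths of connections -/

section Paths

variable {n f : ℕ} {U : Set (BdModel n f)} {H₀ : BdModel n f → CylMatrix n f} {J J₀ J₁ : Jet n f}
  {G G₀ G₁ : ℝ → ℝ × BdModel n f → CylMatrix n f} {c c₀ c₁ : CylMatrix n f}

theorem tanDeriv_mix (hU : IsOpen U) (v : BdModel n f) {F₀ F₁ : ℝ × BdModel n f → ℝ}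
    (h₀ : ContDiffOn ℝ ∞ F₀ (slab U)) (h₁ : ContDiffOn ℝ ∞ F₁ (slab U)) (t : ℝ)
    {q : ℝ × BdModel n f} (hq : q ∈ slab U) :
    tanDeriv U v (fun r => (1 - t) * F₀ r + t * F₁ r) q =
      (1 - t) * tanDeriv U v F₀ q + t * tanDeriv U v F₁ q := by
  have d₀ := (differentiableWithinAt_slab h₀ hq).hasFDerivWithinAt
  have d₁ := (differentiableWithinAt_slab h₁ hq).hasFDerivWithinAt
  rw [tanDeriv, ((d₀.const_mul (1 - t)).fun_add (d₁.const_mul t)).fderivWithin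
    (uniqueDiffOn_slab hU q hq)]
  simp [tanDeriv]

theorem Jet.lower_mix (hU : IsOpen U) (h₀ : J₀.IsRegular U H₀ c₀) (h₁ : J₁.IsRegular U H₀ c₁)
    (t : ℝ) {q : ℝ × BdModel n f} (hq : q ∈ slab U) (α β : Option (Fin n ⊕ Fin f))
    (μ : Fin n ⊕ Fin f) : (J₀.mix J₁ t).lower U α β μ q =
      (1 - t) * J₀.lower U α β μ q + t * J₁.lower U α β μ q := by
  rcases α with _ | b | j <;> rcases μ with a | i <;>
    simp only [Jet.lower, Jet.mix, Matrix.add_apply, Matrix.smul_apply, smul_eq_mul]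
  · ring
  · exact tanDeriv_mix hU _ (h₀.smoothH _ _) (h₁.smoothH _ _) t hq
  · rw [tanDeriv_mix hU _ (h₀.smoothH _ _) (h₁.smoothH _ _) t hq]; ring
  · exact tanDeriv_mix hU _ (h₀.smoothm _ _) (h₁.smoothm _ _) t hq
  · exact tanDeriv_mix hU _ (h₀.smoothH _ _) (h₁.smoothH _ _) t hq

theorem Jet.christoffel_mix (hU : IsOpen U) (h₀ : J₀.IsRegular U H₀ c₀)
    (h₁ : J₁.IsRegular U H₀ c₁) (t : ℝ) {q : ℝ × BdModel n f} (hq : q ∈ slab U)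
    (μ : Fin n ⊕ Fin f) : (J₀.mix J₁ t).christoffel U μ q =
      (1 - t) • J₀.christoffel U μ q + t • J₁.christoffel U μ q := by
  ext α β
  have : tanDeriv U (unitVec μ) (fun r => (J₀.mix J₁ t).H r α β) q = _ :=
    tanDeriv_mix hU (unitVec μ) (h₀.smoothH α β) (h₁.smoothH α β) t hq
  simp only [Jet.christoffel, Matrix.of_apply, Matrix.add_apply, Matrix.smul_apply, smul_eq_mul,
    Jet.lower_mix hU h₀ h₁ t hq, this]
  ring

/-- The rescaled Levi-Civita connections of the path of metrics. -/
def metricGamma (U : Set (BdModel n f)) (J₀ J₁ : Jet n f) (μ : Fin n ⊕ Fin f)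
    (z : (ℝ × BdModel n f) × ℝ) : CylMatrix n f :=
  ((J₀.mix J₁ z.2).H z.1)⁻¹ *
    ((1 - z.2) • J₀.christoffel U μ z.1 + z.2 • J₁.christoffel U μ z.1)

/-- The rescaled Levi-Civita connection. -/
def Jet.gamma (U : Set (BdModel n f)) (J : Jet n f) (μ : Fin n ⊕ Fin f)
    (q : ℝ × BdModel n f) : CylMatrix n f :=
  (J.H q)⁻¹ * J.christoffel U μ q

/-- The rescaled affine path of connections. -/
def affineGamma (U : Set (BdModel n f)) (J₀ J₁ : Jet n f) (μ : Fin n ⊕ Fin f)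
    (z : (ℝ × BdModel n f) × ℝ) : CylMatrix n f :=
  J₀.gamma U μ z.1 + z.2 • (J₁.gamma U μ z.1 - J₀.gamma U μ z.1)

theorem contDiffWithinAt_pathSlab {F : ℝ × BdModel n f → ℝ} {z : (ℝ × BdModel n f) × ℝ}
    (hF : ContDiffWithinAt ℝ ∞ F (slab U) z.1) :
    ContDiffWithinAt ℝ ∞ (fun y : (ℝ × BdModel n f) × ℝ => F y.1) (pathSlab U) z :=
  hF.comp z contDiffWithinAt_fst fun _ hy => hy.1

theorem contDiffWithinAt_mixH (h₀ : J₀.IsRegular U H₀ c₀) (h₁ : J₁.IsRegular U H₀ c₁)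
    {z : (ℝ × BdModel n f) × ℝ} (hz : z ∈ pathSlab U) (α β : Option (Fin n ⊕ Fin f)) :
    ContDiffWithinAt ℝ ∞ (fun y : (ℝ × BdModel n f) × ℝ => (J₀.mix J₁ y.2).H y.1 α β)
      (pathSlab U) z :=
  ((contDiffWithinAt_const.sub contDiffWithinAt_snd).mul
    (contDiffWithinAt_pathSlab (h₀.smoothH α β z.1 hz.1))).add
    (contDiffWithinAt_snd.mul (contDiffWithinAt_pathSlab (h₁.smoothH α β z.1 hz.1)))

theorem contDiffWithinAt_metricGamma (hU : IsOpen U) (h₀ : J₀.IsRegular U H₀ c₀)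
    (h₁ : J₁.IsRegular U H₀ c₁) {z : (ℝ × BdModel n f) × ℝ} (hz : z ∈ pathSlab U)
    (hd : ((J₀.mix J₁ z.2).H z.1).det ≠ 0) (μ : Fin n ⊕ Fin f) (α β : Option (Fin n ⊕ Fin f)) :
    ContDiffWithinAt ℝ ∞ (fun y => metricGamma U J₀ J₁ μ y α β) (pathSlab U) z :=
  contDiffWithinAt_mul (contDiffWithinAt_inv (contDiffWithinAt_mixH h₀ h₁ hz) hd)
    (fun γ δ => ((contDiffWithinAt_const.sub contDiffWithinAt_snd).mul
      (contDiffWithinAt_pathSlab (h₀.contDiffOn_christoffel hU μ γ δ z.1 hz.1))).add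
      (contDiffWithinAt_snd.mul
        (contDiffWithinAt_pathSlab (h₁.contDiffOn_christoffel hU μ γ δ z.1 hz.1)))) α β

theorem Jet.IsRegular.contDiffWithinAt_gamma (hU : IsOpen U) (h : J.IsRegular U H₀ c)
    {q : ℝ × BdModel n f} (hq : q ∈ slab U) (hd : (J.H q).det ≠ 0) (μ : Fin n ⊕ Fin f)
    (α β : Option (Fin n ⊕ Fin f)) :
    ContDiffWithinAt ℝ ∞ (fun y => J.gamma U μ y α β) (slab U) q :=
  contDiffWithinAt_mul (contDiffWithinAt_inv (fun γ δ => h.smoothH γ δ q hq) hd)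
    (fun γ δ => h.contDiffOn_christoffel hU μ γ δ q hq) α β

theorem contDiffWithinAt_affineGamma (hU : IsOpen U) (h₀ : J₀.IsRegular U H₀ c₀)
    (h₁ : J₁.IsRegular U H₀ c₁) {z : (ℝ × BdModel n f) × ℝ} (hz : z ∈ pathSlab U)
    (hd₀ : (J₀.H z.1).det ≠ 0) (hd₁ : (J₁.H z.1).det ≠ 0) (μ : Fin n ⊕ Fin f)
    (α β : Option (Fin n ⊕ Fin f)) :
    ContDiffWithinAt ℝ ∞ (fun y => affineGamma U J₀ J₁ μ y α β) (pathSlab U) z := by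
  have g₀ := contDiffWithinAt_pathSlab (z := z) (h₀.contDiffWithinAt_gamma hU hz.1 hd₀ μ α β)
  have g₁ := contDiffWithinAt_pathSlab (z := z) (h₁.contDiffWithinAt_gamma hU hz.1 hd₁ μ α β)
  exact g₀.add (contDiffWithinAt_snd.mul (g₁.sub g₀))

theorem contDiffWithinAt_fderivWithin_apply (hU : IsOpen U) {F : (ℝ × BdModel n f) × ℝ → ℝ}
    {z : (ℝ × BdModel n f) × ℝ} (hz : z ∈ pathSlab U)
    (hF : ContDiffWithinAt ℝ ∞ F (pathSlab U) z) (v : (ℝ × BdModel n f) × ℝ) :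
    ContDiffWithinAt ℝ ∞ (fun y => fderivWithin ℝ F (pathSlab U) y v) (pathSlab U) z :=
  (hF.fderivWithin_right (m := ∞) (uniqueDiffOn_pathSlab hU) (by simp) hz).clm_apply
    contDiffWithinAt_const

theorem contDiffWithinAt_slabCurvature (hU : IsOpen U)
    {Γ : Fin n ⊕ Fin f → (ℝ × BdModel n f) × ℝ → CylMatrix n f} {z : (ℝ × BdModel n f) × ℝ}
    (hz : z ∈ pathSlab U)
    (hΓ : ∀ μ α β, ContDiffWithinAt ℝ ∞ (fun y => Γ μ y α β) (pathSlab U) z)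
    (μ ν : Fin n ⊕ Fin f) (α β : Option (Fin n ⊕ Fin f)) :
    ContDiffWithinAt ℝ ∞ (fun y => slabCurvature U Γ y μ ν α β) (pathSlab U) z :=
  ((contDiffWithinAt_fderivWithin_apply hU hz (hΓ ν α β) _).sub
    (contDiffWithinAt_fderivWithin_apply hU hz (hΓ μ α β) _)).add
    ((contDiffWithinAt_mul (hΓ μ) (hΓ ν) α β).sub (contDiffWithinAt_mul (hΓ ν) (hΓ μ) α β))

theorem mix_H_zero (h₀ : J₀.IsRegular U H₀ c₀) (h₁ : J₁.IsRegular U H₀ c₁) (t : ℝ)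
    {u : BdModel n f} (hu : u ∈ U) : (J₀.mix J₁ t).H (0, u) = H₀ u :=
  (h₀.mix h₁ t).H_zero u hu

theorem zero_mem_pathSlab {u : BdModel n f} (hu : u ∈ U) (t : ℝ) :
    (((0 : ℝ), u), t) ∈ pathSlab U := ⟨⟨by simp, hu⟩, mem_univ _⟩

theorem gamma_zero_block (h : J.IsRegular U H₀ c) (hB : IsBlockMetric U H₀) (hU : IsOpen U)
    {u : BdModel n f} (hu : u ∈ U) (μ : Fin n ⊕ Fin f) :
    J.gamma U μ (0, u) ∈ blockDiag isVert := by
  rw [Jet.gamma, h.H_zero u hu]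
  exact mul_mem_blockDiag (inv_mem_blockDiag (hB.block u hu)) (h.christoffel_zero_block hB hU hu μ)

theorem metricGamma_eq_gamma (h₀ : J₀.IsRegular U H₀ c₀) (h₁ : J₁.IsRegular U H₀ c₁)
    (hU : IsOpen U) {z : (ℝ × BdModel n f) × ℝ} (hz : z ∈ pathSlab U) (μ : Fin n ⊕ Fin f) :
    metricGamma U J₀ J₁ μ z = (J₀.mix J₁ z.2).gamma U μ z.1 := by
  rw [metricGamma, Jet.gamma, Jet.christoffel_mix hU h₀ h₁ _ hz.1]

/-- At ε = 0 both metrics are inverted by the same H₀⁻¹, so interpolating connections and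
interpolating metrics give the same form. Results on a single jet thereby apply to the affine path.
-/
theorem affineGamma_zero_eq_gamma (h₀ : J₀.IsRegular U H₀ c₀) (h₁ : J₁.IsRegular U H₀ c₁)
    (hU : IsOpen U) {u : BdModel n f} (hu : u ∈ U) (t : ℝ) (μ : Fin n ⊕ Fin f) :
    affineGamma U J₀ J₁ μ ((0, u), t) = (J₀.mix J₁ t).gamma U μ (0, u) := by
  rw [affineGamma, Jet.gamma, Jet.gamma, Jet.gamma, mix_H_zero h₀ h₁ t hu, h₀.H_zero u hu,
    h₁.H_zero u hu, Jet.christoffel_mix hU h₀ h₁ _ ⟨by simp, hu⟩, mul_add, Matrix.mul_smul,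
    Matrix.mul_smul, sub_smul, one_smul, smul_sub]
  abel

/-- Block diagonal matrices form an algebra, and an entry that vanishes on the whole slice ε = 0 has
zero tangential derivatives there. -/
theorem slabCurvature_zero_block (hU : IsOpen U)
    {Γ : Fin n ⊕ Fin f → (ℝ × BdModel n f) × ℝ → CylMatrix n f} {u : BdModel n f} (hu : u ∈ U)
    (t : ℝ) (hΓ : ∀ μ α β, ContDiffWithinAt ℝ ∞ (fun y => Γ μ y α β) (pathSlab U) ((0, u), t))
    (hb : ∀ μ, ∀ w ∈ U, Γ μ ((0, w), t) ∈ blockDiag isVert) (μ ν : Fin n ⊕ Fin f) :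
    slabCurvature U Γ ((0, u), t) μ ν ∈ blockDiag isVert := by
  have h0 : (0 : ℝ) ∈ Ico (0 : ℝ) 1 := by simp
  have key : ∀ μ α β, isVert α ≠ isVert β → ∀ v : BdModel n f,
      fderivWithin ℝ (fun y => Γ μ y α β) (pathSlab U) ((0, u), t) ((0, v), 0) = 0 := by
    intro μ α β hαβ v
    rw [(fderivWithin_pathSlab_tan hU h0 hu ((hΓ μ α β).differentiableWithinAt (by simp)) v).2]
    have : (fun w => Γ μ ((0, w), t) α β) =ᶠ[𝓝 u] fun _ => 0 := by
      filter_upwards [hU.mem_nhds hu] with w hw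
      exact hb μ w hw α β hαβ
    rw [this.fderiv_eq]
    simp
  refine (blockDiag isVert).add_mem ?_ (sub_mem_blockDiag (mul_mem_blockDiag (hb μ u hu)
    (hb ν u hu)) (mul_mem_blockDiag (hb ν u hu) (hb μ u hu)))
  intro α β hαβ
  rw [Matrix.of_apply, key _ _ _ hαβ, key _ _ _ hαβ, sub_zero]

theorem slabCurvature_swap (Γ : Fin n ⊕ Fin f → (ℝ × BdModel n f) × ℝ → CylMatrix n f)
    (z : (ℝ × BdModel n f) × ℝ) (μ ν : Fin n ⊕ Fin f) :
    slabCurvature U Γ z ν μ = -slabCurvature U Γ z μ ν := by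
  ext α β
  simp only [slabCurvature, Matrix.add_apply, Matrix.sub_apply, Matrix.neg_apply, Matrix.of_apply]
  ring

theorem slabCurvature_self (Γ : Fin n ⊕ Fin f → (ℝ × BdModel n f) × ℝ → CylMatrix n f)
    (z : (ℝ × BdModel n f) × ℝ) (μ : Fin n ⊕ Fin f) :
    slabCurvature U Γ z μ μ = 0 := by
  ext α β
  simp [slabCurvature]

end Paths

/-! ### The limiting connection and curvature for one-dimensional fibres. -/

section OneDimensionalFibres

variable {n f : ℕ} {U : Set (BdModel n f)} {H₀ : BdModel n f → CylMatrix n f} {J J₀ J₁ : Jet n f}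
  {c c₀ c₁ : CylMatrix n f}

theorem sum_eq_of_vert (hf : Subsingleton (Fin f)) (i : Fin f)
    (g : Option (Fin n ⊕ Fin f) → ℝ) (hg : ∀ γ, isVert γ = false → g γ = 0) :
    ∑ γ, g γ = g (some (Sum.inr i)) := by
  refine Finset.sum_eq_single _ (fun γ _ hγ => hg γ ?_) (fun h => absurd (Finset.mem_univ _) h)
  rcases γ with _ | b | j
  · rfl
  · rfl
  · exact absurd (by rw [Subsingleton.elim i j]) hγ

theorem eq_of_isVert (hf : Subsingleton (Fin f)) (i : Fin f) {α : Option (Fin n ⊕ Fin f)}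
    (hα : isVert α = true) : α = some (Sum.inr i) := by
  rcases α with _ | b | j
  · cases hα
  · cases hα
  · rw [Subsingleton.elim i j]

/-- In the fibre direction mixed and horizontal entries vanish in the limit, and the single vertical
entry is half the fibre derivative of an entry of H₀. Nothing depends on the jet beyond H₀. -/
theorem gamma_zero_vert_eq (hf : Subsingleton (Fin f)) (h₀ : J₀.IsRegular U H₀ c₀)
    (h₁ : J₁.IsRegular U H₀ c₁) (hB : IsBlockMetric U H₀) (hU : IsOpen U) {u : BdModel n f}
    (hu : u ∈ U) (i : Fin f) :
    J₁.gamma U (Sum.inr i) (0, u) = J₀.gamma U (Sum.inr i) (0, u) := by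
  have : J₁.christoffel U (Sum.inr i) (0, u) = J₀.christoffel U (Sum.inr i) (0, u) := by
    ext α β
    by_cases hαβ : isVert α = isVert β
    · cases hα : isVert α
      · rw [h₀.christoffel_zero_vert hB hU hu i hα (hαβ ▸ hα),
          h₁.christoffel_zero_vert hB hU hu i hα (hαβ ▸ hα)]
      · rw [eq_of_isVert hf i hα, eq_of_isVert hf i (hαβ ▸ hα : isVert β = true),
          h₀.christoffel_zero_diag hU hu, h₁.christoffel_zero_diag hU hu]
    · rw [h₀.christoffel_zero_block hB hU hu _ α β hαβ, h₁.christoffel_zero_block hB hU hu _ α β hαβ]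
  rw [Jet.gamma, Jet.gamma, h₀.H_zero u hu, h₁.H_zero u hu, this]

theorem gamma_zero_vert_horizontal (h : J.IsRegular U H₀ c) (hB : IsBlockMetric U H₀)
    (hU : IsOpen U) {u : BdModel n f} (hu : u ∈ U) (i : Fin f) {α β : Option (Fin n ⊕ Fin f)}
    (hα : isVert α = false) (hβ : isVert β = false) :
    J.gamma U (Sum.inr i) (0, u) α β = 0 := by
  rw [Jet.gamma, h.H_zero u hu, Matrix.mul_apply]
  refine Finset.sum_eq_zero fun γ _ => ?_
  cases hγ : isVert γ
  · rw [h.christoffel_zero_vert hB hU hu i hγ hβ, mul_zero]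
  · rw [inv_mem_blockDiag (hB.block u hu) α γ (by rw [hα, hγ]; simp), zero_mul]

/-- For a one-dimensional fibre the vertical block is a scalar, so inverting H₀ there is division
and the connection form is ½ d log τ, with τ the vertical entry of H₀. -/
theorem gamma_zero_vert_vert (hf : Subsingleton (Fin f)) (h : J.IsRegular U H₀ c)
    (hB : IsBlockMetric U H₀) (hU : IsOpen U) {u : BdModel n f} (hu : u ∈ U) (i : Fin f)
    (μ : Fin n ⊕ Fin f) :
    H₀ u (some (Sum.inr i)) (some (Sum.inr i)) ≠ 0 ∧
    J.gamma U μ (0, u) (some (Sum.inr i)) (some (Sum.inr i)) =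
      (H₀ u (some (Sum.inr i)) (some (Sum.inr i)))⁻¹ *
        (fderiv ℝ (fun w => H₀ w (some (Sum.inr i)) (some (Sum.inr i))) u (unitVec μ) * 2⁻¹) := by
  have hv : ∀ γ : Option (Fin n ⊕ Fin f), isVert γ = false →
      isVert (some (Sum.inr i) : Option (Fin n ⊕ Fin f)) ≠ isVert γ := by
    intro γ hγ; rw [hγ]; simp [isVert]
  have h1 : (H₀ u * (H₀ u)⁻¹) (some (Sum.inr i)) (some (Sum.inr i)) = 1 := by
    rw [Matrix.mul_nonsing_inv _ (hB.det_pos u hu).ne'.isUnit, Matrix.one_apply_eq]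
  rw [Matrix.mul_apply, sum_eq_of_vert hf i _ fun γ hγ => by
    rw [hB.block u hu _ _ (hv γ hγ), zero_mul]] at h1
  refine ⟨left_ne_zero_of_mul_eq_one h1, ?_⟩
  rw [Jet.gamma, h.H_zero u hu, Matrix.mul_apply, sum_eq_of_vert hf i _ fun γ hγ => by
    rw [inv_mem_blockDiag (hB.block u hu) _ _ (hv γ hγ), zero_mul],
    h.christoffel_zero_diag hU hu, eq_inv_of_mul_eq_one_right h1, div_eq_mul_inv]

theorem fderiv_gamma_zero_horizontal (h : J.IsRegular U H₀ c) (hB : IsBlockMetric U H₀)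
    (hU : IsOpen U) {u : BdModel n f} (hu : u ∈ U) (a : Fin n) (i : Fin f)
    {α β : Option (Fin n ⊕ Fin f)} (hα : isVert α = false) (hβ : isVert β = false) :
    fderiv ℝ (fun w => J.gamma U (Sum.inl a) (0, w) α β) u (unitVec (Sum.inr i)) = 0 := by
  have hd : (J.H (0, u)).det ≠ 0 := by rw [h.H_zero u hu]; exact (hB.det_pos u hu).ne'
  have hg : ∀ γ δ, DifferentiableAt ℝ (fun w => J.gamma U (Sum.inl a) (0, w) γ δ) u := by
    intro γ δ
    have h1 := (h.contDiffWithinAt_gamma hU (q := (0, u)) ⟨by simp, hu⟩ hd (Sum.inl a) γ δ)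
    exact (hasFDerivAt_comp_of_mapsTo (h1.differentiableWithinAt (by simp))
      (hasFDerivAt_slice 0 u) (hU.mem_nhds hu) fun w hw => ⟨by simp, hw⟩).differentiableAt
  have hH : ∀ γ δ, DifferentiableAt ℝ (fun w => H₀ w γ δ) u := fun γ δ =>
    (hB.contDiffAt hU hu γ δ).differentiableAt (by simp)
  -- Y is the horizontal block of the fibre derivative of Γ_a, extended by zero. Differentiating H₀
  -- Γ_a = C_a along the fibre, with C_a the Christoffel matrix, gives H₀ Y = 0; the extension makes
  -- this an identity of full matrices, so H₀ can be cancelled.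
  set Y : CylMatrix n f := Matrix.of fun γ δ => if (isVert γ || isVert δ) = true then 0 else
    fderiv ℝ (fun w => J.gamma U (Sum.inl a) (0, w) γ δ) u (unitVec (Sum.inr i)) with hY
  have hzero : H₀ u * Y = 0 := by
    ext γ δ
    rw [Matrix.mul_apply, Matrix.zero_apply]
    cases hδ : isVert δ
    · cases hγ : isVert γ
      · have hC : (fun w => J.christoffel U (Sum.inl a) (0, w) γ δ) =ᶠ[𝓝 u]
            fun w => ∑ ν, H₀ w γ ν * J.gamma U (Sum.inl a) (0, w) ν δ := by
          filter_upwards [hU.mem_nhds hu] with w hw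
          rw [← Matrix.mul_apply, Jet.gamma, h.H_zero w hw, ← Matrix.mul_assoc,
            Matrix.mul_nonsing_inv _ (hB.det_pos w hw).ne'.isUnit, one_mul]
        have h0 := h.fderiv_christoffel_zero hB hU hu a i hγ hδ
        rw [hC.fderiv_eq, fderiv_fun_sum fun ν _ => (hH γ ν).fun_mul (hg ν δ),
          sum_apply] at h0
        rw [← h0]
        refine Finset.sum_congr rfl fun ν _ => ?_
        rw [fderiv_fun_mul (hH γ ν) (hg ν δ), add_apply, smul_apply, smul_apply, smul_eq_mul,
          smul_eq_mul]
        cases hν : isVert ν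
        · rw [hB.indep u hu γ ν hγ hν]; simp [hY, hν, hδ]
        · rw [hB.block u hu γ ν (by simp [hγ, hν]), gamma_zero_block h hB hU hu _ ν δ
            (by simp [hν, hδ])]
          simp
      · refine Finset.sum_eq_zero fun ν _ => ?_
        cases hν : isVert ν
        · rw [hB.block u hu γ ν (by simp [hγ, hν]), zero_mul]
        · simp [hY, hν]
    · exact Finset.sum_eq_zero fun ν _ => by simp [hY, hδ]
  have hY0 : Y = 0 := by
    have := congrArg ((H₀ u)⁻¹ * ·) hzero
    simpa [← Matrix.mul_assoc, Matrix.nonsing_inv_mul _ (hB.det_pos u hu).ne'.isUnit] using this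
  have := congrFun (congrFun hY0 α) β
  simpa [hY, hα, hβ] using this

/-- The form ½ d log τ is closed: the explicit formula for its derivative is symmetric in μ and ν,
by symmetry of the second derivatives of τ. -/
theorem fderiv_gamma_zero_vert (hf : Subsingleton (Fin f)) (h : J.IsRegular U H₀ c)
    (hB : IsBlockMetric U H₀) (hU : IsOpen U) {u : BdModel n f} (hu : u ∈ U) (i : Fin f)
    (μ ν : Fin n ⊕ Fin f) :
    fderiv ℝ (fun w => J.gamma U μ (0, w) (some (Sum.inr i)) (some (Sum.inr i))) u (unitVec ν) =
    fderiv ℝ (fun w => J.gamma U ν (0, w) (some (Sum.inr i)) (some (Sum.inr i))) u (unitVec μ) := by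
  set τ : BdModel n f → ℝ := fun w => H₀ w (some (Sum.inr i)) (some (Sum.inr i)) with hτ
  have hc : ContDiffAt ℝ ∞ τ u := hB.contDiffAt hU hu _ _
  have hd : DifferentiableAt ℝ τ u := hc.differentiableAt (by simp)
  have hne : τ u ≠ 0 := (gamma_zero_vert_vert hf h hB hU hu i μ).1
  have key : ∀ μ ν : Fin n ⊕ Fin f,
      fderiv ℝ (fun w => J.gamma U μ (0, w) (some (Sum.inr i)) (some (Sum.inr i))) u (unitVec ν) =
        (τ u)⁻¹ * (fderiv ℝ (fun w => fderiv ℝ τ w (unitVec μ)) u (unitVec ν) * 2⁻¹) -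
          fderiv ℝ τ u (unitVec μ) * fderiv ℝ τ u (unitVec ν) * (2⁻¹ * (τ u ^ 2)⁻¹) := by
    intro μ ν
    have he : (fun w => J.gamma U μ (0, w) (some (Sum.inr i)) (some (Sum.inr i))) =ᶠ[𝓝 u]
        fun w => (τ w)⁻¹ * (fderiv ℝ τ w (unitVec μ) * 2⁻¹) := by
      filter_upwards [hU.mem_nhds hu] with w hw
      exact (gamma_zero_vert_vert hf h hB hU hw i μ).2
    have hdd : DifferentiableAt ℝ (fun w => fderiv ℝ τ w (unitVec μ)) u :=
      ((hc.fderiv_right (m := ∞) (by simp)).clm_apply contDiffAt_const).differentiableAt (by simp)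
    have hinv : HasFDerivAt (fun w => (τ w)⁻¹) (-(τ u ^ 2)⁻¹ • fderiv ℝ τ u) u :=
      (hasDerivAt_inv hne).comp_hasFDerivAt u hd.hasFDerivAt
    rw [he.fderiv_eq, (hinv.fun_mul (hdd.hasFDerivAt.mul_const _)).fderiv]
    simp only [add_apply, smul_apply, smul_eq_mul]
    ring
  rw [key, key, fderiv_fderiv_comm hc]
  ring

/-- Horizontally, Γ_i is zero and Γ_a does not vary along the fibre, so no term survives. Vertically
the block is scalar, the commutator drops out, and closedness of ½ d log τ gives zero. -/
theorem slabCurvature_zero_vert (hf : Subsingleton (Fin f)) (h : J.IsRegular U H₀ c)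
    (hB : IsBlockMetric U H₀) (hU : IsOpen U)
    {Γ : Fin n ⊕ Fin f → (ℝ × BdModel n f) × ℝ → CylMatrix n f} {u : BdModel n f} (hu : u ∈ U)
    (t : ℝ) (hΓ : ∀ μ α β, ContDiffWithinAt ℝ ∞ (fun y => Γ μ y α β) (pathSlab U) ((0, u), t))
    (hg : ∀ μ, ∀ w ∈ U, Γ μ ((0, w), t) = J.gamma U μ (0, w)) (a : Fin n) (i : Fin f) :
    slabCurvature U Γ ((0, u), t) (Sum.inl a) (Sum.inr i) = 0 := by
  have h0 : (0 : ℝ) ∈ Ico (0 : ℝ) 1 := by simp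
  have hb : ∀ μ, ∀ w ∈ U, Γ μ ((0, w), t) ∈ blockDiag isVert := fun μ w hw => by
    rw [hg μ w hw]; exact gamma_zero_block h hB hU hw μ
  have key : ∀ μ α β, ∀ v : BdModel n f,
      fderivWithin ℝ (fun y => Γ μ y α β) (pathSlab U) ((0, u), t) ((0, v), 0) =
        fderiv ℝ (fun w => J.gamma U μ (0, w) α β) u v := by
    intro μ α β v
    rw [(fderivWithin_pathSlab_tan hU h0 hu ((hΓ μ α β).differentiableWithinAt (by simp)) v).2]
    congr 1
    refine Filter.EventuallyEq.fderiv_eq ?_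
    filter_upwards [hU.mem_nhds hu] with w hw
    rw [hg μ w hw]
  ext α β
  rw [Matrix.zero_apply]
  by_cases hαβ : isVert α = isVert β
  swap
  · exact slabCurvature_zero_block hU hu t hΓ hb _ _ α β hαβ
  rw [slabCurvature, Matrix.add_apply, Matrix.of_apply, key, key, Matrix.sub_apply,
    Matrix.mul_apply, Matrix.mul_apply]
  cases hα : isVert α
  · have hβ : isVert β = false := hαβ ▸ hα
    have e1 : fderiv ℝ (fun w => J.gamma U (Sum.inr i) (0, w) α β) u (unitVec (Sum.inl a)) = 0 := by
      have : (fun w => J.gamma U (Sum.inr i) (0, w) α β) =ᶠ[𝓝 u] fun _ => 0 := by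
        filter_upwards [hU.mem_nhds hu] with w hw
        exact gamma_zero_vert_horizontal h hB hU hw i hα hβ
      rw [this.fderiv_eq]
      simp
    rw [e1, fderiv_gamma_zero_horizontal h hB hU hu a i hα hβ, Finset.sum_eq_zero,
      Finset.sum_eq_zero]
    · simp
    · intro γ _
      cases hγ : isVert γ
      · rw [hg _ u hu, gamma_zero_vert_horizontal h hB hU hu i hα hγ, zero_mul]
      · rw [hb (Sum.inr i) u hu α γ (by simp [hα, hγ]), zero_mul]
    · intro γ _
      cases hγ : isVert γ
      · rw [hg (Sum.inr i) u hu, gamma_zero_vert_horizontal h hB hU hu i hγ hβ, mul_zero]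
      · rw [hb (Sum.inl a) u hu α γ (by simp [hα, hγ]), zero_mul]
  · have hβ : isVert β = true := hαβ ▸ hα
    obtain rfl := eq_of_isVert hf i hα
    obtain rfl := eq_of_isVert hf i hβ
    have hs : ∀ μ ν : Fin n ⊕ Fin f, ∑ γ, Γ μ ((0, u), t) (some (Sum.inr i)) γ *
        Γ ν ((0, u), t) γ (some (Sum.inr i)) =
        Γ μ ((0, u), t) (some (Sum.inr i)) (some (Sum.inr i)) *
        Γ ν ((0, u), t) (some (Sum.inr i)) (some (Sum.inr i)) := fun μ ν =>
      sum_eq_of_vert hf i _ fun γ hγ => by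
        rw [hb μ u hu _ γ (by rw [hα, hγ]; simp), zero_mul]
    rw [hs, hs, fderiv_gamma_zero_vert hf h hB hU hu i]
    ring

end OneDimensionalFibres

/-! ### Vanishing of the limits of the transgression forms -/

section Limits

variable {n f : ℕ} {U : Set (BdModel n f)} {H₀ : BdModel n f → CylMatrix n f} {J₀ J₁ : Jet n f}
  {G₀ G₁ : ℝ → ℝ × BdModel n f → CylMatrix n f} {c₀ c₁ : CylMatrix n f}

theorem continuousWithinAt_topForm {X ι κ : Type*} [TopologicalSpace X] [Fintype ι]
    [DecidableEq ι] {q : ℕ} (o : Fin (2 * q + 1) ≃ ι) {P : (Fin (q + 1) → Matrix κ κ ℝ) → ℝ}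
    (hP : Continuous P) {θ : X → ι → Matrix κ κ ℝ} {Ω : X → ι → ι → Matrix κ κ ℝ} {s : Set X} {x : X}
    (hθ : ∀ μ α β, ContinuousWithinAt (fun y => θ y μ α β) s x)
    (hΩ : ∀ μ ν α β, ContinuousWithinAt (fun y => Ω y μ ν α β) s x) :
    ContinuousWithinAt (fun y => topForm o P (θ y) (Ω y)) s x :=
  (continuous_topForm o hP).continuousAt.comp_continuousWithinAt (f := fun y => (θ y, Ω y))
    ((continuousWithinAt_pi.2 fun μ => continuousWithinAt_pi.2 fun α => continuousWithinAt_pi.2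
      fun β => hθ μ α β).prodMk (continuousWithinAt_pi.2 fun μ => continuousWithinAt_pi.2 fun ν =>
        continuousWithinAt_pi.2 fun α => continuousWithinAt_pi.2 fun β => hΩ μ ν α β))

theorem eventually_mem_interior (hU : IsOpen U) {u : BdModel n f} (hu : u ∈ U) (t : ℝ) :
    ∀ᶠ z : (ℝ × BdModel n f) × ℝ in 𝓝[{z | 0 < z.1.1}] (((0 : ℝ), u), t),
      z.1.1 ∈ Ioo (0 : ℝ) 1 ∧ z.1.2 ∈ U := by
  have h1 : ∀ᶠ z : (ℝ × BdModel n f) × ℝ in 𝓝 (((0 : ℝ), u), t), z.1.1 < 1 ∧ z.1.2 ∈ U :=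
    ((continuous_fst.comp continuous_fst).tendsto (((0 : ℝ), u), t)
      |>.eventually (gt_mem_nhds zero_lt_one)).and
      ((continuous_snd.comp continuous_fst).tendsto (((0 : ℝ), u), t)
      |>.eventually (hU.mem_nhds hu))
  filter_upwards [nhdsWithin_le_nhds h1, self_mem_nhdsWithin] with z hz hz0
  exact ⟨⟨hz0, hz.1⟩, hz.2⟩

/-- Near the limit point, positivity of ε already forces membership in the slab, so continuity on
the slab yields limits through ε > 0. -/
theorem nhdsWithin_pos_le (hU : IsOpen U) {u : BdModel n f} (hu : u ∈ U) (t : ℝ) :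
    𝓝[{z : (ℝ × BdModel n f) × ℝ | 0 < z.1.1}] (((0 : ℝ), u), t) ≤
      𝓝[pathSlab U] (((0 : ℝ), u), t) := by
  refine nhdsWithin_le_iff.2 ?_
  filter_upwards [eventually_mem_interior hU hu t] with z hz
  exact ⟨⟨⟨hz.1.1.le, hz.1.2⟩, hz.2⟩, mem_univ _⟩

theorem Jet.Represents.det_ne_zero (h : J₀.Represents U G₀) {ε : ℝ} (hε : ε ∈ Ioo (0 : ℝ) 1)
    {u : BdModel n f} (hu : u ∈ U) (hd : (J₀.H (ε, u)).det ≠ 0) : (G₀ ε (ε, u)).det ≠ 0 := by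
  intro h0
  refine hd ?_
  rw [h.H_eq hε hu, Matrix.det_mul, Matrix.det_mul, h0]
  ring

/-- The integrand of the transgression of the Euler form, at the parameter `t = z.2` and the point
`z.1.2` of the hypersurface `x = z.1.1`. -/
def eulerIntegrand {q : ℕ} (o : Fin (2 * q + 1) ≃ Fin n ⊕ Fin f)
    (e : Fin (2 * (q + 1)) ≃ Option (Fin n ⊕ Fin f))
    (G₀ G₁ : ℝ → ℝ × BdModel n f → CylMatrix n f) (z : (ℝ × BdModel n f) × ℝ) : ℝ :=
  (√(metricPath (G₀ z.1.1) (G₁ z.1.1) z.2 z.1).det)⁻¹ *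
      topForm o (polarize (pfaffian e))
        (fun μ => (2 * Real.pi)⁻¹ • (metricPath (G₀ z.1.1) (G₁ z.1.1) z.2 z.1 *
          Matrix.of fun α β => deriv
            (fun s => leviCivita (metricPath (G₀ z.1.1) (G₁ z.1.1) s) z.1 (some μ) α β) z.2))
        (fun μ ν => (2 * Real.pi)⁻¹ • (metricPath (G₀ z.1.1) (G₁ z.1.1) z.2 z.1 *
          curvature (leviCivita (metricPath (G₀ z.1.1) (G₁ z.1.1) z.2)) z.1 (some μ) (some ν)))

/-- The integrand of the transgression of the Euler form in rescaled frames. -/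
def rescaledEulerIntegrand {q : ℕ} (o : Fin (2 * q + 1) ≃ Fin n ⊕ Fin f)
    (e : Fin (2 * (q + 1)) ≃ Option (Fin n ⊕ Fin f)) (U : Set (BdModel n f)) (J₀ J₁ : Jet n f)
    (z : (ℝ × BdModel n f) × ℝ) : ℝ :=
  (√((J₀.mix J₁ z.2).H z.1).det)⁻¹ *
      topForm o (polarize (pfaffian e))
        (fun μ => (2 * Real.pi)⁻¹ • ((J₀.mix J₁ z.2).H z.1 * Matrix.of fun α β =>
          fderivWithin ℝ (fun y => metricGamma U J₀ J₁ μ y α β) (pathSlab U) z (0, 1)))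
        (fun μ ν => (2 * Real.pi)⁻¹ • ((J₀.mix J₁ z.2).H z.1 *
          slabCurvature U (metricGamma U J₀ J₁) z μ ν))

/-- With G = D H D and X = D⁻¹ X' D, where D denotes `unscale ε`, one has G X = D (H X') D. The
factor det D from the Pfaffian cancels against the one in √det G. -/
theorem eulerIntegrand_eq {q : ℕ} (o : Fin (2 * q + 1) ≃ Fin n ⊕ Fin f)
    (e : Fin (2 * (q + 1)) ≃ Option (Fin n ⊕ Fin f)) (hU : IsOpen U) (hB : IsBlockMetric U H₀)
    (h₀ : J₀.IsRegular U H₀ c₀) (h₁ : J₁.IsRegular U H₀ c₁) (r₀ : J₀.Represents U G₀)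
    (r₁ : J₁.Represents U G₁) {z : (ℝ × BdModel n f) × ℝ} (hz : z.1.1 ∈ Ioo (0 : ℝ) 1)
    (hu : z.1.2 ∈ U) (hd : ((J₀.mix J₁ z.2).H z.1).det ≠ 0) :
    eulerIntegrand o e G₀ G₁ z = rescaledEulerIntegrand o e U J₀ J₁ z := by
  obtain ⟨⟨ε, u⟩, t⟩ := z
  have hz' : ((ε, u), t) ∈ pathSlab U := ⟨⟨⟨hz.1.le, hz.2⟩, hu⟩, mem_univ _⟩
  dsimp only at hz hu hd
  have r := r₀.mix r₁ t
  -- Needed for every real s, because the s-derivative below is taken after rewriting the whole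
  -- function of s. The conjugation formula holds for degenerate metrics as well.
  have hlc : ∀ s, ∀ w ∈ U, ∀ μ, leviCivita (metricPath (G₀ ε) (G₁ ε) s) (ε, w) (some μ) =
      scale ε * metricGamma U J₀ J₁ μ ((ε, w), s) * unscale ε := by
    intro s w hw μ
    rw [metricGamma_eq_gamma h₀ h₁ hU ⟨⟨⟨hz.1.le, hz.2⟩, hw⟩, mem_univ _⟩]
    exact (r₀.mix r₁ s).leviCivita_eq (h₀.mix h₁ s) hB hU hz hw μ
  have hΓ : ∀ μ α β, DifferentiableWithinAt ℝ (fun y => metricGamma U J₀ J₁ μ y α β)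
      (pathSlab U) ((ε, u), t) := fun μ α β =>
    (contDiffWithinAt_metricGamma hU h₀ h₁ hz' hd μ α β).differentiableWithinAt (by simp)
  have hcurv : ∀ μ ν, curvature (leviCivita (metricPath (G₀ ε) (G₁ ε) t)) (ε, u) (some μ) (some ν) =
      scale ε * slabCurvature U (metricGamma U J₀ J₁) ((ε, u), t) μ ν * unscale ε :=
    curvature_eq_slabCurvature hU hz hu (fun μ α β => differentiableAt_leviCivita
      (r.contDiffAt ε hz u hu) (r.det_ne_zero hz hu hd) (some μ) α β) hΓ (hlc t)
  have hder : ∀ μ, (Matrix.of fun α β => deriv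
      (fun s => leviCivita (metricPath (G₀ ε) (G₁ ε) s) (ε, u) (some μ) α β) t) =
      scale ε * (Matrix.of fun α β => fderivWithin ℝ (fun y => metricGamma U J₀ J₁ μ y α β)
        (pathSlab U) ((ε, u), t) (0, 1)) * unscale ε := by
    intro μ
    ext α β
    rw [Matrix.of_apply, scale, unscale, Matrix.mul_diagonal, Matrix.diagonal_mul, Matrix.of_apply,
      fderivWithin_pathSlab_path ⟨hz.1.le, hz.2⟩ hu (hΓ μ α β), ← deriv_const_mul_field,
      ← deriv_mul_const_field]
    congr 1
    funext s
    rw [hlc s u hu, scale, unscale, Matrix.mul_diagonal, Matrix.diagonal_mul]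
  have hG : metricPath (G₀ ε) (G₁ ε) t (ε, u) =
      unscale ε * (J₀.mix J₁ t).H (ε, u) * unscale ε := r.G_eq hz hu
  have hmul : ∀ X : CylMatrix n f, (2 * Real.pi)⁻¹ • (unscale ε * (J₀.mix J₁ t).H (ε, u) *
      unscale ε * (scale ε * X * unscale ε)) =
      unscale ε * ((2 * Real.pi)⁻¹ • ((J₀.mix J₁ t).H (ε, u) * X)) * unscale ε := by
    intro X
    rw [Matrix.mul_smul, Matrix.smul_mul]
    congr 1
    rw [show unscale ε * (J₀.mix J₁ t).H (ε, u) * unscale ε * (scale ε * X * unscale ε) =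
      unscale ε * (J₀.mix J₁ t).H (ε, u) * (unscale ε * scale ε) * X * unscale ε by
        simp only [Matrix.mul_assoc], unscale_mul_scale hz.1.ne', mul_one]
    simp only [Matrix.mul_assoc]
  have hp : 0 < ∏ α : Option (Fin n ⊕ Fin f), (ε ^ wt α)⁻¹ :=
    Finset.prod_pos fun α _ => inv_pos.2 (pow_pos hz.1 _)
  have hdet : √(unscale ε * (J₀.mix J₁ t).H (ε, u) * unscale ε).det =
      (∏ α : Option (Fin n ⊕ Fin f), (ε ^ wt α)⁻¹) * √((J₀.mix J₁ t).H (ε, u)).det := by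
    rw [Matrix.det_mul, Matrix.det_mul, unscale, Matrix.det_diagonal, mul_right_comm,
      Real.sqrt_mul (mul_self_nonneg _), Real.sqrt_mul_self hp.le]
  rw [eulerIntegrand, rescaledEulerIntegrand]
  dsimp only
  simp only [hder, hcurv, hG, hmul, hdet]
  rw [topForm_map o (polarize (pfaffian e)) (fun X => unscale ε * X * unscale ε)
    (∏ α : Option (Fin n ⊕ Fin f), (ε ^ wt α)⁻¹)]
  · rw [mul_inv, mul_mul_mul_comm, inv_mul_cancel₀ hp.ne', one_mul]
  · exact polarize_map (pfaffian e)
      ((AddMonoidHom.mulRight (unscale ε)).comp (AddMonoidHom.mulLeft (unscale ε))) _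
      fun X => pfaffian_diagonal_mul_mul e _ X

theorem continuousWithinAt_mixH (h₀ : J₀.IsRegular U H₀ c₀) (h₁ : J₁.IsRegular U H₀ c₁)
    {z : (ℝ × BdModel n f) × ℝ} (hz : z ∈ pathSlab U) :
    ContinuousWithinAt (fun y : (ℝ × BdModel n f) × ℝ => ((J₀.mix J₁ y.2).H y.1).det)
      (pathSlab U) z :=
  (contDiffWithinAt_det (contDiffWithinAt_mixH h₀ h₁ hz)).continuousWithinAt

theorem tendsto_eulerIntegrand {q : ℕ} (o : Fin (2 * q + 1) ≃ Fin n ⊕ Fin f)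
    (e : Fin (2 * (q + 1)) ≃ Option (Fin n ⊕ Fin f)) (hU : IsOpen U) (hB : IsBlockMetric U H₀)
    (h₀ : J₀.IsRegular U H₀ c₀) (h₁ : J₁.IsRegular U H₀ c₁) (r₀ : J₀.Represents U G₀)
    (r₁ : J₁.Represents U G₁) (hf : Odd f) {u : BdModel n f} (hu : u ∈ U) (t : ℝ) :
    Tendsto (eulerIntegrand o e G₀ G₁) (𝓝[{z | 0 < z.1.1}] ((0, u), t)) (𝓝 0) := by
  have hz := zero_mem_pathSlab hu t
  have hH : (J₀.mix J₁ t).H (0, u) = H₀ u := mix_H_zero h₀ h₁ t hu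
  have hd : 0 < ((J₀.mix J₁ t).H (0, u)).det := by rw [hH]; exact hB.det_pos u hu
  have hΓ := contDiffWithinAt_metricGamma hU h₀ h₁ hz hd.ne'
  have hHc : ∀ α β, ContDiffWithinAt ℝ ∞ (fun y : (ℝ × BdModel n f) × ℝ =>
      (J₀.mix J₁ y.2).H y.1 α β) (pathSlab U) ((0, u), t) := contDiffWithinAt_mixH h₀ h₁ hz
  have hdc := continuousWithinAt_mixH h₀ h₁ hz
  have hcont : ContinuousWithinAt (rescaledEulerIntegrand o e U J₀ J₁) (pathSlab U) ((0, u), t) := by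
    refine ContinuousWithinAt.mul (ContinuousWithinAt.inv₀ hdc.sqrt (Real.sqrt_pos.2 hd).ne')
      (continuousWithinAt_topForm o (continuous_polarize (continuous_pfaffian e)) ?_ ?_)
    · intro μ α β
      exact continuousWithinAt_const.mul (contDiffWithinAt_mul hHc (fun γ δ =>
        contDiffWithinAt_fderivWithin_apply hU hz (hΓ μ γ δ) (0, 1)) α β).continuousWithinAt
    · intro μ ν α β
      exact continuousWithinAt_const.mul (contDiffWithinAt_mul hHc
        (contDiffWithinAt_slabCurvature hU hz hΓ μ ν) α β).continuousWithinAt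
  -- Block structure at all parameters s, not only at t: a mixed entry is then the zero function of
  -- s, so its t-derivative vanishes too.
  have hb : ∀ s, ∀ μ, ∀ w ∈ U, metricGamma U J₀ J₁ μ ((0, w), s) ∈ blockDiag isVert := by
    intro s μ w hw
    rw [metricGamma_eq_gamma h₀ h₁ hU (zero_mem_pathSlab hw s)]
    exact gamma_zero_block (h₀.mix h₁ s) hB hU hw μ
  have hcard : (Finset.univ.filter fun α : Option (Fin n ⊕ Fin f) => isVert α = true).card = f := by
    have : (Finset.univ.filter fun α : Option (Fin n ⊕ Fin f) => isVert α = true) =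
        Finset.univ.map (Function.Embedding.inr.trans Function.Embedding.some) := by
      ext α
      rw [Finset.mem_filter, Finset.mem_map]
      rcases α with _ | b | i <;> simp [isVert]
    rw [this, Finset.card_map, Finset.card_univ, Fintype.card_fin]
  have hzero : rescaledEulerIntegrand o e U J₀ J₁ ((0, u), t) = 0 := by
    refine mul_eq_zero_of_right _ (topForm_eq_zero_of_forall o _ (blockDiag isVert) (fun X hX =>
      pfaffian_eq_zero_of_blockDiag e isVert (hcard.symm ▸ hf) hX) _ _ ?_ ?_)
    · intro μ
      refine smul_mem_blockDiag _ (mul_mem_blockDiag (hH ▸ hB.block u hu) fun α β hαβ => ?_)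
      rw [Matrix.of_apply, fderivWithin_pathSlab_path (by simp) hu
        ((hΓ μ α β).differentiableWithinAt (by simp))]
      simp only [hb _ μ u hu α β hαβ, deriv_const]
    · intro μ ν
      exact smul_mem_blockDiag _ (mul_mem_blockDiag (hH ▸ hB.block u hu)
        (slabCurvature_zero_block hU hu t hΓ (hb t) μ ν))
  have hlim : Tendsto (rescaledEulerIntegrand o e U J₀ J₁)
      (𝓝[{z | 0 < z.1.1}] ((0, u), t)) (𝓝 0) := by
    have := hcont.tendsto.mono_left (nhdsWithin_pos_le hU hu t)
    rwa [hzero] at this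
  -- The rescaled determinant is known to be positive at ε = 0 only, hence nearby. That is enough to
  -- identify the two integrands as germs at the limit point.
  refine hlim.congr' ?_
  filter_upwards [eventually_mem_interior hU hu t,
    nhdsWithin_pos_le hU hu t (hdc.eventually (lt_mem_nhds hd))] with z hz1 hz2
  exact (eulerIntegrand_eq o e hU hB h₀ h₁ r₀ r₁ hz1.1 hz1.2 (ne_of_gt hz2)).symm

/-- The integrand of the transgression of the `L`-form. -/
def hirzebruchIntegrand (k : ℕ) {q : ℕ} (o : Fin (2 * q + 1) ≃ Fin n ⊕ Fin f)
    (G₀ G₁ : ℝ → ℝ × BdModel n f → CylMatrix n f) (z : (ℝ × BdModel n f) × ℝ) : ℝ :=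
  topForm o (polarize (hirzebruchL k))
    (fun μ => leviCivita (G₁ z.1.1) z.1 (some μ) - leviCivita (G₀ z.1.1) z.1 (some μ))
    (fun μ ν => curvature
      (fun r η => leviCivita (G₀ z.1.1) r η +
        z.2 • (leviCivita (G₁ z.1.1) r η - leviCivita (G₀ z.1.1) r η))
      z.1 (some μ) (some ν))

/-- The integrand of the transgression of the `L`-form in rescaled frames. -/
def rescaledHirzebruchIntegrand (k : ℕ) {q : ℕ} (o : Fin (2 * q + 1) ≃ Fin n ⊕ Fin f)
    (U : Set (BdModel n f)) (J₀ J₁ : Jet n f) (z : (ℝ × BdModel n f) × ℝ) : ℝ :=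
  topForm o (polarize (hirzebruchL k))
    (fun μ => J₁.gamma U μ z.1 - J₀.gamma U μ z.1)
    (fun μ ν => slabCurvature U (affineGamma U J₀ J₁) z μ ν)

theorem hirzebruchIntegrand_eq (k : ℕ) {q : ℕ} (o : Fin (2 * q + 1) ≃ Fin n ⊕ Fin f)
    (hU : IsOpen U) (hB : IsBlockMetric U H₀)
    (h₀ : J₀.IsRegular U H₀ c₀) (h₁ : J₁.IsRegular U H₀ c₁) (r₀ : J₀.Represents U G₀)
    (r₁ : J₁.Represents U G₁) {z : (ℝ × BdModel n f) × ℝ} (hz : z.1.1 ∈ Ioo (0 : ℝ) 1)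
    (hu : z.1.2 ∈ U) (hd₀ : (J₀.H z.1).det ≠ 0) (hd₁ : (J₁.H z.1).det ≠ 0) :
    hirzebruchIntegrand k o G₀ G₁ z = rescaledHirzebruchIntegrand k o U J₀ J₁ z := by
  obtain ⟨⟨ε, u⟩, t⟩ := z
  have hz' : ((ε, u), t) ∈ pathSlab U := ⟨⟨⟨hz.1.le, hz.2⟩, hu⟩, mem_univ _⟩
  dsimp only at hz hu hd₀ hd₁
  have l₀ : ∀ w ∈ U, ∀ μ, leviCivita (G₀ ε) (ε, w) (some μ) =
      scale ε * J₀.gamma U μ (ε, w) * unscale ε := fun w hw μ => r₀.leviCivita_eq h₀ hB hU hz hw μ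
  have l₁ : ∀ w ∈ U, ∀ μ, leviCivita (G₁ ε) (ε, w) (some μ) =
      scale ε * J₁.gamma U μ (ε, w) * unscale ε := fun w hw μ => r₁.leviCivita_eq h₁ hB hU hz hw μ
  have d₀ : ∀ μ α β, DifferentiableAt ℝ (fun r => leviCivita (G₀ ε) r (some μ) α β) (ε, u) :=
    fun μ α β => differentiableAt_leviCivita (r₀.contDiffAt ε hz u hu) (r₀.det_ne_zero hz hu hd₀) _ _ _
  have d₁ : ∀ μ α β, DifferentiableAt ℝ (fun r => leviCivita (G₁ ε) r (some μ) α β) (ε, u) :=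
    fun μ α β => differentiableAt_leviCivita (r₁.contDiffAt ε hz u hu) (r₁.det_ne_zero hz hu hd₁) _ _ _
  have hcurv : ∀ μ ν, curvature (fun r η => leviCivita (G₀ ε) r η +
      t • (leviCivita (G₁ ε) r η - leviCivita (G₀ ε) r η)) (ε, u) (some μ) (some ν) =
      scale ε * slabCurvature U (affineGamma U J₀ J₁) ((ε, u), t) μ ν * unscale ε := by
    refine curvature_eq_slabCurvature hU hz hu (fun μ α β => ?_) (fun μ α β =>
      (contDiffWithinAt_affineGamma hU h₀ h₁ hz' hd₀ hd₁ μ α β).differentiableWithinAt (by simp))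
      fun w hw μ => ?_
    · exact (d₀ μ α β).add (((d₁ μ α β).sub (d₀ μ α β)).const_mul t)
    · rw [l₀ w hw, l₁ w hw, affineGamma, mul_add, add_mul, Matrix.mul_smul, Matrix.smul_mul,
        mul_sub, sub_mul]
  have hθ : ∀ μ, leviCivita (G₁ ε) (ε, u) (some μ) - leviCivita (G₀ ε) (ε, u) (some μ) =
      scale ε * (J₁.gamma U μ (ε, u) - J₀.gamma U μ (ε, u)) * unscale ε := by
    intro μ
    rw [l₀ u hu, l₁ u hu, mul_sub, sub_mul]
  rw [hirzebruchIntegrand, rescaledHirzebruchIntegrand]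
  dsimp only
  simp only [hcurv, hθ]
  rw [topForm_map o (polarize (hirzebruchL k)) (fun X => scale ε * X * unscale ε) 1, one_mul]
  exact polarize_map (hirzebruchL k)
      ((AddMonoidHom.mulRight (unscale ε)).comp (AddMonoidHom.mulLeft (scale ε))) _
      fun X => by
        rw [one_mul]; exact hirzebruchL_conj k _ _ X (scale_mul_unscale hz.1.ne')

theorem tendsto_hirzebruchIntegrand (k : ℕ) {q : ℕ} (o : Fin (2 * q + 1) ≃ Fin n ⊕ Fin f)
    (hU : IsOpen U) (hB : IsBlockMetric U H₀)
    (h₀ : J₀.IsRegular U H₀ c₀) (h₁ : J₁.IsRegular U H₀ c₁) (r₀ : J₀.Represents U G₀)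
    (r₁ : J₁.Represents U G₁) (hf : f = 1) {u : BdModel n f} (hu : u ∈ U) (t : ℝ) :
    Tendsto (hirzebruchIntegrand k o G₀ G₁) (𝓝[{z | 0 < z.1.1}] ((0, u), t)) (𝓝 0) := by
  have hs : Subsingleton (Fin f) := by subst hf; infer_instance
  have i : Fin f := ⟨0, by omega⟩
  have hz := zero_mem_pathSlab hu t
  have hd₀ : (J₀.H (0, u)).det ≠ 0 := by rw [h₀.H_zero u hu]; exact (hB.det_pos u hu).ne'
  have hd₁ : (J₁.H (0, u)).det ≠ 0 := by rw [h₁.H_zero u hu]; exact (hB.det_pos u hu).ne'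
  have hΓ := contDiffWithinAt_affineGamma hU h₀ h₁ hz hd₀ hd₁
  have hcont : ContinuousWithinAt (rescaledHirzebruchIntegrand k o U J₀ J₁) (pathSlab U)
      ((0, u), t) := by
    refine continuousWithinAt_topForm o (continuous_polarize (continuous_hirzebruchL k)) ?_ ?_
    · intro μ α β
      exact ((contDiffWithinAt_pathSlab (z := ((0, u), t))
        (h₁.contDiffWithinAt_gamma hU hz.1 hd₁ μ α β)).sub (contDiffWithinAt_pathSlab
          (z := ((0, u), t)) (h₀.contDiffWithinAt_gamma hU hz.1 hd₀ μ α β))).continuousWithinAt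
    · intro μ ν α β
      exact (contDiffWithinAt_slabCurvature hU hz hΓ μ ν α β).continuousWithinAt
  -- At ε = 0 the affine path is the connection of the mixed jet. Since i is the only fibre index,
  -- all other indices j are base indices.
  have hcv : ∀ j, slabCurvature U (affineGamma U J₀ J₁) ((0, u), t) j (Sum.inr i) = 0 := by
    rintro (a | j)
    · exact slabCurvature_zero_vert hs (h₀.mix h₁ t) hB hU hu t hΓ
        (fun μ w hw => affineGamma_zero_eq_gamma h₀ h₁ hU hw t μ) a i
    · rw [Subsingleton.elim j i, slabCurvature_self]
  have hzero : rescaledHirzebruchIntegrand k o U J₀ J₁ ((0, u), t) = 0 := by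
    refine topForm_eq_zero_of_index o _ _ _ (Sum.inr i) ?_ (fun j => ?_) hcv
    · dsimp only
      rw [gamma_zero_vert_eq hs h₀ h₁ hB hU hu i, sub_self]
    · rw [slabCurvature_swap, hcv, neg_zero]
  have hlim : Tendsto (rescaledHirzebruchIntegrand k o U J₀ J₁)
      (𝓝[{z | 0 < z.1.1}] ((0, u), t)) (𝓝 0) := by
    have := hcont.tendsto.mono_left (nhdsWithin_pos_le hU hu t)
    rwa [hzero] at this
  have e₀ : ∀ᶠ z : (ℝ × BdModel n f) × ℝ in 𝓝[pathSlab U] ((0, u), t), (J₀.H z.1).det ≠ 0 :=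
    (contDiffWithinAt_det fun α β => contDiffWithinAt_pathSlab (z := ((0, u), t))
      (h₀.smoothH α β _ hz.1)).continuousWithinAt.eventually_ne hd₀
  have e₁ : ∀ᶠ z : (ℝ × BdModel n f) × ℝ in 𝓝[pathSlab U] ((0, u), t), (J₁.H z.1).det ≠ 0 :=
    (contDiffWithinAt_det fun α β => contDiffWithinAt_pathSlab (z := ((0, u), t))
      (h₁.smoothH α β _ hz.1)).continuousWithinAt.eventually_ne hd₁
  refine hlim.congr' ?_
  filter_upwards [eventually_mem_interior hU hu t, nhdsWithin_pos_le hU hu t e₀,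
    nhdsWithin_pos_le hU hu t e₁] with z hz1 hz2 hz3
  exact (hirzebruchIntegrand_eq k o hU hB h₀ h₁ r₀ r₁ hz1.1 hz1.2 hz2 hz3).symm

/-- The limits are joint in (ε, u, t) at each point of the compact set {0} × K × [0, 1], so finitely
many neighbourhoods give one bound on ε. -/
theorem eventually_abs_le_of_tendsto {E : Type*} [TopologicalSpace E] {K : Set E}
    (hK : IsCompact K) {F : (ℝ × E) × ℝ → ℝ}
    (h : ∀ u ∈ K, ∀ t ∈ Icc (0 : ℝ) 1,
      Tendsto F (𝓝[{z | 0 < z.1.1}] ((0, u), t)) (𝓝 0)) {δ : ℝ} (hδ : 0 < δ) :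
    ∀ᶠ ε in 𝓝[>] (0 : ℝ), ∀ u ∈ K, ∀ t ∈ Icc (0 : ℝ) 1, |F ((ε, u), t)| ≤ δ := by
  -- Positivity of ε is made a hypothesis inside the statement, so that compactness is applied on a
  -- full neighbourhood of 0.
  have key : ∀ᶠ ε in 𝓝 (0 : ℝ), ∀ y ∈ K ×ˢ Icc (0 : ℝ) 1,
      0 < ε → |F ((ε, y.1), y.2)| ≤ δ := by
    refine (hK.prod isCompact_Icc).eventually_forall_of_forall_eventually fun y hy => ?_
    have h1 := (h y.1 hy.1 y.2 hy.2).eventually (Metric.closedBall_mem_nhds 0 hδ)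
    rw [eventually_nhdsWithin_iff] at h1
    have hc : Tendsto (fun p : ℝ × (E × ℝ) => ((p.1, p.2.1), p.2.2)) (𝓝 (0, y))
        (𝓝 ((0, y.1), y.2)) :=
      Continuous.tendsto (f := fun p : ℝ × (E × ℝ) => ((p.1, p.2.1), p.2.2)) (by fun_prop) (0, y)
    filter_upwards [hc.eventually h1] with p hp h0
    simpa using hp h0
  filter_upwards [nhdsWithin_le_nhds key, self_mem_nhdsWithin] with ε h1 h2 u hu t ht
  exact h1 (u, t) ⟨hu, ht⟩ h2

end Limits

/-! ### Jets of `φ`-metrics and of auxiliary metrics in coordinates -/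

section JetConstructions

variable {n f : ℕ} {U : Set (BdModel n f)} {H₀ : BdModel n f → CylMatrix n f}

theorem contDiffOn_comp_snd {F : BdModel n f → ℝ} (hF : ContDiffOn ℝ ∞ F U) :
    ContDiffOn ℝ ∞ (fun q : ℝ × BdModel n f => F q.2) (slab U) :=
  hF.comp contDiffOn_snd fun _ hq => hq.2

/-- The rescaled jet of the metrics `x ^ (-wt α - wt β) (H₀ + x m)`. -/
def phiJet (U : Set (BdModel n f)) (H₀ : BdModel n f → CylMatrix n f)
    (m : ℝ × BdModel n f → CylMatrix n f) : Jet n f where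
  H q := Matrix.of fun α β => H₀ q.2 α β + q.1 * m q α β
  X q := Matrix.of fun α β => -((wt α + wt β : ℕ) : ℝ) * (H₀ q.2 α β + q.1 * m q α β) +
    q.1 * fderivWithin ℝ (fun r : ℝ × BdModel n f => H₀ r.2 α β + r.1 * m r α β) (slab U) q (1, 0)
  m := m

/-- Since x^(w+1) ∂_x (x^(-w) H) = -w H + x ∂_x H, the limit of the x-derivative is -w H₀ entrywise.
This is where the constants come from. -/
theorem phiJet_isRegular (hU : IsOpen U) (hB : IsBlockMetric U H₀)
    {m : ℝ × BdModel n f → CylMatrix n f}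
    (hm : ∀ α β, ContDiffOn ℝ ∞ (fun q => m q α β) (slab U))
    (hm₀ : ∀ u ∈ U, ∀ α β, isVert α = false → isVert β = false → m (0, u) α β = 0) :
    (phiJet U H₀ m).IsRegular U H₀ (Matrix.of fun α β => -((wt α + wt β : ℕ) : ℝ)) where
  smoothH α β := (contDiffOn_comp_snd (hB.smooth α β)).add (contDiffOn_fst.mul (hm α β))
  smoothX α β := by
    have h := (contDiffOn_comp_snd (hB.smooth α β)).add (contDiffOn_fst.mul (hm α β))
    exact (contDiffOn_const.mul h).add (contDiffOn_fst.mul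
      ((h.fderivWithin (uniqueDiffOn_slab hU) (by simp)).clm_apply contDiffOn_const))
  smoothm := hm
  H_zero u _ := by ext α β; simp [phiJet]
  H_eq _ _ _ _ _ := rfl
  m_zero := hm₀
  X_zero u _ α β := by simp [phiJet]

theorem pd_none_pow (w : ℕ) (p : ℝ × BdModel n f) :
    HasFDerivAt (fun q : ℝ × BdModel n f => q.1 ^ w)
      ((w * p.1 ^ (w - 1)) • ContinuousLinearMap.fst ℝ ℝ (BdModel n f)) p := by
  have h : HasFDerivAt (fun q : ℝ × BdModel n f => q.1) (ContinuousLinearMap.fst ℝ ℝ _) p :=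
    hasFDerivAt_fst
  exact (hasDerivAt_pow w p.1).comp_hasFDerivAt p h

theorem phiJet_represents (hU : IsOpen U) (hB : IsBlockMetric U H₀)
    {m : ℝ × BdModel n f → CylMatrix n f}
    (hm : ∀ α β, ContDiffOn ℝ ∞ (fun q => m q α β) (slab U))
    {G : ℝ × BdModel n f → CylMatrix n f}
    (hG : ∀ x ∈ Ioo (0 : ℝ) 1, ∀ u ∈ U, ∀ α β,
      x ^ (wt α + wt β) * G (x, u) α β = H₀ u α β + x * m (x, u) α β)
    (hs : ∀ x ∈ Ioo (0 : ℝ) 1, ∀ u ∈ U, ∀ α β, G (x, u) α β = G (x, u) β α) :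
    (phiJet U H₀ m).Represents U (fun _ => G) := by
  have hH : ∀ α β, ContDiffOn ℝ ∞ (fun q : ℝ × BdModel n f => H₀ q.2 α β + q.1 * m q α β)
      (slab U) := fun α β =>
    (contDiffOn_comp_snd (hB.smooth α β)).add (contDiffOn_fst.mul (hm α β))
  have hc : ∀ ε ∈ Ioo (0 : ℝ) 1, ∀ u ∈ U, ∀ α β, ContDiffAt ℝ ∞ (fun q => G q α β) (ε, u) := by
    intro ε hε u hu α β
    have he : (fun q => G q α β) =ᶠ[𝓝 (ε, u)]
        fun q => (q.1 ^ (wt α + wt β))⁻¹ * (H₀ q.2 α β + q.1 * m q α β) := by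
      filter_upwards [prod_mem_nhds (Ioo_mem_nhds hε.1 hε.2) (hU.mem_nhds hu)] with q hq
      rw [← hG q.1 hq.1 q.2 hq.2, inv_mul_cancel_left₀ (pow_ne_zero _ hq.1.1.ne')]
    refine ContDiffAt.congr_of_eventuallyEq ?_ he
    exact ((contDiffAt_fst.pow _).inv (pow_ne_zero _ hε.1.ne')).mul
      ((hH α β).contDiffAt (slab_mem_nhds hU hε hu))
  refine ⟨hc, fun _ _ => hs, fun ε hε u hu α β => hG ε hε u hu α β, fun ε hε u hu α β => ?_⟩
  have hd := ((hc ε hε u hu α β).differentiableAt (by simp)).hasFDerivAt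
  have he : (fun q : ℝ × BdModel n f => H₀ q.2 α β + q.1 * m q α β) =ᶠ[𝓝 (ε, u)]
      fun q => q.1 ^ (wt α + wt β) * G q α β := by
    filter_upwards [prod_mem_nhds (Ioo_mem_nhds hε.1 hε.2) (hU.mem_nhds hu)] with q hq
    exact (hG q.1 hq.1 q.2 hq.2 α β).symm
  have hX : (phiJet U H₀ m).X (ε, u) α β = -((wt α + wt β : ℕ) : ℝ) *
      (H₀ u α β + ε * m (ε, u) α β) + ε * fderivWithin ℝ (fun r : ℝ × BdModel n f =>
        H₀ r.2 α β + r.1 * m r α β) (slab U) (ε, u) (1, 0) := rfl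
  rw [hX, fderivWithin_of_mem_nhds (slab_mem_nhds hU hε hu), he.fderiv_eq,
    ((pd_none_pow (wt α + wt β) (ε, u)).fun_mul hd).fderiv, ← hG ε hε u hu]
  simp only [pd, coordVec, add_apply, smul_apply, smul_eq_mul, ContinuousLinearMap.coe_fst']
  -- The derivative of x^w contains the truncated exponent w - 1, so w = 0 is separate.
  rcases Nat.eq_zero_or_pos (wt α + wt β) with h0 | h0
  · rw [h0]; simp
  · obtain ⟨w, hw⟩ := Nat.exists_eq_succ_of_ne_zero h0.ne'
    rw [hw]
    simp only [Nat.succ_eq_add_one, Nat.add_sub_cancel]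
    ring

/-- The parameter space `[0, 1)² × U` of the auxiliary metrics. -/
def biSlab (U : Set (BdModel n f)) : Set ((ℝ × ℝ) × BdModel n f) := (Ico 0 1 ×ˢ Ico 0 1) ×ˢ U

theorem uniqueDiffOn_biSlab (hU : IsOpen U) : UniqueDiffOn ℝ (biSlab U) :=
  ((uniqueDiffOn_Ico 0 1).prod (uniqueDiffOn_Ico 0 1)).prod hU.uniqueDiffOn

/-- The rescaled jet of the metrics `ε ^ (-wt α - wt β) h + κ_ε (x)`. -/
def auxJet (U : Set (BdModel n f)) (h : BdModel n f → CylMatrix n f)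
    (κ : (ℝ × ℝ) × BdModel n f → CylMatrix n f) : Jet n f where
  H q := Matrix.of fun α β => h q.2 α β + q.1 ^ (wt α + wt β) * κ ((q.1, q.1), q.2) α β
  X q := Matrix.of fun α β => q.1 ^ (wt α + wt β + 1) *
    fderivWithin ℝ (fun r => κ r α β) (biSlab U) ((q.1, q.1), q.2) ((0, 1), 0)
  m q := Matrix.of fun α β => q.1 ^ (wt α + wt β - 1) * κ ((q.1, q.1), q.2) α β

theorem contDiffOn_comp_diag {F : (ℝ × ℝ) × BdModel n f → ℝ} (hF : ContDiffOn ℝ ∞ F (biSlab U)) :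
    ContDiffOn ℝ ∞ (fun q : ℝ × BdModel n f => F ((q.1, q.1), q.2)) (slab U) :=
  hF.comp ((contDiffOn_fst.prodMk contDiffOn_fst).prodMk contDiffOn_snd)
    fun _ hq => ⟨⟨hq.1, hq.1⟩, hq.2⟩

theorem wt_pos_of_isVert {α : Option (Fin n ⊕ Fin f)} (h : isVert α = false) : 0 < wt α := by
  rcases α with _ | b | j
  · exact two_pos
  · exact one_pos
  · cases h

theorem wt_eq_zero_of_isVert {α : Option (Fin n ⊕ Fin f)} (h : isVert α = true) : wt α = 0 := by
  rcases α with _ | b | j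
  · cases h
  · cases h
  · rfl

/-- In ĝ_ε the singular powers are powers of ε, constant in x. The rescaled x-derivative keeps at
least one factor ε and its limit is 0, in contrast to the φ-metric. -/
theorem auxJet_isRegular (hU : IsOpen U) {h : BdModel n f → CylMatrix n f}
    {κ : (ℝ × ℝ) × BdModel n f → CylMatrix n f}
    (hh : ∀ α β, ContDiffOn ℝ ∞ (fun u => h u α β) U)
    (hκ : ∀ α β, ContDiffOn ℝ ∞ (fun q => κ q α β) (biSlab U))
    (h_eq : ∀ u ∈ U, ∀ α β, (isVert α && isVert β) = false → h u α β = H₀ u α β)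
    (κ_eq : ∀ u ∈ U, ∀ α β, (isVert α && isVert β) = true →
      h u α β = 0 ∧ κ ((0, 0), u) α β = H₀ u α β) :
    (auxJet U h κ).IsRegular U H₀ 0 where
  smoothH α β := (contDiffOn_comp_snd (hh α β)).add
    ((contDiffOn_fst.pow _).mul (contDiffOn_comp_diag (hκ α β)))
  smoothX α β := (contDiffOn_fst.pow _).mul (contDiffOn_comp_diag
    (((hκ α β).fderivWithin (uniqueDiffOn_biSlab hU) (by simp)).clm_apply contDiffOn_const))
  smoothm α β := (contDiffOn_fst.pow _).mul (contDiffOn_comp_diag (hκ α β))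
  H_zero u hu := by
    ext α β
    simp only [auxJet, Matrix.of_apply]
    cases hv : (isVert α && isVert β)
    · rw [h_eq u hu α β hv, zero_pow, zero_mul, add_zero]
      rcases Bool.and_eq_false_iff.1 hv with h' | h'
      · have := wt_pos_of_isVert h'; omega
      · have := wt_pos_of_isVert h'; omega
    · rw [(κ_eq u hu α β hv).1, (κ_eq u hu α β hv).2,
        wt_eq_zero_of_isVert (Bool.and_eq_true_iff.1 hv).1,
        wt_eq_zero_of_isVert (Bool.and_eq_true_iff.1 hv).2]
      simp
  H_eq q hq α β hv := by
    simp only [auxJet, Matrix.of_apply]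
    -- Outside the vertical block the weight is positive, so the exponent w - 1 in `m` is not
    -- truncated. Inside that block no expansion of `H` in terms of `m` is required.
    have hw : 0 < wt α + wt β := by
      rcases Bool.and_eq_false_iff.1 hv with h' | h'
      · have := wt_pos_of_isVert h'; omega
      · have := wt_pos_of_isVert h'; omega
    rw [h_eq q.2 hq.2 α β hv, ← mul_assoc, ← pow_succ', Nat.sub_add_cancel hw]
  m_zero u _ α β hα hβ := by
    have h1 := wt_pos_of_isVert hα
    have h2 := wt_pos_of_isVert hβ
    simp only [auxJet, Matrix.of_apply]
    rw [zero_pow (by omega), zero_mul]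
  X_zero u _ α β := by simp [auxJet]

theorem auxJet_represents (hU : IsOpen U) {h : BdModel n f → CylMatrix n f}
    {κ : (ℝ × ℝ) × BdModel n f → CylMatrix n f}
    (hh : ∀ α β, ContDiffOn ℝ ∞ (fun u => h u α β) U)
    (hκ : ∀ α β, ContDiffOn ℝ ∞ (fun q => κ q α β) (biSlab U))
    {G : ℝ → ℝ × BdModel n f → CylMatrix n f}
    (hG : ∀ ε ∈ Ioo (0 : ℝ) 1, ∀ x ∈ Ioo (0 : ℝ) 1, ∀ u ∈ U, ∀ α β,
      G ε (x, u) α β = (ε ^ (wt α + wt β))⁻¹ * h u α β + κ ((ε, x), u) α β)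
    (hs : ∀ ε ∈ Ioo (0 : ℝ) 1, ∀ x ∈ Ioo (0 : ℝ) 1, ∀ u ∈ U, ∀ α β,
      G ε (x, u) α β = G ε (x, u) β α) :
    (auxJet U h κ).Represents U G := by
  have he : ∀ ε ∈ Ioo (0 : ℝ) 1, ∀ u ∈ U, ∀ α β, (fun q => G ε q α β) =ᶠ[𝓝 (ε, u)]
        fun q => (ε ^ (wt α + wt β))⁻¹ * h q.2 α β + κ ((ε, q.1), q.2) α β := by
    intro ε hε u hu α β
    filter_upwards [prod_mem_nhds (Ioo_mem_nhds hε.1 hε.2) (hU.mem_nhds hu)] with q hq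
    exact hG ε hε q.1 hq.1 q.2 hq.2 α β
  have hn : ∀ ε ∈ Ioo (0 : ℝ) 1, ∀ u ∈ U, biSlab U ∈ 𝓝 ((ε, ε), u) := fun ε hε u hu =>
    prod_mem_nhds (prod_mem_nhds (Ico_mem_nhds hε.1 hε.2) (Ico_mem_nhds hε.1 hε.2))
      (hU.mem_nhds hu)
  refine ⟨fun ε hε u hu α β => ?_, hs, fun ε hε u hu α β => ?_, fun ε hε u hu α β => ?_⟩
  · refine ContDiffAt.congr_of_eventuallyEq ?_ (he ε hε u hu α β)
    refine (contDiffAt_const.mul (((hh α β).contDiffAt (hU.mem_nhds hu)).comp (ε, u)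
      contDiffAt_snd)).add ?_
    exact ContDiffAt.comp (f := fun q : ℝ × BdModel n f => ((ε, q.1), q.2)) (ε, u)
      ((hκ α β).contDiffAt (hn ε hε u hu))
      ((contDiffAt_const.prodMk contDiffAt_fst).prodMk contDiffAt_snd)
  · simp only [auxJet, Matrix.of_apply]
    rw [hG ε hε ε hε u hu, mul_add, mul_inv_cancel_left₀ (pow_ne_zero _ hε.1.ne')]
  · simp only [auxJet, Matrix.of_apply]
    rw [fderivWithin_of_mem_nhds (hn ε hε u hu), pd, (he ε hε u hu α β).fderiv_eq]
    congr 1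
    -- This part is constant in x and drops out along ∂_x; only κ contributes.
    have d₁ : HasFDerivAt (fun q : ℝ × BdModel n f => h q.2 α β) _ (ε, u) :=
      HasFDerivAt.comp (g := fun w => h w α β) (f := fun q : ℝ × BdModel n f => q.2) (ε, u)
        (((hh α β).contDiffAt (hU.mem_nhds hu)).differentiableAt (by simp)).hasFDerivAt
        hasFDerivAt_snd
    have d₂ : HasFDerivAt (fun q : ℝ × BdModel n f => κ ((ε, q.1), q.2) α β) _ (ε, u) :=
      HasFDerivAt.comp (f := fun q : ℝ × BdModel n f => ((ε, q.1), q.2)) (ε, u)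
        (((hκ α β).contDiffAt (hn ε hε u hu)).differentiableAt (by simp)).hasFDerivAt
        (((hasFDerivAt_const ε _).prodMk hasFDerivAt_fst).prodMk hasFDerivAt_snd)
    rw [((d₁.const_mul _).fun_add d₂).fderiv]
    simp [coordVec]

end JetConstructions

/-! ### Coordinate frames -/

section Frames

variable {V : Type*} [NormedAddCommGroup V] [NormedSpace ℝ V]
  {B : Type*} [TopologicalSpace B] [ChartedSpace V B]
  {Y : Type*} [NormedAddCommGroup Y] [NormedSpace ℝ Y]

/-- The tangent vector with components `v` in the chart `χ`. -/
def chartVec (χ : OpenPartialHomeomorph B V) (u v : V) : TangentSpace 𝓘(ℝ, V) (χ.symm u) :=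
  mfderiv 𝓘(ℝ, V) 𝓘(ℝ, V) χ.symm u v

variable {χ : OpenPartialHomeomorph B V}

theorem mem_maximalAtlas_one (hχ : χ ∈ IsManifold.maximalAtlas 𝓘(ℝ, V) ∞ B) :
    χ ∈ IsManifold.maximalAtlas 𝓘(ℝ, V) 1 B :=
  IsManifold.maximalAtlas_subset_of_le (by exact_mod_cast le_top) hχ

theorem chartVec_injective (hχ : χ ∈ IsManifold.maximalAtlas 𝓘(ℝ, V) ∞ B) {u : V}
    (hu : u ∈ χ.target) {v : V} (hv : chartVec χ u v = 0) : v = 0 := by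
  have hd : χ.MDifferentiable 𝓘(ℝ, V) 𝓘(ℝ, V) :=
    ⟨fun x hx => (mdifferentiableAt_of_mem_maximalAtlas (mem_maximalAtlas_one hχ)
      hx).mdifferentiableWithinAt, fun x hx => (mdifferentiableAt_symm_of_mem_maximalAtlas
      (mem_maximalAtlas_one hχ) hx).mdifferentiableWithinAt⟩
  have h := DFunLike.congr_fun (hd.comp_symm_deriv hu) v
  have h' : mfderiv 𝓘(ℝ, V) 𝓘(ℝ, V) χ (χ.symm u) (chartVec χ u v) = v := h
  rw [hv, map_zero] at h'
  exact h'.symm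

variable [IsManifold 𝓘(ℝ, V) ∞ B]

/-- The coordinate field is the tangent map of the inverse chart applied to a constant section. -/
theorem contMDiffOn_chartVec (hχ : χ ∈ IsManifold.maximalAtlas 𝓘(ℝ, V) ∞ B) (v : V) :
    ContMDiffOn 𝓘(ℝ, V) 𝓘(ℝ, V).tangent ∞
      (fun u => (⟨χ.symm u, chartVec χ u v⟩ : TangentBundle 𝓘(ℝ, V) B)) χ.target := by
  have h1 : ContMDiffOn 𝓘(ℝ, V) 𝓘(ℝ, V) ∞ χ.symm χ.target :=
    contMDiffOn_symm_of_mem_maximalAtlas hχ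
  have h2 := h1.contMDiffOn_tangentMapWithin (m := ∞) (by simp) χ.open_target.uniqueMDiffOn
  have h3 : ContMDiff 𝓘(ℝ, V) 𝓘(ℝ, V).tangent ∞
      (fun u : V => (⟨u, v⟩ : TangentBundle 𝓘(ℝ, V) V)) := by
    intro u
    rw [Bundle.contMDiffAt_totalSpace]
    refine ⟨contMDiffAt_id, ?_⟩
    simpa using contMDiffAt_const
  refine (h2.comp h3.contMDiffOn fun u hu => hu).congr fun u hu => ?_
  simp only [Function.comp, tangentMapWithin, chartVec]
  rw [mfderivWithin_of_isOpen χ.open_target hu]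

theorem contDiffOn_bilin {b : Y → B} {s : Set Y}
    {ψ : ∀ y, TangentSpace 𝓘(ℝ, V) (b y) →L[ℝ] TangentSpace 𝓘(ℝ, V) (b y) →L[ℝ] ℝ}
    {v w : ∀ y, TangentSpace 𝓘(ℝ, V) (b y)}
    (hψ : ContMDiffOn 𝓘(ℝ, Y) (𝓘(ℝ, V).prod 𝓘(ℝ, V →L[ℝ] V →L[ℝ] ℝ)) ∞
      (fun y => Bundle.TotalSpace.mk' (V →L[ℝ] V →L[ℝ] ℝ)
        (E := fun x : B => TangentSpace 𝓘(ℝ, V) x →L[ℝ] TangentSpace 𝓘(ℝ, V) x →L[ℝ] ℝ)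
        (b y) (ψ y)) s)
    (hv : ContMDiffOn 𝓘(ℝ, Y) 𝓘(ℝ, V).tangent ∞
      (fun y => (⟨b y, v y⟩ : TangentBundle 𝓘(ℝ, V) B)) s)
    (hw : ContMDiffOn 𝓘(ℝ, Y) 𝓘(ℝ, V).tangent ∞
      (fun y => (⟨b y, w y⟩ : TangentBundle 𝓘(ℝ, V) B)) s) :
    ContDiffOn ℝ ∞ (fun y => ψ y (v y) (w y)) s := by
  rw [← contMDiffOn_iff_contDiffOn]
  have : ContMDiffOn 𝓘(ℝ, Y) (𝓘(ℝ, V).prod 𝓘(ℝ, ℝ)) ∞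
      (fun y => Bundle.TotalSpace.mk' ℝ (E := Bundle.Trivial B ℝ) (b y) (ψ y (v y) (w y))) s :=
    ContMDiffOn.clm_bundle_apply₂ (F₁ := V) (F₂ := V)
      (E₁ := fun x : B => TangentSpace 𝓘(ℝ, V) x) (E₂ := fun x : B => TangentSpace 𝓘(ℝ, V) x)
      hψ hv hw
  intro y hy
  have h := this y hy
  simp only [Bundle.contMDiffWithinAt_totalSpace] at h
  exact h.2

theorem contDiffOn_covec {b : Y → B} {s : Set Y}
    {ψ : ∀ y, TangentSpace 𝓘(ℝ, V) (b y) →L[ℝ] ℝ} {v : ∀ y, TangentSpace 𝓘(ℝ, V) (b y)}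
    (hψ : ContMDiffOn 𝓘(ℝ, Y) (𝓘(ℝ, V).prod 𝓘(ℝ, V →L[ℝ] ℝ)) ∞
      (fun y => Bundle.TotalSpace.mk' (V →L[ℝ] ℝ)
        (E := fun x : B => TangentSpace 𝓘(ℝ, V) x →L[ℝ] ℝ) (b y) (ψ y)) s)
    (hv : ContMDiffOn 𝓘(ℝ, Y) 𝓘(ℝ, V).tangent ∞
      (fun y => (⟨b y, v y⟩ : TangentBundle 𝓘(ℝ, V) B)) s) :
    ContDiffOn ℝ ∞ (fun y => ψ y (v y)) s := by
  rw [← contMDiffOn_iff_contDiffOn]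
  have : ContMDiffOn 𝓘(ℝ, Y) (𝓘(ℝ, V).prod 𝓘(ℝ, ℝ)) ∞
      (fun y => Bundle.TotalSpace.mk' ℝ (E := Bundle.Trivial B ℝ) (b y) (ψ y (v y))) s :=
    ContMDiffOn.clm_bundle_apply (F₁ := V) (E₁ := fun x : B => TangentSpace 𝓘(ℝ, V) x) hψ hv
  intro y hy
  have h := this y hy
  simp only [Bundle.contMDiffWithinAt_totalSpace] at h
  exact h.2

theorem contMDiffOn_apply_endo {b : Y → B} {s : Set Y}
    {ψ : ∀ y, TangentSpace 𝓘(ℝ, V) (b y) →L[ℝ] TangentSpace 𝓘(ℝ, V) (b y)}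
    {v : ∀ y, TangentSpace 𝓘(ℝ, V) (b y)}
    (hψ : ContMDiffOn 𝓘(ℝ, Y) (𝓘(ℝ, V).prod 𝓘(ℝ, V →L[ℝ] V)) ∞
      (fun y => Bundle.TotalSpace.mk' (V →L[ℝ] V)
        (E := fun x : B => TangentSpace 𝓘(ℝ, V) x →L[ℝ] TangentSpace 𝓘(ℝ, V) x) (b y) (ψ y)) s)
    (hv : ContMDiffOn 𝓘(ℝ, Y) 𝓘(ℝ, V).tangent ∞
      (fun y => (⟨b y, v y⟩ : TangentBundle 𝓘(ℝ, V) B)) s) :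
    ContMDiffOn 𝓘(ℝ, Y) 𝓘(ℝ, V).tangent ∞
      (fun y => (⟨b y, ψ y (v y)⟩ : TangentBundle 𝓘(ℝ, V) B)) s :=
  ContMDiffOn.clm_bundle_apply (F₁ := V) (F₂ := V) (E₁ := fun x : B => TangentSpace 𝓘(ℝ, V) x)
    (E₂ := fun x : B => TangentSpace 𝓘(ℝ, V) x) hψ hv

end Frames

/-! ### The boundary fibration in fibred charts. -/

section FibredCharts

variable {n f : ℕ}
  {M : Type*} [TopologicalSpace M] [ChartedSpace (EuclideanHalfSpace (n + f + 1)) M]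
  {W : Type*} [TopologicalSpace W] [ChartedSpace (BdModel n f) W]
  {N : Type*} [TopologicalSpace N] [ChartedSpace (EuclideanSpace ℝ (Fin n)) N]
  {F : Type*} [TopologicalSpace F] [ChartedSpace (EuclideanSpace ℝ (Fin f)) F]
  {D : FibredBoundary n f M W N F}

/-- The projection to the base coordinates. -/
def baseProj (n f : ℕ) : BdModel n f →L[ℝ] EuclideanSpace ℝ (Fin n) :=
  LinearMap.toContinuousLinearMap
    { toFun := fun u => WithLp.toLp 2 fun a => u (Sum.inl a)
      map_add' := fun _ _ => rfl
      map_smul' := fun _ _ => rfl }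

theorem baseProj_apply (u : BdModel n f) (a : Fin n) : baseProj n f u a = u (Sum.inl a) := rfl

theorem baseProj_inr (i : Fin f) : baseProj n f (unitVec (Sum.inr i)) = 0 := by
  ext a
  simp [baseProj_apply]

theorem cylVec_some (χ : OpenPartialHomeomorph W (BdModel n f)) (u : BdModel n f)
    (i : Fin n ⊕ Fin f) : cylVec χ u (some i) = (0, chartVec χ u (unitVec i)) := rfl

variable {χ : OpenPartialHomeomorph W (BdModel n f)}

theorem contMDiffOn_family {P : Type*} [NormedAddCommGroup P] [NormedSpace ℝ P] {s : Set P}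
    (hχ : χ ∈ IsManifold.maximalAtlas 𝓘(ℝ, BdModel n f) ∞ W) :
    ContMDiffOn 𝓘(ℝ, P × BdModel n f) (𝓘(ℝ, P).prod 𝓘(ℝ, BdModel n f)) ∞
      (fun q : P × BdModel n f => (q.1, χ.symm q.2)) (s ×ˢ χ.target) := by
  have h1 : ContMDiffOn 𝓘(ℝ, BdModel n f) 𝓘(ℝ, BdModel n f) ∞ χ.symm χ.target :=
    contMDiffOn_symm_of_mem_maximalAtlas hχ
  exact contDiff_fst.contMDiff.contMDiffOn.prodMk
    (h1.comp contDiff_snd.contMDiff.contMDiffOn fun q hq => hq.2)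

/-- The base chart of a fibred chart determines the differential of the projection. -/
theorem IsFibredChart.exists_base (hχ : IsFibredChart D χ) :
    ∃ η ∈ IsManifold.maximalAtlas (𝓡 n) ∞ N, ∀ u ∈ χ.target,
      baseProj n f u ∈ η.target ∧ D.proj (χ.symm u) = η.symm (baseProj n f u) ∧
      ∀ v, (mfderiv 𝓘(ℝ, BdModel n f) (𝓡 n) D.proj (χ.symm u) (chartVec χ u v) :
        EuclideanSpace ℝ (Fin n)) = chartVec η (baseProj n f u) (baseProj n f v) := by
  obtain ⟨hχ', η, hη, hsub, hcoord⟩ := hχ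
  -- In these charts φ is the linear projection to the base coordinates, and its differential
  -- follows by the chain rule.
  have key : ∀ u ∈ χ.target, D.proj (χ.symm u) ∈ η.source ∧
      η (D.proj (χ.symm u)) = baseProj n f u := by
    intro u hu
    have hs := χ.map_target hu
    refine ⟨hsub hs, ?_⟩
    ext a
    rw [← hcoord _ hs a, χ.right_inv hu, baseProj_apply]
  have key2 : ∀ u ∈ χ.target, baseProj n f u ∈ η.target ∧
      D.proj (χ.symm u) = η.symm (baseProj n f u) := by
    intro u hu
    obtain ⟨h1, h2⟩ := key u hu
    rw [← h2]
    exact ⟨η.map_source h1, (η.left_inv h1).symm⟩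
  refine ⟨η, hη, fun u hu => ⟨(key2 u hu).1, (key2 u hu).2, fun v => ?_⟩⟩
  have d1 : MDifferentiableAt 𝓘(ℝ, BdModel n f) 𝓘(ℝ, BdModel n f) χ.symm u :=
    mdifferentiableAt_symm_of_mem_maximalAtlas (mem_maximalAtlas_one hχ') hu
  have d2 : MDifferentiableAt 𝓘(ℝ, BdModel n f) (𝓡 n) D.proj (χ.symm u) :=
    (D.contMDiff_proj _).mdifferentiableAt (by simp)
  have d3 : MDifferentiableAt (𝓡 n) (𝓡 n) η.symm (baseProj n f u) :=
    mdifferentiableAt_symm_of_mem_maximalAtlas (mem_maximalAtlas_one hη) (key2 u hu).1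
  have e1 := mfderiv_comp u d2 d1
  have e2 := mfderiv_comp u d3 (baseProj n f).mdifferentiableAt
  have e3 : (D.proj ∘ χ.symm) =ᶠ[𝓝 u] (η.symm ∘ baseProj n f) := by
    filter_upwards [χ.open_target.mem_nhds hu] with w hw
    exact (key2 w hw).2
  have e4 := e3.mfderiv_eq (I := 𝓘(ℝ, BdModel n f)) (I' := 𝓡 n)
  have e5 : mfderiv 𝓘(ℝ, BdModel n f) (𝓡 n) (D.proj ∘ χ.symm) u v =
      mfderiv 𝓘(ℝ, BdModel n f) (𝓡 n) D.proj (χ.symm u) (chartVec χ u v) := by rw [e1]; rfl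
  have e6 : mfderiv 𝓘(ℝ, BdModel n f) (𝓡 n) (η.symm ∘ baseProj n f) u v =
      chartVec η (baseProj n f u) (baseProj n f v) := by
    rw [e2, ContinuousLinearMap.mfderiv_eq]; rfl
  have e7 : (mfderiv 𝓘(ℝ, BdModel n f) (𝓡 n) (D.proj ∘ χ.symm) u v : EuclideanSpace ℝ (Fin n)) =
      mfderiv 𝓘(ℝ, BdModel n f) (𝓡 n) (η.symm ∘ baseProj n f) u v :=
    DFunLike.congr_fun e4 v
  exact (e5.symm.trans e7).trans e6

theorem mfderiv_proj_vertical (hχ : IsFibredChart D χ) {u : BdModel n f} (hu : u ∈ χ.target)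
    {v : BdModel n f} (hv : baseProj n f v = 0) :
    mfderiv 𝓘(ℝ, BdModel n f) (𝓡 n) D.proj (χ.symm u) (chartVec χ u v) = 0 := by
  obtain ⟨η, _, h⟩ := hχ.exists_base
  refine ((h u hu).2.2 v).trans ?_
  rw [hv]
  exact map_zero (mfderiv (𝓡 n) (𝓡 n) η.symm (baseProj n f u))

variable [IsManifold 𝓘(ℝ, BdModel n f) ∞ W]

theorem contMDiffOn_field_snd {P : Type*} [NormedAddCommGroup P] [NormedSpace ℝ P] {s : Set P}
    {v : ∀ u : BdModel n f, TangentSpace 𝓘(ℝ, BdModel n f) (χ.symm u)}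
    (hv : ContMDiffOn 𝓘(ℝ, BdModel n f) 𝓘(ℝ, BdModel n f).tangent ∞
      (fun u => (⟨χ.symm u, v u⟩ : TangentBundle 𝓘(ℝ, BdModel n f) W)) χ.target) :
    ContMDiffOn 𝓘(ℝ, P × BdModel n f) 𝓘(ℝ, BdModel n f).tangent ∞
      (fun q : P × BdModel n f =>
        (⟨χ.symm q.2, v q.2⟩ : TangentBundle 𝓘(ℝ, BdModel n f) W)) (s ×ˢ χ.target) :=
  hv.comp contDiff_snd.contMDiff.contMDiffOn fun _ hq => hq.2

theorem SmoothBilinFamily.contDiffOn {P : Type*} [NormedAddCommGroup P] [NormedSpace ℝ P]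
    {s : Set P} {K : P → ∀ w : W, TangentSpace 𝓘(ℝ, BdModel n f) w →L[ℝ]
      TangentSpace 𝓘(ℝ, BdModel n f) w →L[ℝ] ℝ} (hK : SmoothBilinFamily s K)
    (hχ : χ ∈ IsManifold.maximalAtlas 𝓘(ℝ, BdModel n f) ∞ W)
    {v w : ∀ u : BdModel n f, TangentSpace 𝓘(ℝ, BdModel n f) (χ.symm u)}
    (hv : ContMDiffOn 𝓘(ℝ, BdModel n f) 𝓘(ℝ, BdModel n f).tangent ∞
      (fun u => (⟨χ.symm u, v u⟩ : TangentBundle 𝓘(ℝ, BdModel n f) W)) χ.target)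
    (hw : ContMDiffOn 𝓘(ℝ, BdModel n f) 𝓘(ℝ, BdModel n f).tangent ∞
      (fun u => (⟨χ.symm u, w u⟩ : TangentBundle 𝓘(ℝ, BdModel n f) W)) χ.target) :
    ContDiffOn ℝ ∞ (fun q : P × BdModel n f => K q.1 (χ.symm q.2) (v q.2) (w q.2))
      (s ×ˢ χ.target) :=
  contDiffOn_bilin (hK.comp (contMDiffOn_family hχ) fun _ hq => ⟨hq.1, mem_univ _⟩)
    (contMDiffOn_field_snd hv) (contMDiffOn_field_snd hw)

theorem contMDiffOn_vert (S : Splitting D) (hχ : χ ∈ IsManifold.maximalAtlas 𝓘(ℝ, BdModel n f) ∞ W)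
    {v : ∀ u : BdModel n f, TangentSpace 𝓘(ℝ, BdModel n f) (χ.symm u)}
    (hv : ContMDiffOn 𝓘(ℝ, BdModel n f) 𝓘(ℝ, BdModel n f).tangent ∞
      (fun u => (⟨χ.symm u, v u⟩ : TangentBundle 𝓘(ℝ, BdModel n f) W)) χ.target) :
    ContMDiffOn 𝓘(ℝ, BdModel n f) 𝓘(ℝ, BdModel n f).tangent ∞
      (fun u => (⟨χ.symm u, S.vert (χ.symm u) (v u)⟩ : TangentBundle 𝓘(ℝ, BdModel n f) W))
      χ.target := by
  have h1 : ContMDiffOn 𝓘(ℝ, BdModel n f) 𝓘(ℝ, BdModel n f) ∞ χ.symm χ.target :=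
    contMDiffOn_symm_of_mem_maximalAtlas hχ
  exact contMDiffOn_apply_endo (S.contMDiff_vert.comp_contMDiffOn h1) hv

end FibredCharts

/-! ### The limit metric in a fibred chart -/

section LimitMetric

variable {n f : ℕ}
  {M : Type*} [TopologicalSpace M] [ChartedSpace (EuclideanHalfSpace (n + f + 1)) M]
  {W : Type*} [TopologicalSpace W] [ChartedSpace (BdModel n f) W]
  {N : Type*} [TopologicalSpace N] [ChartedSpace (EuclideanSpace ℝ (Fin n)) N]
  {F : Type*} [TopologicalSpace F] [ChartedSpace (EuclideanSpace ℝ (Fin f)) F]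
  {D : FibredBoundary n f M W N F}
  [IsManifold 𝓘(ℝ, BdModel n f) ∞ W] [IsManifold (𝓡 n) ∞ N] {S : Splitting D}
  {χ : OpenPartialHomeomorph W (BdModel n f)}

/-- The coordinate vector fields of the chart. -/
abbrev coordField (χ : OpenPartialHomeomorph W (BdModel n f)) (u : BdModel n f)
    (i : Fin n ⊕ Fin f) : TangentSpace 𝓘(ℝ, BdModel n f) (χ.symm u) :=
  chartVec χ u (unitVec i)

/-- The limit `dx² + φ^* h + τ` of the rescaled metrics in coordinates, without the fibre part. -/
def horizontalMetric (Q : ProductData S) (χ : OpenPartialHomeomorph W (BdModel n f))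
    (u : BdModel n f) : CylMatrix n f :=
  Matrix.of fun α β => match α, β with
    | none, none => 1
    | some (Sum.inl a), some (Sum.inl b) =>
      Q.baseForm (χ.symm u) (coordField χ u (Sum.inl a)) (coordField χ u (Sum.inl b))
    | _, _ => 0

/-- The limit `dx² + φ^* h + τ` of the rescaled metrics in coordinates. -/
def limitMetric (Q : ProductData S) (χ : OpenPartialHomeomorph W (BdModel n f))
    (u : BdModel n f) : CylMatrix n f :=
  Matrix.of fun α β => match α, β with
    | none, none => 1
    | some (Sum.inl a), some (Sum.inl b) =>
      Q.baseForm (χ.symm u) (coordField χ u (Sum.inl a)) (coordField χ u (Sum.inl b))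
    | some (Sum.inr i), some (Sum.inr j) =>
      Q.τ (χ.symm u) (coordField χ u (Sum.inr i)) (coordField χ u (Sum.inr j))
    | _, _ => 0

/-- The inner product depends on its base point through the type. The vectors are taken in the
common model space so that they can be compared at two equal points. -/
theorem inner_congr (Q : ProductData S) {y y' : N} (hy : y = y') (v w : EuclideanSpace ℝ (Fin n)) :
    (Q.h.inner y v w : ℝ) = Q.h.inner y' v w := by
  subst hy; rfl

theorem baseForm_eq (Q : ProductData S) (hχ : IsFibredChart D χ) :
    ∃ η ∈ IsManifold.maximalAtlas (𝓡 n) ∞ N, ∀ u ∈ χ.target, baseProj n f u ∈ η.target ∧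
      ∀ v w : BdModel n f, Q.baseForm (χ.symm u) (chartVec χ u v) (chartVec χ u w) =
        Q.h.inner (η.symm (baseProj n f u)) (chartVec η (baseProj n f u) (baseProj n f v))
          (chartVec η (baseProj n f u) (baseProj n f w)) := by
  obtain ⟨η, hη, h⟩ := hχ.exists_base
  refine ⟨η, hη, fun u hu => ⟨(h u hu).1, fun v w => ?_⟩⟩
  obtain ⟨_, h2, h3⟩ := h u hu
  refine Eq.trans ?_ (inner_congr Q h2 _ _)
  rw [ProductData.baseForm, ← h3 v, ← h3 w]

theorem contDiffOn_inner (Q : ProductData S) {η : OpenPartialHomeomorph N (EuclideanSpace ℝ (Fin n))}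
    (hη : η ∈ IsManifold.maximalAtlas (𝓡 n) ∞ N) (v w : EuclideanSpace ℝ (Fin n)) :
    ContDiffOn ℝ ∞ (fun y => (Q.h.inner (η.symm y) (chartVec η y v) (chartVec η y w) : ℝ))
      η.target := by
  have h1 : ContMDiffOn (𝓡 n) (𝓡 n) ∞ η.symm η.target := contMDiffOn_symm_of_mem_maximalAtlas hη
  exact contDiffOn_bilin (Q.h.contMDiff.comp_contMDiffOn h1) (contMDiffOn_chartVec hη v)
    (contMDiffOn_chartVec hη w)

/-- The components of φ^*h are functions on the base chart composed with the projection, hence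
smooth and constant along the fibre coordinates. -/
theorem contDiffOn_baseForm (Q : ProductData S) (hχ : IsFibredChart D χ) (v w : BdModel n f) :
    ContDiffOn ℝ ∞ (fun u => Q.baseForm (χ.symm u) (chartVec χ u v) (chartVec χ u w)) χ.target ∧
    ∀ u ∈ χ.target, ∀ j, fderiv ℝ
      (fun u => Q.baseForm (χ.symm u) (chartVec χ u v) (chartVec χ u w)) u
      (unitVec (Sum.inr j)) = 0 := by
  obtain ⟨η, hη, h⟩ := baseForm_eq Q hχ
  have hs := contDiffOn_inner Q hη (baseProj n f v) (baseProj n f w)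
  refine ⟨(hs.comp (baseProj n f).contDiff.contDiffOn fun u hu => (h u hu).1).congr
    fun u hu => (h u hu).2 v w, fun u hu j => ?_⟩
  have he : (fun u => Q.baseForm (χ.symm u) (chartVec χ u v) (chartVec χ u w)) =ᶠ[𝓝 u]
      (fun y => (Q.h.inner (η.symm y) (chartVec η y (baseProj n f v))
        (chartVec η y (baseProj n f w)) : ℝ)) ∘ baseProj n f := by
    filter_upwards [χ.open_target.mem_nhds hu] with p hp
    exact (h p hp).2 v w
  have hd := (hs.contDiffAt (η.open_target.mem_nhds (h u hu).1)).differentiableAt (by simp)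
  rw [he.fderiv_eq, fderiv_comp u hd (baseProj n f).differentiableAt]
  simp [baseProj_inr]

theorem baseForm_vertical (Q : ProductData S) (hχ : IsFibredChart D χ) {u : BdModel n f}
    (hu : u ∈ χ.target) (i : Fin f) (X : TangentSpace 𝓘(ℝ, BdModel n f) (χ.symm u)) :
    Q.baseForm (χ.symm u) (coordField χ u (Sum.inr i)) X = 0 ∧
    Q.baseForm (χ.symm u) X (coordField χ u (Sum.inr i)) = 0 := by
  simp only [ProductData.baseForm, mfderiv_proj_vertical hχ hu (baseProj_inr i), map_zero,
    zero_apply, and_self]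

theorem contDiffOn_tau (Q : ProductData S) (hχ : IsFibredChart D χ) (v w : BdModel n f) :
    ContDiffOn ℝ ∞ (fun u => Q.τ (χ.symm u) (chartVec χ u v) (chartVec χ u w)) χ.target := by
  have h := Q.smooth_τ.contDiffOn hχ.1 (contMDiffOn_chartVec hχ.1 v) (contMDiffOn_chartVec hχ.1 w)
  -- `smooth_τ` speaks of a family constant in a dummy real parameter, which is set to 0.
  exact h.comp (contDiff_const.prodMk contDiff_id : ContDiff ℝ ∞ fun u : BdModel n f =>
    ((0 : ℝ), u)).contDiffOn fun u hu => ⟨mem_univ _, hu⟩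

theorem limitMetric_symm (Q : ProductData S) (u : BdModel n f) (α β : Option (Fin n ⊕ Fin f)) :
    limitMetric Q χ u α β = limitMetric Q χ u β α := by
  rcases α with _ | a | i <;> rcases β with _ | b | j <;> try rfl
  · exact Q.h.symm _ _ _
  · exact Q.τ_symm _ _ _

/-- The quadratic form splits as a square in the x-component, plus h on the image of the base part
under dφ, plus τ on the vertical part. Each is definite because dφ identifies base coordinate
vectors with those of the base chart and kills fibre coordinate vectors. -/
theorem limitMetric_posDef (Q : ProductData S) (hχ : IsFibredChart D χ) {u : BdModel n f}
    (hu : u ∈ χ.target) : (limitMetric Q χ u).PosDef := by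
  refine Matrix.posDef_iff_dotProduct_mulVec.2 ⟨?_, fun x hx => ?_⟩
  · ext α β
    simp [Matrix.conjTranspose_apply, limitMetric_symm Q u α β]
  obtain ⟨η, hη, hbase⟩ := hχ.exists_base
  obtain ⟨hπ, -, hd⟩ := hbase u hu
  set v : BdModel n f := ∑ a : Fin n, x (some (Sum.inl a)) • unitVec (Sum.inl a) with hv
  set w : BdModel n f := ∑ i : Fin f, x (some (Sum.inr i)) • unitVec (Sum.inr i) with hw
  have lin : ∀ {k : ℕ} (c : Fin k → ℝ) (e : Fin k → BdModel n f),
      chartVec χ u (∑ a, c a • e a) = ∑ a, c a • chartVec χ u (e a) := by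
    intro k c e
    let L : BdModel n f →L[ℝ] TangentSpace 𝓘(ℝ, BdModel n f) (χ.symm u) :=
      mfderiv 𝓘(ℝ, BdModel n f) 𝓘(ℝ, BdModel n f) χ.symm u
    exact (map_sum L _ _).trans (Finset.sum_congr rfl fun a _ => map_smul L _ _)
  have hq : star x ⬝ᵥ (limitMetric Q χ u).mulVec x = x none * x none +
      Q.baseForm (χ.symm u) (chartVec χ u v) (chartVec χ u v) +
      Q.τ (χ.symm u) (chartVec χ u w) (chartVec χ u w) := by
    rw [hv, hw, lin, lin]
    simp only [dotProduct, Matrix.mulVec, Fintype.sum_option, Fintype.sum_sum_type,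
      ProductData.baseForm, map_sum, map_smul, sum_apply, smul_apply, smul_eq_mul, Finset.mul_sum,
      limitMetric, Matrix.of_apply, star_trivial, zero_mul, Finset.sum_const_zero,
      add_zero, zero_add, one_mul]
    rw [add_assoc]
    congr 2
    · rw [Finset.sum_comm]
      refine Finset.sum_congr rfl fun a _ => Finset.sum_congr rfl fun b _ => by
        simp only [coordField]; ring
    · rw [Finset.sum_comm]
      refine Finset.sum_congr rfl fun a _ => Finset.sum_congr rfl fun b _ => by
        simp only [coordField]; ring
  have hvi : ∀ a, v (Sum.inl a) = x (some (Sum.inl a)) := by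
    intro a
    simp [hv, Finset.sum_apply, Pi.single_apply]
  have hwi : ∀ i, w (Sum.inr i) = x (some (Sum.inr i)) := by
    intro i
    simp [hw, Finset.sum_apply, Pi.single_apply]
  have hwπ : baseProj n f w = 0 := by simp [hw, baseProj_inr]
  have b0 : 0 ≤ Q.baseForm (χ.symm u) (chartVec χ u v) (chartVec χ u v) := by
    rw [ProductData.baseForm]
    by_cases h : mfderiv 𝓘(ℝ, BdModel n f) (𝓡 n) D.proj (χ.symm u) (chartVec χ u v) = 0
    · rw [h, map_zero]
    · exact (Q.h.pos _ _ h).le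
  have t0 : 0 ≤ Q.τ (χ.symm u) (chartVec χ u w) (chartVec χ u w) := by
    by_cases h : chartVec χ u w = 0
    · rw [h, map_zero]
    · exact (Q.τ_pos _ _ (mfderiv_proj_vertical hχ hu hwπ) h).le
  rw [hq]
  by_contra hcon
  have hx0 : x none = 0 := by nlinarith [mul_self_nonneg (x none)]
  have hb : Q.baseForm (χ.symm u) (chartVec χ u v) (chartVec χ u v) ≤ 0 := by
    nlinarith [mul_self_nonneg (x none)]
  have ht : Q.τ (χ.symm u) (chartVec χ u w) (chartVec χ u w) ≤ 0 := by
    nlinarith [mul_self_nonneg (x none)]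
  have hw0 : w = 0 := by
    by_contra h
    exact absurd (Q.τ_pos _ _ (mfderiv_proj_vertical hχ hu hwπ)
      fun h' => h (chartVec_injective hχ.1 hu h')) (not_lt.2 ht)
  -- Positivity of h gives dφ v = 0, and dφ v is the vector with components `baseProj n f v` in the
  -- base chart, where components are determined.
  have hv0 : baseProj n f v = 0 := by
    refine chartVec_injective hη hπ ?_
    by_contra h
    refine absurd (Q.h.pos (D.proj (χ.symm u)) (mfderiv 𝓘(ℝ, BdModel n f) (𝓡 n) D.proj
      (χ.symm u) (chartVec χ u v)) ?_) (not_lt.2 hb)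
    intro h'
    exact h ((hd v).symm.trans h')
  refine hx (funext fun α => ?_)
  rcases α with _ | a | i
  · exact hx0
  · rw [← hvi, ← baseProj_apply, hv0]; rfl
  · rw [← hwi, hw0]; rfl

theorem limitMetric_isBlockMetric (Q : ProductData S) (hχ : IsFibredChart D χ) :
    IsBlockMetric χ.target (limitMetric Q χ) where
  smooth α β := by
    rcases α with _ | a | i <;> rcases β with _ | b | j <;> try exact contDiffOn_const
    · exact (contDiffOn_baseForm Q hχ _ _).1
    · exact contDiffOn_tau Q hχ _ _
  block u _ α β h := by
    rcases α with _ | a | i <;> rcases β with _ | b | j <;> first | rfl | exact absurd rfl h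
  indep u hu α β hα hβ j := by
    rcases α with _ | a | i <;> rcases β with _ | b | l
    · exact DFunLike.congr_fun (fderiv_const_apply (1 : ℝ)) _
    · exact DFunLike.congr_fun (fderiv_const_apply (0 : ℝ)) _
    · cases hβ
    · exact DFunLike.congr_fun (fderiv_const_apply (0 : ℝ)) _
    · exact (contDiffOn_baseForm Q hχ _ _).2 u hu j
    · cases hβ
    · cases hα
    · cases hα
    · cases hα
  det_pos u hu := (limitMetric_posDef Q hχ hu).det_pos

end LimitMetric

/-! ### Components of φ-tensors in the rescaled frame. -/

section PhiTensors

variable {n f : ℕ}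
  {M : Type*} [TopologicalSpace M] [ChartedSpace (EuclideanHalfSpace (n + f + 1)) M]
  {W : Type*} [TopologicalSpace W] [ChartedSpace (BdModel n f) W]
  {N : Type*} [TopologicalSpace N] [ChartedSpace (EuclideanSpace ℝ (Fin n)) N]
  {F : Type*} [TopologicalSpace F] [ChartedSpace (EuclideanSpace ℝ (Fin f)) F]
  {D : FibredBoundary n f M W N F}
  [IsManifold 𝓘(ℝ, BdModel n f) ∞ W] {S : Splitting D}
  {χ : OpenPartialHomeomorph W (BdModel n f)}

/-- The coefficient of the vertical part of `∂_i` in `phiField`. -/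
def vertShift (x : ℝ) : Fin n ⊕ Fin f → ℝ
  | Sum.inl _ => x - 1
  | Sum.inr _ => 0

/-- The vector fields `∂_a^H + x ∂_a^V` and `∂_i`. -/
def phiField (S : Splitting D) (χ : OpenPartialHomeomorph W (BdModel n f)) (x : ℝ)
    (u : BdModel n f) (i : Fin n ⊕ Fin f) : TangentSpace 𝓘(ℝ, BdModel n f) (χ.symm u) :=
  coordField χ u i + vertShift x i • S.vert (χ.symm u) (coordField χ u i)

/-- The components of a `φ`-tensor with respect to `x²∂_x`, `x ∂_a`, `∂_i`. -/
def PhiTensor.comp (T : PhiTensor n f W) (S : Splitting D)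
    (χ : OpenPartialHomeomorph W (BdModel n f)) (q : ℝ × BdModel n f) : CylMatrix n f :=
  Matrix.of fun α β => match α, β with
    | none, none => T.c₀₀ q.1 (χ.symm q.2)
    | none, some j => T.c₀ q.1 (χ.symm q.2) (phiField S χ q.1 q.2 j)
    | some i, none => T.c₀ q.1 (χ.symm q.2) (phiField S χ q.1 q.2 i)
    | some i, some j =>
      T.c₁ q.1 (χ.symm q.2) (phiField S χ q.1 q.2 i) (phiField S χ q.1 q.2 j)

theorem vert_coordField (S : Splitting D) (hχ : IsFibredChart D χ) {u : BdModel n f}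
    (hu : u ∈ χ.target) (i : Fin f) :
    S.vert (χ.symm u) (coordField χ u (Sum.inr i)) = coordField χ u (Sum.inr i) :=
  S.vert_eq_self _ _ (mfderiv_proj_vertical hχ hu (baseProj_inr i))

/-- The tangent vector ∂_a corresponds to ∂_a^H / x + ∂_a^V in the φ-tangent bundle; clearing the
pole gives ∂_a^H + x ∂_a^V, smooth up to x = 0. A fibre vector is already vertical and needs no
factor. -/
theorem phiField_eq (S : Splitting D) (hχ : IsFibredChart D χ) {u : BdModel n f}
    (hu : u ∈ χ.target) {x : ℝ} (hx : x ≠ 0) (i : Fin n ⊕ Fin f) :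
    x⁻¹ • (coordField χ u i - S.vert (χ.symm u) (coordField χ u i)) +
      S.vert (χ.symm u) (coordField χ u i) = (x ^ wt (some i))⁻¹ • phiField S χ x u i := by
  rcases i with a | i
  · simp only [phiField, vertShift, wt, pow_one, smul_add, smul_sub, smul_smul, sub_smul,
      inv_mul_cancel₀ hx, one_smul]
    abel
  · simp [phiField, vertShift, wt, vert_coordField S hχ hu]

theorem PhiTensor.pow_mul_eval (T : PhiTensor n f W) (S : Splitting D) (hχ : IsFibredChart D χ)
    {u : BdModel n f} (hu : u ∈ χ.target) {x : ℝ} (hx : x ≠ 0) (α β : Option (Fin n ⊕ Fin f)) :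
    x ^ (wt α + wt β) * T.eval S x (χ.symm u) (cylVec χ u α) (cylVec χ u β) =
      T.comp S χ (x, u) α β := by
  rcases α with _ | i <;> rcases β with _ | j
  · simp only [PhiTensor.eval, cylVec, PhiTensor.comp, Matrix.of_apply, map_zero, sub_zero,
      smul_zero, add_zero, mul_zero, wt]
    field_simp
  · simp only [PhiTensor.eval, cylVec_some, PhiTensor.comp, Matrix.of_apply,
      phiField_eq S hχ hu hx]
    simp only [cylVec, map_zero, sub_zero, smul_zero, add_zero, mul_zero, zero_div, zero_mul,
      zero_add, zero_apply, map_smul, smul_eq_mul, pow_add]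
    have := pow_ne_zero (wt (some j)) hx
    simp only [wt]
    field_simp
  · simp only [PhiTensor.eval, cylVec_some, PhiTensor.comp, Matrix.of_apply,
      phiField_eq S hχ hu hx]
    simp only [cylVec, map_zero, sub_zero, smul_zero, add_zero, mul_zero, zero_div, zero_mul,
      zero_add, map_smul, smul_eq_mul, pow_add]
    have := pow_ne_zero (wt (some i)) hx
    simp only [wt]
    field_simp
  · simp only [PhiTensor.eval, cylVec_some, PhiTensor.comp, Matrix.of_apply,
      phiField_eq S hχ hu hx]
    simp only [zero_div, zero_mul, zero_add, map_smul, smul_apply, smul_eq_mul, pow_add]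
    have h1 := pow_ne_zero (wt (some i)) hx
    have h2 := pow_ne_zero (wt (some j)) hx
    field_simp

theorem contDiff_vertShift (i : Fin n ⊕ Fin f) : ContDiff ℝ ∞ fun x => vertShift x i := by
  rcases i with a | i
  · exact contDiff_id.sub contDiff_const
  · exact contDiff_const

theorem PhiTensor.contDiffOn_comp (T : PhiTensor n f W) (S : Splitting D)
    (hχ : IsFibredChart D χ) (α β : Option (Fin n ⊕ Fin f)) :
    ContDiffOn ℝ ∞ (fun q => T.comp S χ q α β) (slab χ.target) := by
  have hs : ∀ i : Fin n ⊕ Fin f, ContDiffOn ℝ ∞ (fun q : ℝ × BdModel n f => vertShift q.1 i)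
      (slab χ.target) := fun i => ((contDiff_vertShift i).comp contDiff_fst).contDiffOn
  have hX := fun i : Fin n ⊕ Fin f => contMDiffOn_chartVec hχ.1 (unitVec i)
  have hV := fun i => contMDiffOn_vert S hχ.1 (hX i)
  have hfam : ContMDiffOn 𝓘(ℝ, ℝ × BdModel n f) (𝓘(ℝ, ℝ).prod 𝓘(ℝ, BdModel n f)) ∞
      (fun q : ℝ × BdModel n f => (q.1, χ.symm q.2)) (slab χ.target) := contMDiffOn_family hχ.1
  have hmaps : MapsTo (fun q : ℝ × BdModel n f => (q.1, χ.symm q.2)) (slab χ.target)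
      (Ico (0 : ℝ) 1 ×ˢ univ) := fun q hq => ⟨hq.1, mem_univ _⟩
  have h₀ : ∀ i, ContDiffOn ℝ ∞ (fun q : ℝ × BdModel n f =>
      T.c₀ q.1 (χ.symm q.2) (phiField S χ q.1 q.2 i)) (slab χ.target) := by
    intro i
    simp only [phiField, map_add, map_smul, smul_eq_mul]
    exact (contDiffOn_covec (T.smooth₀.comp hfam hmaps) (contMDiffOn_field_snd (hX i))).add
      ((hs i).mul (contDiffOn_covec (T.smooth₀.comp hfam hmaps) (contMDiffOn_field_snd (hV i))))
  rcases α with _ | i <;> rcases β with _ | j <;> simp only [PhiTensor.comp, Matrix.of_apply]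
  · rw [← contMDiffOn_iff_contDiffOn]
    exact T.smooth₀₀.comp hfam hmaps
  · exact h₀ j
  · exact h₀ i
  · simp only [phiField, map_add, map_smul, add_apply, smul_apply, smul_eq_mul]
    exact ((T.smooth₁.contDiffOn hχ.1 (hX i) (hX j)).add
      ((hs i).mul (T.smooth₁.contDiffOn hχ.1 (hV i) (hX j)))).add
      ((hs j).mul ((T.smooth₁.contDiffOn hχ.1 (hX i) (hV j)).add
        ((hs i).mul (T.smooth₁.contDiffOn hχ.1 (hV i) (hV j)))))

theorem PhiTensor.comp_symm (T : PhiTensor n f W) {q : ℝ × BdModel n f}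
    (hq : q.1 ∈ Ico (0 : ℝ) 1) (α β : Option (Fin n ⊕ Fin f)) :
    T.comp S χ q α β = T.comp S χ q β α := by
  rcases α with _ | i <;> rcases β with _ | j <;> try rfl
  exact T.symm _ hq _ _ _

/-- The O(x) bound is stated for x > 0; continuity up to x = 0 turns it into the vanishing of the
boundary value. -/
theorem PhiTensor.CondI.horizontal_eq_zero {A : PhiTensor n f W} (hA : A.CondI S) (w : W)
    {Y₁ Y₂ : TangentSpace 𝓘(ℝ, BdModel n f) w} (h₁ : S.vert w Y₁ = 0) (h₂ : S.vert w Y₂ = 0) :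
    A.c₁ 0 w Y₁ Y₂ = 0 := by
  have hc : ContDiffOn ℝ ∞ (fun x => A.c₁ x w Y₁ Y₂) (Ico 0 1) := by
    refine contDiffOn_bilin (b := fun _ => w) (A.smooth₁.comp (contMDiff_id.prodMk
      contMDiff_const).contMDiffOn fun x hx => ⟨hx, mem_univ w⟩) ?_ ?_
    · exact contMDiffOn_const
    · exact contMDiffOn_const
  have t1 : Tendsto (fun x => A.c₁ x w Y₁ Y₂) (𝓝[>] 0) (𝓝 (A.c₁ 0 w Y₁ Y₂)) := by
    refine ((hc.continuousOn 0 (by simp)).tendsto).mono_left ?_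
    rw [← nhdsWithin_Ioo_eq_nhdsGT (zero_lt_one' ℝ)]
    exact nhdsWithin_mono _ Ioo_subset_Ico_self
  have t2 : Tendsto (fun x => A.c₁ x w Y₁ Y₂) (𝓝[>] 0) (𝓝 0) :=
    (hA.2 w Y₁ Y₂ h₁ h₂).trans_tendsto (tendsto_id.mono_left nhdsWithin_le_nhds)
  exact tendsto_nhds_unique t1 t2

theorem PhiTensor.CondI.comp_eq_zero {A : PhiTensor n f W} (hA : A.CondI S)
    {u : BdModel n f} {α β : Option (Fin n ⊕ Fin f)} (hα : isVert α = false)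
    (hβ : isVert β = false) : A.comp S χ (0, u) α β = 0 := by
  have h0 := hA.1 0 (by simp) (χ.symm u)
  -- At x = 0 the field is ∂_a minus its vertical part, hence horizontal, since `S.vert` is
  -- idempotent.
  have hv : ∀ a : Fin n, S.vert (χ.symm u) (phiField S χ 0 u (Sum.inl a)) = 0 := by
    intro a
    have := S.vert_eq_self (χ.symm u) _ (S.proj_vert (χ.symm u) (coordField χ u (Sum.inl a)))
    simp [phiField, vertShift, this]
  rcases α with _ | a | i
  · rcases β with _ | b | j
    · exact h0.1
    · simp [PhiTensor.comp, h0.2]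
    · cases hβ
  · rcases β with _ | b | j
    · simp [PhiTensor.comp, h0.2]
    · exact hA.horizontal_eq_zero _ (hv a) (hv b)
    · cases hβ
  · cases hα

end PhiTensors

/-! ### Exact `φ`-metrics and auxiliary metrics in a fibred chart -/

section MetricsInCharts

variable {n f : ℕ}
  {M : Type*} [TopologicalSpace M] [ChartedSpace (EuclideanHalfSpace (n + f + 1)) M]
  {W : Type*} [TopologicalSpace W] [ChartedSpace (BdModel n f) W]
  {N : Type*} [TopologicalSpace N] [ChartedSpace (EuclideanSpace ℝ (Fin n)) N]
  {F : Type*} [TopologicalSpace F] [ChartedSpace (EuclideanSpace ℝ (Fin f)) F]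
  {D : FibredBoundary n f M W N F}
  [IsManifold 𝓘(ℝ, BdModel n f) ∞ W] [IsManifold (𝓡 n) ∞ N] {S : Splitting D}
  {χ : OpenPartialHomeomorph W (BdModel n f)}

/-- The first order part of the product-type metric with respect to `x²∂_x`, `x ∂_a`, `∂_i`. -/
def prodRemainder (Q : ProductData S) (χ : OpenPartialHomeomorph W (BdModel n f))
    (q : ℝ × BdModel n f) : CylMatrix n f :=
  Matrix.of fun α β => match α, β with
    | some (Sum.inl a), some (Sum.inl b) =>
      q.1 * Q.τ (χ.symm q.2) (coordField χ q.2 (Sum.inl a)) (coordField χ q.2 (Sum.inl b))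
    | some (Sum.inl a), some (Sum.inr j) =>
      Q.τ (χ.symm q.2) (coordField χ q.2 (Sum.inl a)) (coordField χ q.2 (Sum.inr j))
    | some (Sum.inr i), some (Sum.inl b) =>
      Q.τ (χ.symm q.2) (coordField χ q.2 (Sum.inr i)) (coordField χ q.2 (Sum.inl b))
    | _, _ => 0

theorem baseForm_zero (Q : ProductData S) (w : W) (X : TangentSpace 𝓘(ℝ, BdModel n f) w) :
    Q.baseForm w 0 X = 0 ∧ Q.baseForm w X 0 = 0 := by
  simp [ProductData.baseForm]

/-- The fields ∂_a need not be horizontal, so τ also has entries with base indices. Their weights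
put them into the remainder: base-fibre entries at order x, base-base entries at order x², which
keeps the horizontal block of the remainder zero at x = 0. -/
theorem pow_mul_metric (Q : ProductData S) (hχ : IsFibredChart D χ) {u : BdModel n f}
    (hu : u ∈ χ.target) {x : ℝ} (hx : x ≠ 0) (α β : Option (Fin n ⊕ Fin f)) :
    x ^ (wt α + wt β) * Q.metric x (χ.symm u) (cylVec χ u α) (cylVec χ u β) =
      limitMetric Q χ u α β + x * prodRemainder Q χ (x, u) α β := by
  have hb := fun i X => (baseForm_vertical Q hχ hu i X).1
  have hb' := fun i X => (baseForm_vertical Q hχ hu i X).2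
  simp only [coordField] at hb hb'
  rcases α with _ | a | i <;> rcases β with _ | b | j <;>
    simp only [ProductData.metric, limitMetric, prodRemainder, Matrix.of_apply, cylVec_some,
      coordField, wt] <;>
    (try simp only [cylVec, (baseForm_zero Q _ _).1, (baseForm_zero Q _ _).2, map_zero, zero_apply,
      hb, hb']) <;>
    (try field_simp) <;> (try ring)

theorem contDiffOn_prodRemainder (Q : ProductData S) (hχ : IsFibredChart D χ)
    (α β : Option (Fin n ⊕ Fin f)) :
    ContDiffOn ℝ ∞ (fun q => prodRemainder Q χ q α β) (slab χ.target) := by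
  have hτ := fun i j : Fin n ⊕ Fin f =>
    contDiffOn_comp_snd (contDiffOn_tau Q hχ (unitVec i) (unitVec j))
  rcases α with _ | a | i <;> rcases β with _ | b | j <;> try exact contDiffOn_const
  · exact contDiffOn_fst.mul (hτ _ _)
  · exact hτ _ _
  · exact hτ _ _

theorem prodRemainder_symm (Q : ProductData S) (q : ℝ × BdModel n f)
    (α β : Option (Fin n ⊕ Fin f)) : prodRemainder Q χ q α β = prodRemainder Q χ q β α := by
  rcases α with _ | a | i <;> rcases β with _ | b | j <;> try rfl
  · exact congrArg (q.1 * ·) (Q.τ_symm _ _ _)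
  · exact Q.τ_symm _ _ _
  · exact Q.τ_symm _ _ _

theorem prodRemainder_zero (Q : ProductData S) (u : BdModel n f) {α β : Option (Fin n ⊕ Fin f)}
    (hα : isVert α = false) (hβ : isVert β = false) : prodRemainder Q χ (0, u) α β = 0 := by
  rcases α with _ | a | i <;> rcases β with _ | b | j <;>
    first | rfl | exact zero_mul _ | exact Bool.noConfusion hα | exact Bool.noConfusion hβ

/-- The rescaled first order part of the metric `g̃ + x A + x² B` in coordinates. -/
def phiRemainder (Q : ProductData S) (A B : PhiTensor n f W)
    (χ : OpenPartialHomeomorph W (BdModel n f)) (q : ℝ × BdModel n f) : CylMatrix n f :=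
  prodRemainder Q χ q + A.comp S χ q + q.1 • B.comp S χ q

variable {Q : ProductData S} {A B : PhiTensor n f W}

theorem contDiffOn_phiRemainder (hχ : IsFibredChart D χ) (α β : Option (Fin n ⊕ Fin f)) :
    ContDiffOn ℝ ∞ (fun q => phiRemainder Q A B χ q α β) (slab χ.target) :=
  ((contDiffOn_prodRemainder Q hχ α β).add (A.contDiffOn_comp S hχ α β)).add
    (contDiffOn_fst.mul (B.contDiffOn_comp S hχ α β))

theorem phiRemainder_zero (hA : A.CondI S) (u : BdModel n f) {α β : Option (Fin n ⊕ Fin f)}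
    (hα : isVert α = false) (hβ : isVert β = false) : phiRemainder Q A B χ (0, u) α β = 0 := by
  simp [phiRemainder, prodRemainder_zero Q u hα hβ, hA.comp_eq_zero hα hβ]

theorem phiJet_isRegular_of_condI (hχ : IsFibredChart D χ) (hA : A.CondI S) :
    (phiJet χ.target (limitMetric Q χ) (phiRemainder Q A B χ)).IsRegular χ.target
      (limitMetric Q χ) (Matrix.of fun α β => -((wt α + wt β : ℕ) : ℝ)) :=
  phiJet_isRegular χ.open_target (limitMetric_isBlockMetric Q hχ) (contDiffOn_phiRemainder hχ)
    fun u _ _ _ => phiRemainder_zero hA u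

theorem phiJet_represents_gram [IsManifold (𝓡∂ (n + f + 1)) ∞ M] (hχ : IsFibredChart D χ)
    (G : ExactPhiMetric Q A B) :
    (phiJet χ.target (limitMetric Q χ) (phiRemainder Q A B χ)).Represents χ.target
      (fun _ => gram (D.pullback G.g) χ) := by
  have hG : ∀ x ∈ Ioo (0 : ℝ) 1, ∀ u ∈ χ.target, ∀ α β,
      x ^ (wt α + wt β) * gram (D.pullback G.g) χ (x, u) α β =
        limitMetric Q χ u α β + x * phiRemainder Q A B χ (x, u) α β := by
    intro x hx u hu α β
    have h1 := pow_mul_metric Q hχ hu hx.1.ne' α β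
    have h2 := A.pow_mul_eval S hχ hu hx.1.ne' α β
    have h3 := B.pow_mul_eval S hχ hu hx.1.ne' α β
    have hg : gram (D.pullback G.g) χ (x, u) α β = Q.metric x (χ.symm u) (cylVec χ u α)
        (cylVec χ u β) + x * A.eval S x (χ.symm u) (cylVec χ u α) (cylVec χ u β) +
        x ^ 2 * B.eval S x (χ.symm u) (cylVec χ u α) (cylVec χ u β) := G.collar_eq x hx _ _ _
    simp only [phiRemainder, Matrix.add_apply, Matrix.smul_apply, smul_eq_mul]
    rw [hg]
    linear_combination h1 + x * h2 + x ^ 2 * h3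
  refine phiJet_represents χ.open_target (limitMetric_isBlockMetric Q hχ)
    (contDiffOn_phiRemainder hχ) hG fun x hx u hu α β => ?_
  have hx' : ((x, u) : ℝ × BdModel n f).1 ∈ Ico (0 : ℝ) 1 := ⟨hx.1.le, hx.2⟩
  refine mul_left_cancel₀ (pow_ne_zero (wt α + wt β) hx.1.ne') ?_
  rw [hG x hx u hu, add_comm (wt α), hG x hx u hu, limitMetric_symm]
  simp only [phiRemainder, Matrix.add_apply, Matrix.smul_apply]
  rw [prodRemainder_symm, A.comp_symm hx', B.comp_symm hx']

/-- The components of the family `κ`. -/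
def kappaComp (K : AuxiliaryFamily Q A) (χ : OpenPartialHomeomorph W (BdModel n f))
    (q : (ℝ × ℝ) × BdModel n f) : CylMatrix n f :=
  Matrix.of fun α β => match α, β with
    | some i, some j => K.κ q.1 (χ.symm q.2) (coordField χ q.2 i) (coordField χ q.2 j)
    | _, _ => 0

theorem contDiffOn_kappaComp (K : AuxiliaryFamily Q A) (hχ : IsFibredChart D χ)
    (α β : Option (Fin n ⊕ Fin f)) :
    ContDiffOn ℝ ∞ (fun q => kappaComp K χ q α β) (biSlab χ.target) := by
  rcases α with _ | i <;> rcases β with _ | j <;> try exact contDiffOn_const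
  exact K.smooth.contDiffOn hχ.1 (contMDiffOn_chartVec hχ.1 _) (contMDiffOn_chartVec hχ.1 _)

theorem contDiffOn_horizontalMetric (Q : ProductData S) (hχ : IsFibredChart D χ)
    (α β : Option (Fin n ⊕ Fin f)) :
    ContDiffOn ℝ ∞ (fun u => horizontalMetric Q χ u α β) χ.target := by
  rcases α with _ | a | i <;> rcases β with _ | b | j <;> try exact contDiffOn_const
  exact (contDiffOn_baseForm Q hχ _ _).1

/-- On vertical vectors the agreement on x = ε reads κ_ε(ε) = τ + ε A. Letting ε tend to 0 shows
that both families share the vertical block of the limit metric. -/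
theorem kappaComp_zero (K : AuxiliaryFamily Q A) (hχ : IsFibredChart D χ) {u : BdModel n f}
    (hu : u ∈ χ.target) (i j : Fin f) :
    kappaComp K χ ((0, 0), u) (some (Sum.inr i)) (some (Sum.inr j)) =
      limitMetric Q χ u (some (Sum.inr i)) (some (Sum.inr j)) := by
  set α : Option (Fin n ⊕ Fin f) := some (Sum.inr i) with hα
  set β : Option (Fin n ⊕ Fin f) := some (Sum.inr j) with hβ
  have h1 : ContinuousWithinAt (fun ε : ℝ => kappaComp K χ ((ε, ε), u) α β) (Ico 0 1) 0 :=
    ((contDiffOn_comp_diag (contDiffOn_kappaComp K hχ α β)).continuousOn (0, u)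
      ⟨by simp, hu⟩).comp (f := fun ε : ℝ => (ε, u)) (by fun_prop) fun ε hε => ⟨hε, hu⟩
  have h2 : ContinuousWithinAt (fun ε : ℝ => A.comp S χ (ε, u) α β) (Ico 0 1) 0 :=
    ((A.contDiffOn_comp S hχ α β).continuousOn (0, u)
      ⟨by simp, hu⟩).comp (f := fun ε : ℝ => (ε, u)) (by fun_prop) fun ε hε => ⟨hε, hu⟩
  have h3 : ContinuousWithinAt (fun ε : ℝ => limitMetric Q χ u α β + ε * A.comp S χ (ε, u) α β)
      (Ico 0 1) 0 := continuousWithinAt_const.add (continuousWithinAt_id.mul h2)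
  have hle : 𝓝[>] (0 : ℝ) ≤ 𝓝[Ico 0 1] 0 := by
    rw [← nhdsWithin_Ioo_eq_nhdsGT (zero_lt_one' ℝ)]
    exact nhdsWithin_mono _ Ioo_subset_Ico_self
  have he : (fun ε : ℝ => kappaComp K χ ((ε, ε), u) α β) =ᶠ[𝓝[>] 0]
      fun ε => limitMetric Q χ u α β + ε * A.comp S χ (ε, u) α β := by
    filter_upwards [Ioo_mem_nhdsGT (zero_lt_one' ℝ)] with ε hε
    have ha := K.agree ε hε (χ.symm u) (coordField χ u (Sum.inr i)) (coordField χ u (Sum.inr j))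
    have hm := pow_mul_metric Q hχ hu hε.1.ne' α β
    have hc := A.pow_mul_eval S hχ hu hε.1.ne' α β
    rw [(baseForm_vertical Q hχ hu i _).1, zero_div, zero_add] at ha
    have hp : prodRemainder Q χ (ε, u) α β = 0 := rfl
    have hw : wt α + wt β = 0 := rfl
    rw [hw, pow_zero, one_mul] at hm hc
    rw [hp, mul_zero, add_zero] at hm
    rw [← hm, ← hc]
    exact ha
  have h4 := tendsto_nhds_unique ((h1.tendsto.mono_left hle).congr' he) (h3.tendsto.mono_left hle)
  simpa using h4

theorem auxJet_isRegular_kappa (K : AuxiliaryFamily Q A) (hχ : IsFibredChart D χ) :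
    (auxJet χ.target (horizontalMetric Q χ) (kappaComp K χ)).IsRegular χ.target
      (limitMetric Q χ) 0 := by
  refine auxJet_isRegular χ.open_target (contDiffOn_horizontalMetric Q hχ)
    (contDiffOn_kappaComp K hχ) (fun u _ α β h => ?_) fun u hu α β h => ?_
  · rcases α with _ | a | i <;> rcases β with _ | b | j <;> first | rfl | cases h
  · rcases α with _ | a | i <;> rcases β with _ | b | j <;> try cases h
    exact ⟨rfl, kappaComp_zero K hχ hu i j⟩

theorem auxJet_represents_gram [IsManifold (𝓡∂ (n + f + 1)) ∞ M] (K : AuxiliaryFamily Q A)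
    (hχ : IsFibredChart D χ) :
    (auxJet χ.target (horizontalMetric Q χ) (kappaComp K χ)).Represents χ.target
      (fun ε => gram (K.metric ε) χ) := by
  refine auxJet_represents χ.open_target (contDiffOn_horizontalMetric Q hχ)
    (contDiffOn_kappaComp K hχ) (fun ε hε x hx u hu α β => ?_) fun ε hε x hx u hu α β => ?_
  · have hb := fun i X => (baseForm_vertical Q hχ hu i X).1
    have hb' := fun i X => (baseForm_vertical Q hχ hu i X).2
    simp only [coordField] at hb hb'
    have hε' := hε.1.ne'
    rcases α with _ | a | i <;> rcases β with _ | b | j <;>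
    simp only [gram, AuxiliaryFamily.metric, horizontalMetric, kappaComp, Matrix.of_apply,
      cylVec_some, coordField, wt] <;>
    (try simp only [cylVec, (baseForm_zero Q _ _).1, (baseForm_zero Q _ _).2, map_zero, zero_apply,
      hb, hb']) <;>
    (try field_simp) <;> (try ring)
  · have hs : ∀ X Y, Q.baseForm (χ.symm u) X Y = Q.baseForm (χ.symm u) Y X :=
      fun X Y => Q.h.symm _ _ _
    simp only [gram, AuxiliaryFamily.metric, Matrix.of_apply]
    rw [hs, K.symm ε ⟨hε.1.le, hε.2⟩ x ⟨hx.1.le, hx.2⟩, mul_comm (cylVec χ u α).1]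

end MetricsInCharts

/-! ### Integration over the hypersurfaces -/

section Integration

variable {n f : ℕ}
  {M : Type*} [TopologicalSpace M] [ChartedSpace (EuclideanHalfSpace (n + f + 1)) M]
  {W : Type*} [TopologicalSpace W] [ChartedSpace (BdModel n f) W]
  {N : Type*} [TopologicalSpace N] [ChartedSpace (EuclideanSpace ℝ (Fin n)) N]
  {F : Type*} [TopologicalSpace F] [ChartedSpace (EuclideanSpace ℝ (Fin f)) F]
  {D : FibredBoundary n f M W N F}

theorem abs_intervalIntegral_le {F : ℝ → ℝ} {δ : ℝ} (h : ∀ t ∈ Icc (0 : ℝ) 1, |F t| ≤ δ) :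
    |∫ t in (0 : ℝ)..1, F t| ≤ δ := by
  have := intervalIntegral.norm_integral_le_of_norm_le_const (a := 0) (b := 1) (f := F) (C := δ)
    fun t ht => h t (by rw [uIoc_of_le zero_le_one] at ht; exact ⟨ht.1.le, ht.2⟩)
  simpa using this

theorem eventually_abs_transgressionEuler_le {q : ℕ} {o : Fin (2 * q + 1) ≃ Fin n ⊕ Fin f}
    {e : Fin (2 * (q + 1)) ≃ Option (Fin n ⊕ Fin f)} {G₀ G₁ : ℝ → ℝ × BdModel n f → CylMatrix n f}
    {C : Set (BdModel n f)} (hC : IsCompact C)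
    (h : ∀ u ∈ C, ∀ t,
      Tendsto (eulerIntegrand o e G₀ G₁) (𝓝[{z | 0 < z.1.1}] ((0, u), t)) (𝓝 0))
    {δ : ℝ} (hδ : 0 < δ) :
    ∀ᶠ ε in 𝓝[>] (0 : ℝ), ∀ u ∈ C, |transgressionEuler o e (G₀ ε) (G₁ ε) (ε, u)| ≤ δ := by
  have hq : (0 : ℝ) < (q : ℝ) + 1 := by positivity
  filter_upwards [eventually_abs_le_of_tendsto hC (fun u hu t _ => h u hu t) (div_pos hδ hq)]
    with ε hε u hu
  rw [transgressionEuler, abs_neg, abs_mul, abs_of_pos hq, ← le_div_iff₀' hq]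
  exact abs_intervalIntegral_le fun t ht => hε u hu t ht

theorem eventually_abs_transgressionL_le (k : ℕ) {q : ℕ} {o : Fin (2 * q + 1) ≃ Fin n ⊕ Fin f}
    {G₀ G₁ : ℝ → ℝ × BdModel n f → CylMatrix n f} {C : Set (BdModel n f)} (hC : IsCompact C)
    (h : ∀ u ∈ C, ∀ t,
      Tendsto (hirzebruchIntegrand k o G₀ G₁) (𝓝[{z | 0 < z.1.1}] ((0, u), t)) (𝓝 0))
    {δ : ℝ} (hδ : 0 < δ) :
    ∀ᶠ ε in 𝓝[>] (0 : ℝ), ∀ u ∈ C, |transgressionL k o (G₀ ε) (G₁ ε) (ε, u)| ≤ δ := by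
  have hq : (0 : ℝ) < (q : ℝ) + 1 := by positivity
  filter_upwards [eventually_abs_le_of_tendsto hC (fun u hu t _ => h u hu t) (div_pos hδ hq)]
    with ε hε u hu
  rw [transgressionL, abs_mul, abs_of_pos hq, ← le_div_iff₀' hq]
  exact abs_intervalIntegral_le fun t ht => hε u hu t ht

/-- The integrals of a family of densities which tends to zero uniformly on compact subsets of the
charts tend to zero. -/
theorem OrientedFibredAtlas.tendsto_integral [CompactSpace W] (U : OrientedFibredAtlas D)
    {dens : ℝ → OpenPartialHomeomorph W (BdModel n f) → BdModel n f → ℝ}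
    (h : ∀ a, ∀ K ⊆ (U.chart a).target, IsCompact K → ∀ δ > 0,
      ∀ᶠ ε in 𝓝[>] (0 : ℝ), ∀ u ∈ K, |dens ε (U.chart a) u| ≤ δ) :
    Tendsto (fun ε => U.integral (dens ε)) (𝓝[>] 0) (𝓝 0) := by
  have key : ∀ a, Tendsto (fun ε => ∫ u in (U.chart a).target,
      U.ρ a ((U.chart a).symm u) * dens ε (U.chart a) u) (𝓝[>] 0) (𝓝 0) := by
    intro a
    set χ := U.chart a with hχ
    set K : Set (BdModel n f) := χ '' tsupport (U.ρ a) with hK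
    have hKc : IsCompact K := (isClosed_tsupport _).isCompact.image_of_continuousOn
      (χ.continuousOn.mono (U.tsupport_ρ a))
    have hKs : K ⊆ χ.target := by
      rintro _ ⟨w, hw, rfl⟩
      exact χ.map_source (U.tsupport_ρ a hw)
    have hρ : ∀ w, |U.ρ a w| ≤ 1 := by
      intro w
      rw [abs_of_nonneg (U.ρ_nonneg a w), ← U.sum_ρ w]
      exact Finset.single_le_sum (fun b _ => U.ρ_nonneg b w) (Finset.mem_univ a)
    -- Outside the compact image of the support of the partition function the integrand is zero, so
    -- uniform control on compact sets suffices.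
    have hint : ∀ ε, ∫ u in χ.target, U.ρ a (χ.symm u) * dens ε χ u =
        ∫ u in K, U.ρ a (χ.symm u) * dens ε χ u := by
      intro ε
      refine (setIntegral_eq_of_subset_of_forall_sdiff_eq_zero χ.open_target.measurableSet hKs
        fun u hu => ?_)
      have : U.ρ a (χ.symm u) = 0 := by
        by_contra hne
        exact hu.2 ⟨χ.symm u, subset_tsupport _ hne, χ.right_inv hu.1⟩
      rw [this, zero_mul]
    have hfin : volume K < ⊤ := hKc.measure_lt_top
    simp only [hint]
    rw [Metric.tendsto_nhds]
    intro η hη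
    -- Adding 1 keeps the quotient meaningful when K has measure zero and makes the final inequality
    -- strict.
    have hpos : 0 < volume.real K + 1 := by positivity
    filter_upwards [h a K hKs hKc (η / (volume.real K + 1)) (div_pos hη hpos)] with ε hε
    rw [dist_zero_right]
    -- A pointwise bound on a set of finite measure bounds the integral without any measurability of
    -- the density, since the integral of a non-integrable function is 0.
    have hle : ‖∫ u in K, U.ρ a (χ.symm u) * dens ε χ u‖ ≤
        η / (volume.real K + 1) * volume.real K := by
      refine norm_setIntegral_le_of_norm_le_const hfin fun u hu => ?_
      rw [norm_mul, Real.norm_eq_abs, Real.norm_eq_abs]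
      calc |U.ρ a (χ.symm u)| * |dens ε χ u| ≤ 1 * (η / (volume.real K + 1)) :=
            mul_le_mul (hρ _) (hε u hu) (abs_nonneg _) zero_le_one
        _ = _ := one_mul _
    refine hle.trans_lt ?_
    rw [div_mul_eq_mul_div, div_lt_iff₀ hpos]
    nlinarith
  have := tendsto_finsetSum Finset.univ fun a _ => key a
  simpa [OrientedFibredAtlas.integral] using this

end Integration

end PhiCS

end

theorem mainTheorem5 (k n f : ℕ) (hdim : n + f + 1 = 4 * k)
    (M : Type*) [TopologicalSpace M] [ChartedSpace (EuclideanHalfSpace (n + f + 1)) M]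
    [IsManifold (𝓡∂ (n + f + 1)) ∞ M] [T2Space M] [CompactSpace M]
    (W : Type*) [TopologicalSpace W] [ChartedSpace (PhiCS.BdModel n f) W]
    [IsManifold 𝓘(ℝ, PhiCS.BdModel n f) ∞ W] [T2Space W] [CompactSpace W]
    (N : Type*) [TopologicalSpace N] [ChartedSpace (EuclideanSpace ℝ (Fin n)) N]
    [IsManifold (𝓡 n) ∞ N] [T2Space N] [CompactSpace N]
    (F : Type*) [TopologicalSpace F] [ChartedSpace (EuclideanSpace ℝ (Fin f)) F]
    [IsManifold (𝓡 f) ∞ F] [T2Space F] [CompactSpace F]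
    (D : PhiCS.FibredBoundary n f M W N F) (S : PhiCS.Splitting D)
    (Q : PhiCS.ProductData S) (A B : PhiCS.PhiTensor n f W)
    (hAi : A.CondI S) (hAii : A.CondII S)
    (G : PhiCS.ExactPhiMetric Q A B) (K : PhiCS.AuxiliaryFamily Q A)
    (U : PhiCS.OrientedFibredAtlas D) :
    (Odd f →
      Tendsto (fun ε : ℝ => -PhiCS.integralTe k hdim U K G ε) (𝓝[>] 0) (𝓝 0)) ∧
    (f = 1 →
      Tendsto (fun ε : ℝ => -PhiCS.integralTL k hdim U K G ε) (𝓝[>] 0) (𝓝 0)) := by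
  -- In each chart the auxiliary and the φ-metric jets are regular over the same `limitMetric`, with
  -- different constants in the x-derivative.
  have r₀ := fun a => PhiCS.auxJet_isRegular_kappa K (U.isFibred a)
  have r₁ := fun a => PhiCS.phiJet_isRegular_of_condI (Q := Q) (B := B) (U.isFibred a) hAi
  have hH := fun a => PhiCS.limitMetric_isBlockMetric Q (U.isFibred a)
  constructor
  · intro hf
    suffices key : Tendsto (fun ε : ℝ => PhiCS.integralTe k hdim U K G ε) (𝓝[>] 0) (𝓝 0) by
      simpa using key.neg
    refine U.tendsto_integral fun a C hC hCc δ hδ => ?_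
    exact PhiCS.eventually_abs_transgressionEuler_le hCc (fun u hu t =>
      PhiCS.tendsto_eulerIntegrand _ _ (U.chart a).open_target (hH a) (r₀ a) (r₁ a)
        (PhiCS.auxJet_represents_gram K (U.isFibred a))
        (PhiCS.phiJet_represents_gram (U.isFibred a) G) hf (hC hu) t) hδ
  · intro hf
    suffices key : Tendsto (fun ε : ℝ => PhiCS.integralTL k hdim U K G ε) (𝓝[>] 0) (𝓝 0) by
      simpa using key.neg
    refine U.tendsto_integral fun a C hC hCc δ hδ => ?_
    exact PhiCS.eventually_abs_transgressionL_le k hCc (fun u hu t =>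
      PhiCS.tendsto_hirzebruchIntegrand k _ (U.chart a).open_target (hH a) (r₀ a) (r₁ a)
        (PhiCS.auxJet_represents_gram K (U.isFibred a))
        (PhiCS.phiJet_represents_gram (U.isFibred a) G) hf (hC hu) t) hδ
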